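/- **Theorem (search-to-decision reduction for Alternating Matrix Space Isometry).** An $n\times n$ matrix $X$ over a field $\mathbb{F}$ is *alternating* if $v^tXv=0$ for all $v\in\mathbb{F}^n$; two linear spaces $\mathcal{A},\mathcal{B}$ of $n\times n$ matrices over $\mathbb F$ are *isometric* if there is $P\in\mathrm{GL}(n,\mathbb{F})$ (an *isometry*) with $P^t\mathcal{A}P=\mathcal{B}$. *Alternating Matrix Space Isometry over $\mathbb{F}_q$* is the problem of deciding, given linear bases of two spaces of alternating matrices of the same size over $\mathbb{F}_q$, whether the spaces are isometric. There are a single deterministic oracle algorithm and an absolute constant $C$ such that the following holds for every prime power $q$, where $\mathbb{F}_q=\mathbb{F}_p[\alpha]$ is presented to the algorithm by $p$ and the minimal polynomial of $\alpha$ over $\mathbb{F}_p$, and for every oracle that decides Alternating Matrix Space Isometry over $\mathbb{F}_q$. Given $n\ge 1$ and linear bases of two spaces $\mathcal{A},\mathcal{B}$ of alternating $n\times n$ matrices over $\mathbb{F}_q$, the algorithm halts; it outputs some $P\in\mathrm{GL}(n,\mathbb{F}_q)$ with $P^t\mathcal{A}P=\mathcal{B}$ if $\mathcal{A}$ and $\mathcal{B}$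 are isometric, and reports that they are not isometric otherwise. Moreover: 1. its running time is at most $q^{Cn}\cdot n!$, and at most $q^{Cn(1+\lfloor\log_2 n\rfloor)}$; that is, it is $q^{O(n)}\cdot n!=q^{\tilde O(n)}$; 2. it makes at most $q^{Cn}$ oracle queries; 3. every query is an instance of Alternating Matrix Space Isometry over $\mathbb{F}_q$ of size at most $Cn^2$: two linearly independent tuples, each of at most $Cn^2$ alternating $N\times N$ matrices, with $N\le Cn^2$. (Running time is counted on binary-tree data: each elementary operation, including an oracle call, costs the size of the data it reads and writes, up to constant factors; numbers $<p$ are written in binary, and the matrix dimension in unary.) -/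

import Mathlib

namespace AltMatSpace

/-! ### The machine model

Data are binary trees (S-expressions), the words of the machine. A program is a first-order
expression over the tree operations, with branching, unbounded iteration and oracle calls. Every
elementary step is charged the size of the data it reads plus the size of the data it writes, with
no sharing of subtrees, so that a multitape oracle Turing machine working on the parenthesized
words simulates a run in time linear in its cost. -/

/-- Binary trees. -/
inductive Val : Type
  | nil : Val
  | cons (a b : Val) : Val

/-- The number of nodes of a tree, i.e. the length of its written form. -/
def Val.size : Val → ℕ
  | .nil => 1
  | .cons a b => a.size + b.size + 1

/-- First component. -/
def Val.fst : Val → Val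
  | .nil => .nil
  | .cons a _ => a

/-- Second component. -/
def Val.snd : Val → Val
  | .nil => .nil
  | .cons _ b => b

/-- Boolean values as trees. -/
def encBool : Bool → Val
  | false => .nil
  | true => .cons .nil .nil

/-- Oracle programs. -/
inductive Prog : Type
  | nil : Prog                    -- the constant `nil`
  | id : Prog
  | fst : Prog
  | snd : Prog
  | pair (f g : Prog) : Prog      -- `x ↦ cons (f x) (g x)`
  | comp (g f : Prog) : Prog      -- `x ↦ g (f x)`
  | ite (c f g : Prog) : Prog     -- `if c x ≠ nil then f x else g x`
  | loop (f : Prog) : Prog        -- `while fst x ≠ nil do x := f x`, then return `x`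
  | ask : Prog                    -- `x ↦` the oracle's answer on `x`

/-- `Run O P x y t qs`: with oracle `O`, the program `P` halts on input `x` with output `y` after a
computation of cost `t` during which it submits to the oracle exactly the queries in the list `qs`
(in this order, with repetitions). -/
inductive Run (O : Val → Bool) : Prog → Val → Val → ℕ → List Val → Prop
  | nil (x : Val) : Run O .nil x .nil (x.size + Val.nil.size) []
  | id (x : Val) : Run O .id x x (x.size + x.size) []
  | fst (x : Val) : Run O .fst x x.fst (x.size + x.fst.size) []
  | snd (x : Val) : Run O .snd x x.snd (x.size + x.snd.size) []
  | pair {f g : Prog} {x y z : Val} {t u : ℕ} {qs rs : List Val} :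
      Run O f x y t qs → Run O g x z u rs →
      Run O (.pair f g) x (.cons y z) (t + u + (x.size + (Val.cons y z).size)) (qs ++ rs)
  | comp {f g : Prog} {x y z : Val} {t u : ℕ} {qs rs : List Val} :
      Run O f x y t qs → Run O g y z u rs →
      Run O (.comp g f) x z (t + u + 1) (qs ++ rs)
  | iteTrue {c f g : Prog} {x b y : Val} {t u : ℕ} {qs rs : List Val} :
      Run O c x b t qs → b ≠ .nil → Run O f x y u rs →
      Run O (.ite c f g) x y (t + u + (x.size + b.size)) (qs ++ rs)
  | iteFalse {c f g : Prog} {x b y : Val} {t u : ℕ} {qs rs : List Val} :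
      Run O c x b t qs → b = .nil → Run O g x y u rs →
      Run O (.ite c f g) x y (t + u + (x.size + b.size)) (qs ++ rs)
  | loopDone {f : Prog} {x : Val} :
      x.fst = .nil → Run O (.loop f) x x (x.size + x.size) []
  | loopStep {f : Prog} {x y z : Val} {t u : ℕ} {qs rs : List Val} :
      x.fst ≠ .nil → Run O f x y t qs → Run O (.loop f) y z u rs →
      Run O (.loop f) x z (t + u + (x.size + y.size)) (qs ++ rs)
  | ask (x : Val) : Run O .ask x (encBool (O x)) (x.size + (encBool (O x)).size) [x]

/-- A program has at most one run on a given input. -/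
theorem Run.deterministic {O : Val → Bool} {P : Prog} {x y z : Val} {t u : ℕ} {qs rs : List Val}
    (h : Run O P x y t qs) (h' : Run O P x z u rs) : y = z ∧ t = u ∧ qs = rs := by
  induction h generalizing z u rs with
  | nil x => cases h'; simp
  | id x => cases h'; simp
  | fst x => cases h'; simp
  | snd x => cases h'; simp
  | ask x => cases h'; simp
  | pair _ _ ih₁ ih₂ =>
    cases h' with
    | pair a b =>
      obtain ⟨rfl, rfl, rfl⟩ := ih₁ a
      obtain ⟨rfl, rfl, rfl⟩ := ih₂ b
      simp
  | comp _ _ ih₁ ih₂ =>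
    cases h' with
    | comp a b =>
      obtain ⟨rfl, rfl, rfl⟩ := ih₁ a
      obtain ⟨rfl, rfl, rfl⟩ := ih₂ b
      simp
  | iteTrue _ hb _ ih₁ ih₂ =>
    cases h' with
    | iteTrue a hb' b =>
      obtain ⟨rfl, rfl, rfl⟩ := ih₁ a
      obtain ⟨rfl, rfl, rfl⟩ := ih₂ b
      simp
    | iteFalse a hb' b => exact absurd ((ih₁ a).1.trans hb') hb
  | iteFalse _ hb _ ih₁ ih₂ =>
    cases h' with
    | iteTrue a hb' b => exact absurd ((ih₁ a).1.symm.trans hb) hb'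
    | iteFalse a hb' b =>
      obtain ⟨rfl, rfl, rfl⟩ := ih₁ a
      obtain ⟨rfl, rfl, rfl⟩ := ih₂ b
      simp
  | loopDone hx =>
    cases h' with
    | loopDone _ => simp
    | loopStep hx' _ _ => exact absurd hx hx'
  | loopStep hx _ _ ih₁ ih₂ =>
    cases h' with
    | loopDone hx' => exact absurd hx' hx
    | loopStep _ a b =>
      obtain ⟨rfl, rfl, rfl⟩ := ih₁ a
      obtain ⟨rfl, rfl, rfl⟩ := ih₂ b
      simp

/-! ### Alternating matrix spaces and isometry -/

section Spaces

variable {F : Type*} [Field F]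

/-- A square matrix `X` is alternating if `vᵗ X v = 0` for all vectors `v`. -/
def IsAlternating {n : ℕ} (X : Matrix (Fin n) (Fin n) F) : Prop :=
  ∀ v : Fin n → F, dotProduct v (X.mulVec v) = 0

/-- `A` is an ordered linear basis of a space of alternating `n × n` matrices. -/
def IsAltBasis {n m : ℕ} (A : Fin m → Matrix (Fin n) (Fin n) F) : Prop :=
  (∀ k, IsAlternating (A k)) ∧ LinearIndependent F A

/-- The matrix space spanned by a tuple of matrices. -/
def space {n m : ℕ} (A : Fin m → Matrix (Fin n) (Fin n) F) :
    Submodule F (Matrix (Fin n) (Fin n) F) :=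
  Submodule.span F (Set.range A)

/-- `P` is an isometry from `S` to `T`: `Pᵗ S P = T`. -/
def IsIsometry {n : ℕ} (P : Matrix.GeneralLinearGroup (Fin n) F)
    (S T : Submodule F (Matrix (Fin n) (Fin n) F)) : Prop :=
  (fun X : Matrix (Fin n) (Fin n) F =>
    (P : Matrix (Fin n) (Fin n) F).transpose * X * (P : Matrix (Fin n) (Fin n) F)) ''
    (S : Set (Matrix (Fin n) (Fin n) F)) = (T : Set (Matrix (Fin n) (Fin n) F))

/-- Two matrix spaces are isometric. -/
def Isometric {n : ℕ} (S T : Submodule F (Matrix (Fin n) (Fin n) F)) : Prop :=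
  ∃ P : Matrix.GeneralLinearGroup (Fin n) F, IsIsometry P S T

end Spaces

/-! ### Encodings

A finite field `F` is presented as `𝔽_p[α]` with `α` a generator of `F` over its prime field: the
presentation consists of `p` in binary and the nonleading coefficients of the minimal polynomial
of `α`, and an element is written as its coordinate vector in the basis `1, α, α², …`. -/

/-- Lists. -/
def encList {T : Type*} (enc : T → Val) : List T → Val
  | [] => .nil
  | a :: l => .cons (enc a) (encList enc l)

/-- Natural numbers in binary, least significant bit first. -/
def encNat (k : ℕ) : Val := encList encBool k.bits

/-- Natural numbers in unary. -/
def encUnary (k : ℕ) : Val := encList encBool (List.replicate k false)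

/-- Residues modulo `p`, as binary representatives in `[0, p)`. -/
def encZMod {p : ℕ} (a : ZMod p) : Val := encNat a.val

section Encodings

variable {p : ℕ} {F : Type*} [Field F] [Algebra (ZMod p) F] (pb : PowerBasis (ZMod p) F)

/-- The presentation of the field. -/
noncomputable def encField : Val :=
  .cons (encNat p)
    (encList encZMod (List.ofFn fun i : Fin pb.dim => (minpoly (ZMod p) pb.gen).coeff i))

/-- A field element. -/
noncomputable def encElt (a : F) : Val :=
  encList encZMod (List.ofFn fun i : Fin pb.dim => pb.basis.repr a i)

/-- A matrix, as the list of its rows. -/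
noncomputable def encMatrix {n : ℕ} (X : Matrix (Fin n) (Fin n) F) : Val :=
  encList (encList (encElt pb)) (List.ofFn fun i => List.ofFn fun j => X i j)

/-- A tuple of matrices. -/
noncomputable def encTuple {n m : ℕ} (A : Fin m → Matrix (Fin n) (Fin n) F) : Val :=
  encList (encMatrix pb) (List.ofFn A)

/-- An instance of the isometry problem over `F`: the dimension and the two bases. -/
noncomputable def encInstance {n m m' : ℕ} (A : Fin m → Matrix (Fin n) (Fin n) F)
    (B : Fin m' → Matrix (Fin n) (Fin n) F) : Val :=
  .cons (encUnary n) (.cons (encTuple pb A) (encTuple pb B))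

/-- The input of the search problem: the field and an instance over it. -/
noncomputable def encInput {n m m' : ℕ} (A : Fin m → Matrix (Fin n) (Fin n) F)
    (B : Fin m' → Matrix (Fin n) (Fin n) F) : Val :=
  .cons (encField pb) (encInstance pb A B)

/-- The output of the search problem: a matrix, or `nil` for "not isometric". -/
noncomputable def encOutput {n : ℕ} : Option (Matrix (Fin n) (Fin n) F) → Val
  | none => .nil
  | some X => .cons .nil (encMatrix pb X)

/-- `O` decides Alternating Matrix Space Isometry over `F`. Nothing is required of its answers on
words that do not encode an instance of the problem. -/
def IsDecisionOracle (O : Val → Bool) : Prop :=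
  ∀ (N m m' : ℕ) (A : Fin m → Matrix (Fin N) (Fin N) F) (B : Fin m' → Matrix (Fin N) (Fin N) F),
    IsAltBasis A → IsAltBasis B →
      (O (encInstance pb A B) = true ↔ Isometric (space A) (space B))

/-- The word `w` encodes an instance of Alternating Matrix Space Isometry over `F` made of spaces of
dimension at most `s` of matrices with at most `s` rows and columns. -/
def IsInstanceOfSize (s : ℕ) (w : Val) : Prop :=
  ∃ (N m m' : ℕ) (A : Fin m → Matrix (Fin N) (Fin N) F) (B : Fin m' → Matrix (Fin N) (Fin N) F),
    IsAltBasis A ∧ IsAltBasis B ∧ w = encInstance pb A B ∧ N ≤ s ∧ m ≤ s ∧ m' ≤ s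

/-- `y` is a correct answer to the search problem for `S` and `T`. -/
def IsSolution {n : ℕ} (S T : Submodule F (Matrix (Fin n) (Fin n) F)) (y : Val) : Prop :=
  (∃ P : Matrix.GeneralLinearGroup (Fin n) F, IsIsometry P S T ∧
      y = encOutput pb (some (P : Matrix (Fin n) (Fin n) F))) ∨
    (¬ Isometric S T ∧ y = encOutput pb (none : Option (Matrix (Fin n) (Fin n) F)))

end Encodings

end AltMatSpace

open AltMatSpace

/-! An isometry `P` is found one row at a time. Suppose the first rows `v₁, …, vᵢ₋₁` are such that
some isometry sends the standard row `eⱼ` to `vⱼ` for every `j < i`. All nonzero rows `v` are tried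
for the next place, and the oracle is asked whether some isometry sends `e₁, …, eᵢ` to `v₁, …, vᵢ₋₁,
v`. The row `eᵢ P` of any isometry compatible with the earlier choices passes, so a candidate is
always found. After `n` rounds the chosen rows are the rows of an isometry. This takes at most `1 +
n qⁿ` queries, and all other work is polynomial in `qⁿ`.

The constrained question must itself be an isometry problem; this is the task of the gadget. To the
matrices of `A` one adjoins `n + 1` frame coordinates, a matrix coupling them to the original
coordinates through `S` (whose rows are the prescribed vectors, padded by zero), and marking
coordinates. The marking coordinates are of two kinds. There are `2n + 2` free ones, coupled
arbitrarily to the `2n + 1` core coordinates. The others are attached to the `n + 1` frame vectors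
and to their sum, the `i`-th of these lines receiving `i + 1` coordinates, counted from `i = 0`.

The gadget is rigid for linear-algebraic reasons. The dimension of `{M x}`, with `M` in the space,
is at most `2n + 1` for vectors supported on the marking coordinates and at least `2n + 2` for all
others, so a congruence preserves the marking subspace (`toBlocks₁₂_eq_zero`). The induced map on
the core must permute the marked lines, and their pairwise distinct multiplicities force it to fix
each of them (`finrank_markSpace`, `mulVec_lineVec`). Fixing the lines of a basis and of its sum, it
is scalar on the frame. What remains is an isometry `P` of the original spaces with `S P`
proportional to `T` (`gadget_rigid`). Rescaling `P` removes the factor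
(`isometric_gadgetTuple_iff`).

The cost analysis rests on a calculus of programs whose running time is polynomial in the input size
plus a cost parameter (`Realizes`), where loops are folds over lists (`Realizes.fold`). Only unary
conversion of the characteristic and the enumeration of field elements and rows exceed polynomial
time. Their traces are bounded by polynomials in `qⁿ` (`size_add_envCost_le`), which gives time
`q^(Cn)`. -/

namespace AltMatSpace

/-! ### Polynomially bounded quantities -/

/-- `t` is bounded by a fixed power of `b`. -/
def PolyBounded {α : Type*} (b t : α → ℕ) : Prop := ∃ c : ℕ, ∀ a, t a ≤ b a ^ c

namespace PolyBounded
variable {α : Type*} {b t u : α → ℕ}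

theorem mono (hu : PolyBounded b u) (h : ∀ a, t a ≤ u a) : PolyBounded b t := by
  obtain ⟨c, hc⟩ := hu
  exact ⟨c, fun a => (h a).trans (hc a)⟩

theorem self (b : α → ℕ) : PolyBounded b b := ⟨1, fun a => by simp⟩

theorem mul (ht : PolyBounded b t) (hu : PolyBounded b u) :
    PolyBounded b (fun a => t a * u a) := by
  obtain ⟨c, hc⟩ := ht
  obtain ⟨d, hd⟩ := hu
  exact ⟨c + d, fun a => by rw [pow_add]; exact Nat.mul_le_mul (hc a) (hd a)⟩

theorem pow (ht : PolyBounded b t) (k : ℕ) : PolyBounded b (fun a => t a ^ k) := by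
  obtain ⟨c, hc⟩ := ht
  exact ⟨c * k, fun a => by rw [pow_mul]; exact Nat.pow_le_pow_left (hc a) k⟩

theorem const (hb : ∀ a, 2 ≤ b a) (k : ℕ) : PolyBounded b (fun _ => k) :=
  ⟨k, fun a => (Nat.lt_two_pow_self.le).trans (Nat.pow_le_pow_left (hb a) k)⟩

theorem add (hb : ∀ a, 2 ≤ b a) (ht : PolyBounded b t) (hu : PolyBounded b u) :
    PolyBounded b (fun a => t a + u a) := by
  obtain ⟨c, hc⟩ := ht
  obtain ⟨d, hd⟩ := hu
  -- The additional exponent absorbs the factor 2, because the base is at least 2.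
  refine ⟨c + d + 1, fun a => ?_⟩
  have h1 : b a ^ c ≤ b a ^ (c + d) := Nat.pow_le_pow_right (by linarith [hb a]) (by omega)
  have h2 : b a ^ d ≤ b a ^ (c + d) := Nat.pow_le_pow_right (by linarith [hb a]) (by omega)
  calc t a + u a ≤ b a ^ (c + d) + b a ^ (c + d) := by linarith [hc a, hd a]
    _ = b a ^ (c + d) * 2 := by ring
    _ ≤ b a ^ (c + d + 1) := by rw [pow_succ]; exact Nat.mul_le_mul_left _ (hb a)

end PolyBounded

/-! ### Realizable functions -/

theorem Val.size_pos (x : Val) : 1 ≤ x.size := by cases x <;> simp [Val.size]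

@[simp] theorem Val.size_nil : Val.nil.size = 1 := rfl
@[simp] theorem Val.size_cons (a b : Val) : (Val.cons a b).size = a.size + b.size + 1 := rfl
@[simp] theorem Val.fst_cons (a b : Val) : (Val.cons a b).fst = a := rfl
@[simp] theorem Val.snd_cons (a b : Val) : (Val.cons a b).snd = b := rfl
@[simp] theorem Val.fst_nil : Val.nil.fst = .nil := rfl
@[simp] theorem Val.snd_nil : Val.nil.snd = .nil := rfl

theorem Val.size_fst_le (x : Val) : x.fst.size ≤ x.size := by
  cases x <;> simp; omega

theorem Val.size_snd_le (x : Val) : x.snd.size ≤ x.size := by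
  cases x <;> simp; omega

/-- Every elementary step is charged for what it writes. Hence a time bound for one program also
bounds the input of the program that follows it. -/
theorem Run.size_le {O : Val → Bool} {P : Prog} {x y : Val} {t : ℕ} {qs : List Val}
    (h : Run O P x y t qs) : y.size ≤ t := by
  induction h <;> omega

/-- Branching on whether a value is `nil`. -/
def iteV {α : Type*} (c : Val) (a b : α) : α :=
  match c with
  | .nil => b
  | .cons _ _ => a

@[simp] theorem iteV_nil {α : Type*} (a b : α) : iteV .nil a b = b := rfl
@[simp] theorem iteV_cons {α : Type*} (c d : Val) (a b : α) : iteV (.cons c d) a b = a := rfl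

/-- A function with oracle access, producing a value and the list of queries made, is realized by
one program whose cost is polynomial in the size of the input plus `T`. -/
def Realizes (T : Val → ℕ) (f : (Val → Bool) → Val → Val × List Val) : Prop :=
  ∃ (P : Prog) (c : ℕ), ∀ O x, ∃ t, Run O P x (f O x).1 t (f O x).2 ∧
    t ≤ (x.size + T x + 1) ^ c

/-- A function computed without oracle in polynomial time. -/
def PolyTime (f : Val → Val) : Prop := Realizes (fun _ => 0) fun _ x => (f x, [])

theorem two_le_base (T : Val → ℕ) (x : Val) : 2 ≤ x.size + T x + 1 := by
  have := x.size_pos; omega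

/-- To realize a function it suffices to exhibit a program and a polynomially bounded cost. -/
theorem Realizes.intro {T : Val → ℕ} {f : (Val → Bool) → Val → Val × List Val} (P : Prog)
    (t : Val → ℕ) (ht : PolyBounded (fun x => x.size + T x + 1) t)
    (h : ∀ O x, ∃ u, Run O P x (f O x).1 u (f O x).2 ∧ u ≤ t x) : Realizes T f := by
  obtain ⟨c, hc⟩ := ht
  refine ⟨P, c, fun O x => ?_⟩
  obtain ⟨u, hu, hut⟩ := h O x
  exact ⟨u, hu, hut.trans (hc x)⟩

theorem polyBounded_size (T : Val → ℕ) : PolyBounded (fun x => x.size + T x + 1) Val.size :=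
  (PolyBounded.self _).mono fun a => by omega

namespace Realizes
variable {T : Val → ℕ} {f g h : (Val → Bool) → Val → Val × List Val}

theorem congr (hf : Realizes T f) (hfg : ∀ O x, f O x = g O x) : Realizes T g := by
  have : f = g := by funext O x; exact hfg O x
  exact this ▸ hf

theorem mono {T' : Val → ℕ} (hf : Realizes T f)
    (hT : PolyBounded (fun x => x.size + T' x + 1) T) : Realizes T' f := by
  obtain ⟨P, c, hP⟩ := hf
  refine Realizes.intro P (fun x => (x.size + T x + 1) ^ c) ?_ fun O x => hP O x
  refine PolyBounded.pow ?_ c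
  exact ((polyBounded_size T').add (two_le_base T') hT).add (two_le_base T')
    (PolyBounded.const (two_le_base T') 1)

theorem mono' {T' : Val → ℕ} (hf : Realizes T f) (hT : ∀ x, T x ≤ T' x) : Realizes T' f :=
  hf.mono ((PolyBounded.self _).mono fun x => by have := hT x; omega)

theorem of_zero (hf : Realizes (fun _ => 0) f) : Realizes T f := hf.mono' fun _ => Nat.zero_le _

theorem pair (hf : Realizes T f) (hg : Realizes T g) :
    Realizes T fun O x => (.cons (f O x).1 (g O x).1, (f O x).2 ++ (g O x).2) := by
  obtain ⟨P, c, hP⟩ := hf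
  obtain ⟨P', c', hP'⟩ := hg
  refine Realizes.intro (.pair P P')
    (fun x => 2 * ((x.size + T x + 1) ^ c + (x.size + T x + 1) ^ c') + x.size + 1) ?_ fun O x => ?_
  · have hb := two_le_base T
    exact ((((PolyBounded.const hb 2).mul (((PolyBounded.self _).pow c).add hb
      ((PolyBounded.self _).pow c'))).add hb (polyBounded_size T))).add hb
        (PolyBounded.const hb 1)
  · obtain ⟨t, ht, hle⟩ := hP O x
    obtain ⟨t', ht', hle'⟩ := hP' O x
    refine ⟨_, .pair ht ht', ?_⟩
    have := ht.size_le
    have := ht'.size_le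
    simp only [Val.size_cons]
    omega

/-- The intermediate value is no larger than the cost of producing it, so the second polynomial is
evaluated at a polynomial quantity. The hypothesis `hT` does the same for the cost parameter of the
second program. -/
theorem comp {T' : Val → ℕ} (hg : Realizes T' g) (hf : Realizes T f)
    (hT : ∀ O x, T' (f O x).1 ≤ T x) :
    Realizes T fun O x => ((g O (f O x).1).1, (f O x).2 ++ (g O (f O x).1).2) := by
  obtain ⟨P, c, hP⟩ := hf
  obtain ⟨P', c', hP'⟩ := hg
  refine Realizes.intro (.comp P' P) (fun x => (x.size + T x + 1) ^ c +
    ((x.size + T x + 1) ^ c + (x.size + T x + 1)) ^ c' + 1) ?_ fun O x => ?_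
  · have hb := two_le_base T
    exact (((PolyBounded.self _).pow c).add hb ((((PolyBounded.self _).pow c).add hb
      (PolyBounded.self _)).pow c')).add hb (PolyBounded.const hb 1)
  · obtain ⟨t, ht, hle⟩ := hP O x
    obtain ⟨t', ht', hle'⟩ := hP' O (f O x).1
    refine ⟨_, .comp ht ht', ?_⟩
    have h1 := ht.size_le
    have h2 := hT O x
    have h3 : ((f O x).1.size + T' (f O x).1 + 1) ^ c' ≤
        ((x.size + T x + 1) ^ c + (x.size + T x + 1)) ^ c' := Nat.pow_le_pow_left (by omega) c'
    omega

theorem ite (hh : Realizes T h) (hf : Realizes T f) (hg : Realizes T g) :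
    Realizes T fun O x => iteV (h O x).1 ((f O x).1, (h O x).2 ++ (f O x).2)
      ((g O x).1, (h O x).2 ++ (g O x).2) := by
  obtain ⟨P, c, hP⟩ := hf
  obtain ⟨P', c', hP'⟩ := hg
  obtain ⟨Q, d, hQ⟩ := hh
  refine Realizes.intro (.ite Q P P') (fun x => 2 * (x.size + T x + 1) ^ d +
    ((x.size + T x + 1) ^ c + (x.size + T x + 1) ^ c') + x.size) ?_ fun O x => ?_
  · have hb := two_le_base T
    exact (((PolyBounded.const hb 2).mul ((PolyBounded.self _).pow d)).add hb
      (((PolyBounded.self _).pow c).add hb ((PolyBounded.self _).pow c'))).add hb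
        (polyBounded_size T)
  · obtain ⟨t, ht, hle⟩ := hQ O x
    have h1 := ht.size_le
    cases hx : (h O x).1 with
    | nil =>
      obtain ⟨t', ht', hle'⟩ := hP' O x
      exact ⟨_, .iteFalse ht hx ht', by omega⟩
    | cons a b =>
      obtain ⟨t', ht', hle'⟩ := hP O x
      exact ⟨_, .iteTrue ht (by simp [hx]) ht', by omega⟩

theorem ask : Realizes T fun O x => (encBool (O x), [x]) := by
  refine Realizes.intro .ask (fun x => x.size + 3) ?_ fun O x => ⟨_, .ask x, ?_⟩
  · exact (polyBounded_size T).add (two_le_base T) (PolyBounded.const (two_le_base T) 3)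
  · cases O x <;> simp [encBool]

end Realizes

namespace PolyTime

theorem const_nil : PolyTime fun _ => .nil :=
  Realizes.intro .nil (fun x => x.size + 1)
    ((polyBounded_size fun _ => 0).add (two_le_base fun _ => 0) (PolyBounded.const (two_le_base fun _ => 0) 1))
    fun _ x => ⟨_, .nil x, le_rfl⟩

theorem id : PolyTime fun x => x :=
  Realizes.intro .id (fun x => x.size + x.size)
    ((polyBounded_size fun _ => 0).add (two_le_base fun _ => 0) (polyBounded_size fun _ => 0))
    fun _ x => ⟨_, .id x, le_rfl⟩

variable {f g h : Val → Val}

theorem comp (hg : PolyTime g) (hf : PolyTime f) : PolyTime fun x => g (f x) :=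
  Realizes.comp hg hf fun _ _ => le_rfl

theorem fst (hf : PolyTime f) : PolyTime fun x => (f x).fst := by
  refine comp (g := Val.fst) ?_ hf
  refine Realizes.intro .fst (fun x => x.size + x.size)
    ((polyBounded_size fun _ => 0).add (two_le_base fun _ => 0) (polyBounded_size fun _ => 0))
    fun _ x => ⟨_, .fst x, by have := x.size_fst_le; omega⟩

theorem snd (hf : PolyTime f) : PolyTime fun x => (f x).snd := by
  refine comp (g := Val.snd) ?_ hf
  refine Realizes.intro .snd (fun x => x.size + x.size)
    ((polyBounded_size fun _ => 0).add (two_le_base fun _ => 0) (polyBounded_size fun _ => 0))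
    fun _ x => ⟨_, .snd x, by have := x.size_snd_le; omega⟩

theorem cons (hf : PolyTime f) (hg : PolyTime g) : PolyTime fun x => .cons (f x) (g x) :=
  Realizes.pair hf hg

theorem ite (hh : PolyTime h) (hf : PolyTime f) (hg : PolyTime g) :
    PolyTime fun x => iteV (h x) (f x) (g x) := by
  refine Realizes.congr (Realizes.ite hh hf hg) fun O x => ?_
  cases hx : h x <;> simp [hx]

theorem const (v : Val) : PolyTime fun _ => v := by
  induction v with
  | nil => exact const_nil
  | cons a b iha ihb => exact iha.cons ihb

theorem size_bound (hf : PolyTime f) : ∃ c, ∀ x, (f x).size ≤ (x.size + 1) ^ c := by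
  obtain ⟨P, c, hP⟩ := hf
  refine ⟨c, fun x => ?_⟩
  obtain ⟨t, ht, hle⟩ := hP (fun _ => false) x
  exact ht.size_le.trans (by simpa using hle)

end PolyTime

/-! ### Folds -/

/-- The number of entries of a list. -/
def Val.len : Val → ℕ
  | .nil => 0
  | .cons _ b => b.len + 1

theorem Val.len_le_size (x : Val) : x.len ≤ x.size := by
  induction x with
  | nil => simp [Val.len]
  | cons a b _ ih => simp [Val.len]; omega

/-- Left fold over a list. -/
def foldV (h : Val → Val → Val) : Val → Val → Val
  | s, .nil => s
  | s, .cons a b => foldV h (h a s) b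

/-- The queries made during a left fold. -/
def foldQ (h : Val → Val → Val × List Val) : Val → Val → List Val
  | _, .nil => []
  | s, .cons a b => (h a s).2 ++ foldQ h (h a s).1 b

/-- The total size of all states of a left fold. -/
def foldTrace (h : Val → Val → Val) : Val → Val → ℕ
  | s, .nil => s.size
  | s, .cons a b => s.size + foldTrace h (h a s) b

theorem foldQ_pure (h : Val → Val → Val) (s l : Val) : foldQ (fun a s => (h a s, [])) s l = [] := by
  induction l generalizing s with
  | nil => rfl
  | cons a b _ ih => simp [foldQ, ih]

theorem size_le_foldTrace (h : Val → Val → Val) (s l : Val) : s.size ≤ foldTrace h s l := by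
  cases l <;> simp [foldTrace]

/-- The input is a list, an initial state and a fixed environment, and a single `loop` consumes the
list. Each round is polynomial in the size of the current data, which the total size of all states
dominates. The number of rounds is at most the size of the list. -/
theorem Realizes.fold {T : Val → ℕ} {H : (Val → Bool) → Val → Val × List Val}
    (hH : Realizes (fun _ => 0) H)
    (hT : ∀ O x, foldTrace (fun a s => (H O (.cons a (.cons s x.snd.snd))).1) x.snd.fst x.fst ≤
      T x) :
    Realizes T fun O x =>
      (foldV (fun a s => (H O (.cons a (.cons s x.snd.snd))).1) x.snd.fst x.fst,
        foldQ (fun a s => H O (.cons a (.cons s x.snd.snd))) x.snd.fst x.fst) := by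
  -- One round of the loop: the first entry of the remaining list acts on the state, and the
  -- environment is carried along.
  have hbody : Realizes (fun _ => 0) fun O z =>
      (.cons z.fst.snd (.cons (H O (.cons z.fst.fst (.cons z.snd.fst z.snd.snd))).1 z.snd.snd),
        (H O (.cons z.fst.fst (.cons z.snd.fst z.snd.snd))).2) := by
    have h1 : PolyTime fun z => .cons z.fst.fst (.cons z.snd.fst z.snd.snd) :=
      (PolyTime.id.fst.fst).cons ((PolyTime.id.snd.fst).cons PolyTime.id.snd.snd)
    have h2 := Realizes.comp hH h1 fun _ _ => le_rfl
    refine Realizes.congr (Realizes.pair PolyTime.id.fst.snd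
      (Realizes.pair h2 PolyTime.id.snd.snd)) fun O x => ?_
    simp
  obtain ⟨P, c, hP⟩ := hbody
  -- A single `Z` serves all rounds: the trace of the remaining fold contains every later state, so
  -- the hypothesis passes to the tail of the list.
  have key : ∀ (O : Val → Bool) (Z : ℕ) (l s e : Val),
      l.size + foldTrace (fun a s => (H O (.cons a (.cons s e))).1) s l + e.size + 2 ≤ Z →
      ∃ t, Run O (.loop P) (.cons l (.cons s e))
        (.cons .nil (.cons (foldV (fun a s => (H O (.cons a (.cons s e))).1) s l) e)) t
        (foldQ (fun a s => H O (.cons a (.cons s e))) s l) ∧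
        t ≤ (l.len + 1) * ((Z + 1) ^ c + 2 * Z) := by
    intro O Z l
    induction l with
    | nil =>
      intro s e hZ
      refine ⟨_, .loopDone rfl, ?_⟩
      simp [foldTrace] at hZ
      simp [Val.len]
      omega
    | cons a b _ ih =>
      intro s e hZ
      simp only [foldTrace, Val.size_cons] at hZ
      obtain ⟨u, hu, hule⟩ := ih (H O (.cons a (.cons s e))).1 e (by omega)
      obtain ⟨t, ht, htle⟩ := hP O (.cons (.cons a b) (.cons s e))
      simp only [Val.fst_cons, Val.snd_cons] at ht
      refine ⟨_, .loopStep (by simp) ht hu, ?_⟩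
      have h1 := size_le_foldTrace (fun a s => (H O (.cons a (.cons s e))).1)
        (H O (.cons a (.cons s e))).1 b
      have h2 : ((Val.cons (.cons a b) (.cons s e)).size + 0 + 1) ^ c ≤ (Z + 1) ^ c :=
        Nat.pow_le_pow_left (by simp only [Val.size_cons]; omega) c
      have h3 : (Val.cons (.cons a b) (.cons s e)).size ≤ Z := by simp only [Val.size_cons]; omega
      have h4 : (Val.cons b (.cons (H O (.cons a (.cons s e))).1 e)).size ≤ Z := by
        simp only [Val.size_cons]; omega
      have h5 : ((Val.cons a b).len + 1) * ((Z + 1) ^ c + 2 * Z) =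
          (b.len + 1) * ((Z + 1) ^ c + 2 * Z) + ((Z + 1) ^ c + 2 * Z) := by
        simp only [Val.len]; ring
      have h6 : ((Val.cons (.cons a b) (.cons s e)).size + (fun _ => 0)
          ((Val.cons (.cons a b) (.cons s e))) + 1) ^ c ≤ (Z + 1) ^ c := h2
      rw [h5]
      omega
  have hloop : Realizes T fun O x =>
      (.cons .nil (.cons (foldV (fun a s => (H O (.cons a (.cons s x.snd.snd))).1)
        x.snd.fst x.fst) x.snd.snd),
        foldQ (fun a s => H O (.cons a (.cons s x.snd.snd))) x.snd.fst x.fst) := by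
    have hb := two_le_base T
    have hZ : PolyBounded (fun x => x.size + T x + 1) fun x => x.size + T x + x.size + 2 :=
      (((PolyBounded.self _).mono fun x => by omega : PolyBounded _ fun x => x.size + T x).add hb
        (polyBounded_size T)).add hb (PolyBounded.const hb 2)
    refine Realizes.intro (.comp (.loop P) (.pair .fst (.pair (.comp .fst .snd)
      (.comp .snd .snd)))) (fun x => 20 * x.size + 20 + (x.size + 1) *
        ((x.size + T x + x.size + 2 + 1) ^ c + 2 * (x.size + T x + x.size + 2))) ?_ fun O x => ?_
    · exact (((PolyBounded.const hb 20).mul (polyBounded_size T)).add hb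
        (PolyBounded.const hb 20)).add hb (((polyBounded_size T).add hb
          (PolyBounded.const hb 1)).mul
        (((hZ.add hb (PolyBounded.const hb 1)).pow c).add hb ((PolyBounded.const hb 2).mul hZ)))
    · have e1 := x.size_fst_le
      have e2 := x.size_snd_le
      have e3 := x.snd.size_snd_le
      have e4 := x.snd.size_fst_le
      have e5 := hT O x
      obtain ⟨t, ht, hle⟩ := key O (x.size + T x + x.size + 2) x.fst x.snd.fst x.snd.snd (by omega)
      refine ⟨_, .comp (.pair (.fst x) (.pair (.comp (.snd x) (.fst x.snd))
        (.comp (.snd x) (.snd x.snd)))) ht, ?_⟩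
      have e6 := x.fst.len_le_size
      have e7 : (x.fst.len + 1) * ((x.size + T x + x.size + 2 + 1) ^ c +
          2 * (x.size + T x + x.size + 2)) ≤ (x.size + 1) *
          ((x.size + T x + x.size + 2 + 1) ^ c + 2 * (x.size + T x + x.size + 2)) :=
        Nat.mul_le_mul_right _ (by omega)
      simp only [Val.size_cons]
      omega
  refine Realizes.congr (Realizes.comp (T' := fun _ => 0) PolyTime.id.snd.fst hloop
    fun _ _ => Nat.zero_le _) fun O x => ?_
  simp

/-- A fold whose states grow additively in each step takes polynomial time. -/
theorem foldTrace_le {h : Val → Val → Val} {K : ℕ} {l s : Val}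
    (hK : ∀ a s, a.size ≤ l.size → (h a s).size ≤ s.size + K) :
    foldTrace h s l ≤ (l.len + 1) * (s.size + l.len * K) := by
  induction l generalizing s with
  | nil => simp [foldTrace, Val.len]
  | cons a b _ ih =>
    have h1 := ih (s := h a s) fun a' s' ha => hK a' s' (by simp; omega)
    have h2 := hK a s (by simp; omega)
    simp only [foldTrace, Val.len]
    calc s.size + foldTrace h (h a s) b
        ≤ s.size + (b.len + 1) * ((s.size + K) + b.len * K) := by
          refine Nat.add_le_add_left (h1.trans (Nat.mul_le_mul_left _ (by omega))) _
      _ ≤ (b.len + 1 + 1) * (s.size + (b.len + 1) * K) := by nlinarith [Nat.zero_le (b.len * K)]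

/-- The increment per step depends on the entry and the environment but not on the state, so growth
does not compound, and the trace is polynomial in the input size alone. -/
theorem Realizes.fold_of_growth {H : (Val → Bool) → Val → Val × List Val}
    (hH : Realizes (fun _ => 0) H)
    (hg : ∃ c, ∀ O a s e, (H O (.cons a (.cons s e))).1.size ≤
      s.size + (a.size + e.size + 1) ^ c) {l i e : Val → Val}
    (hl : PolyTime l) (hi : PolyTime i) (he : PolyTime e) :
    Realizes (fun _ => 0) fun O x =>
      (foldV (fun a s => (H O (.cons a (.cons s (e x)))).1) (i x) (l x),
        foldQ (fun a s => H O (.cons a (.cons s (e x)))) (i x) (l x)) := by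
  obtain ⟨c, hc⟩ := hg
  have h1 : Realizes (fun x => (x.size + 1) * (x.size + x.size * (x.size + x.size + 1) ^ c))
      fun O x =>
      (foldV (fun a s => (H O (.cons a (.cons s x.snd.snd))).1) x.snd.fst x.fst,
        foldQ (fun a s => H O (.cons a (.cons s x.snd.snd))) x.snd.fst x.fst) := by
    refine Realizes.fold hH fun O x => ?_
    have e1 := x.size_fst_le
    have e2 := x.size_snd_le
    have e3 := x.snd.size_snd_le
    have e4 := x.snd.size_fst_le
    have e6 := x.fst.len_le_size
    refine (foldTrace_le (K := (x.size + x.size + 1) ^ c) fun a s ha => (hc O a s _).trans ?_).trans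
      ?_
    · exact Nat.add_le_add_left (Nat.pow_le_pow_left (by omega) c) _
    · refine Nat.mul_le_mul (by omega) (Nat.add_le_add (by omega) (Nat.mul_le_mul_right _ (by omega)))
  have h2 := h1.mono (T' := fun _ => 0) (by
    have hb := two_le_base fun _ => 0
    have hs := polyBounded_size fun _ => 0
    exact (hs.add hb (PolyBounded.const hb 1)).mul (hs.add hb (hs.mul (((hs.add hb hs).add hb
      (PolyBounded.const hb 1)).pow c))))
  refine Realizes.congr (Realizes.comp h2 (hl.cons (hi.cons he)) fun _ _ => le_rfl) fun O x => ?_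
  simp

theorem PolyTime.fold {H : Val → Val → Val → Val}
    (hH : PolyTime fun y => H y.fst y.snd.fst y.snd.snd)
    (hg : ∃ c, ∀ a s x, (H a s x).size ≤ s.size + (a.size + x.size + 1) ^ c) {l i : Val → Val}
    (hl : PolyTime l) (hi : PolyTime i) : PolyTime fun x => foldV (fun a s => H a s x) (i x) (l x) := by
  refine Realizes.congr (Realizes.fold_of_growth hH ?_ hl hi PolyTime.id) fun O x => ?_
  · obtain ⟨c, hc⟩ := hg
    exact ⟨c, fun O a s e => by simpa using hc a s e⟩
  · simp [foldQ_pure]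

/-! ### List operations -/

section Lists
variable {S T : Type*}

theorem foldV_encList (h : Val → Val → Val) (enc : T → Val) (l : List T) (s : Val) :
    foldV h s (encList enc l) = l.foldl (fun s a => h (enc a) s) s := by
  induction l generalizing s with
  | nil => rfl
  | cons a l ih => simp [encList, foldV, ih]

/-- A fold over an encoded list follows a fold on the decoded states. -/
theorem foldV_encList_foldl (h : Val → Val → Val) (enc : T → Val) (st : S → Val) (g : S → T → S)
    (hg : ∀ s a, h (enc a) (st s) = st (g s a)) (l : List T) (s : S) :
    foldV h (st s) (encList enc l) = st (l.foldl g s) := by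
  induction l generalizing s with
  | nil => rfl
  | cons a l ih => simp [encList, foldV, hg, ih]

/-- Reading a tree along its right spine turns it into a list of trees. Size estimates, which are
needed on all inputs and not only on well-formed ones, thereby reduce to lists. -/
theorem exists_encList (v : Val) : ∃ l : List Val, v = encList (fun x => x) l := by
  induction v with
  | nil => exact ⟨[], rfl⟩
  | cons a b _ ih =>
    obtain ⟨l, rfl⟩ := ih
    exact ⟨a :: l, rfl⟩

theorem encList_map (enc : T → Val) (f : S → T) (l : List S) :
    encList enc (l.map f) = encList (fun a => enc (f a)) l := by
  induction l with
  | nil => rfl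
  | cons a l ih => simp [encList, ih]

theorem encList_congr {enc enc' : T → Val} {l : List T} (h : ∀ a ∈ l, enc a = enc' a) :
    encList enc l = encList enc' l := by
  induction l with
  | nil => rfl
  | cons a l ih =>
    simp only [encList, h a (by simp), ih fun b hb => h b (by simp [hb])]

end Lists

/-- List reversal. -/
def revV (l : Val) : Val := foldV (fun a s => .cons a s) .nil l

/-- Concatenation. -/
def appV (l m : Val) : Val := foldV (fun a s => .cons a s) m (revV l)

/-- Image of a list. -/
def mapV (h : Val → Val) (l : Val) : Val := revV (foldV (fun a s => .cons (h a) s) .nil l)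

/-- Concatenation of the images of the entries of a list. -/
def flatMapV (h : Val → Val) (l : Val) : Val := foldV (fun a s => appV s (h a)) .nil l

/-- Removes as many entries from `m` as `l` has. -/
def dropV (l m : Val) : Val := foldV (fun _ s => s.snd) m l

/-- The entry of `m` at the position given in unary. -/
def nthV (m i : Val) : Val := (dropV i m).fst

/-- Whether some entry satisfies a test. -/
def anyV (h : Val → Val) (l : Val) : Val :=
  foldV (fun a s => iteV (h a) (.cons .nil .nil) s) .nil l

/-- The unary numbers below a unary number. -/
def rangeV (u : Val) : Val := foldV (fun _ s => .cons (dropV (.cons .nil s) u) s) .nil u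

/-- The list of pairs of corresponding entries. -/
def zipV (l m : Val) : Val :=
  revV (foldV (fun a s => .cons s.fst.snd (.cons (.cons a s.fst.fst) s.snd)) (.cons m .nil) l).snd

/-- Equality of unary numbers. -/
def eqV (u v : Val) : Val := iteV (dropV u v) .nil (iteV (dropV v u) .nil (.cons .nil .nil))

section Spec
variable {S T : Type*}

@[simp] theorem revV_encList (enc : T → Val) (l : List T) :
    revV (encList enc l) = encList enc l.reverse := by
  have := foldV_encList_foldl (fun a s => .cons a s) enc (encList enc) (fun s a => a :: s)
    (fun _ _ => rfl) l []
  simpa [revV, encList] using this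

@[simp] theorem appV_encList (enc : T → Val) (l m : List T) :
    appV (encList enc l) (encList enc m) = encList enc (l ++ m) := by
  have := foldV_encList_foldl (fun a s => .cons a s) enc (encList enc) (fun s a => a :: s)
    (fun _ _ => rfl) l.reverse m
  simpa [appV, encList] using this

theorem mapV_encList (h : Val → Val) (enc : T → Val) (l : List T) :
    mapV h (encList enc l) = encList (fun a => h (enc a)) l := by
  have := foldV_encList_foldl (fun a s => .cons (h a) s) enc (encList fun a => h (enc a))
    (fun s a => a :: s) (fun _ _ => rfl) l []
  rw [mapV, show Val.nil = encList (fun a => h (enc a)) [] from rfl, this]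
  simp

theorem flatMapV_encList (h : Val → Val) (enc : T → Val) (enc' : S → Val) (g : T → List S)
    (l : List T) (hg : ∀ a ∈ l, h (enc a) = encList enc' (g a)) :
    flatMapV h (encList enc l) = encList enc' (l.flatMap g) := by
  suffices H : ∀ s : List S, foldV (fun a s => appV s (h a)) (encList enc' s) (encList enc l) =
      encList enc' (s ++ l.flatMap g) from H []
  induction l with
  | nil => simp [encList, foldV]
  | cons a l ih =>
    intro s
    simp only [encList, foldV, hg a (by simp), appV_encList]
    rw [ih fun b hb => hg b (by simp [hb])]
    simp

theorem dropV_encList (enc : T → Val) (enc' : S → Val) (l : List T) (m : List S) :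
    dropV (encList enc l) (encList enc' m) = encList enc' (m.drop l.length) := by
  have := foldV_encList_foldl (fun _ s => s.snd) enc (encList enc') (fun s _ => s.drop 1)
    (fun s _ => by cases s <;> rfl) l m
  rw [dropV, this]
  congr 1
  clear this
  induction l generalizing m with
  | nil => simp
  | cons a l ih => rw [List.foldl_cons, ih, List.drop_drop, List.length_cons, add_comm]

theorem encUnary_succ (k : ℕ) : encUnary (k + 1) = .cons .nil (encUnary k) := rfl

theorem encUnary_eq (enc : T → Val) (l : List T) (h : ∀ a ∈ l, enc a = .nil) :
    encList enc l = encUnary l.length := by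
  induction l with
  | nil => rfl
  | cons a l ih =>
    simp only [encList, List.length_cons, encUnary_succ, h a (by simp),
      ih fun b hb => h b (by simp [hb])]

theorem dropV_encUnary (enc : T → Val) (k : ℕ) (m : List T) :
    dropV (encUnary k) (encList enc m) = encList enc (m.drop k) := by
  simp [encUnary, dropV_encList]

theorem dropV_encUnary_encUnary (k n : ℕ) : dropV (encUnary k) (encUnary n) = encUnary (n - k) := by
  rw [encUnary, encUnary, dropV_encList]
  simp [encUnary]

theorem nthV_encUnary (enc : T → Val) (m : List T) {k : ℕ} (hk : k < m.length) :
    nthV (encList enc m) (encUnary k) = enc m[k] := by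
  rw [nthV, dropV_encUnary, List.drop_eq_getElem_cons hk]
  rfl

theorem eqV_encUnary (i j : ℕ) : eqV (encUnary i) (encUnary j) = encBool (decide (i = j)) := by
  rw [eqV, dropV_encUnary_encUnary, dropV_encUnary_encUnary]
  rcases lt_trichotomy i j with h | rfl | h
  · obtain ⟨d, hd⟩ : ∃ d, j - i = d + 1 := ⟨j - i - 1, by omega⟩
    simp [hd, encUnary_succ, h.ne, encBool]
  · simp [encUnary, encList, encBool]
  · obtain ⟨d, hd⟩ : ∃ d, i - j = d + 1 := ⟨i - j - 1, by omega⟩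
    have : j - i = 0 := by omega
    have h0 : encUnary 0 = .nil := rfl
    simp [hd, this, encUnary_succ, h.ne', encBool, h0]

theorem anyV_encList (h : Val → Val) (enc : T → Val) (g : T → Bool) (l : List T)
    (hg : ∀ a ∈ l, (h (enc a) = .nil ↔ g a = false)) :
    anyV h (encList enc l) = encBool (l.any g) := by
  suffices H : ∀ b : Bool, foldV (fun a s => iteV (h a) (.cons .nil .nil) s) (encBool b)
      (encList enc l) = encBool (b || l.any g) from H false
  induction l with
  | nil => simp [encList, foldV]
  | cons a l ih =>
    intro b
    have ha := hg a (by simp)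
    have ih' := ih fun b hb => hg b (by simp [hb])
    simp only [encList, foldV]
    have : iteV (h (enc a)) (.cons .nil .nil) (encBool b) = encBool (b || g a) := by
      cases hx : h (enc a) with
      | nil => simp [ha.mp hx]
      | cons u v =>
        have : g a = true := by
          by_contra hne
          simp [ha.mpr (by simpa using hne)] at hx
        simp [this, encBool]
    rw [this, ih']
    simp [Bool.or_assoc]

theorem rangeV_encUnary (n : ℕ) : rangeV (encUnary n) = encList encUnary (List.range n) := by
  -- After `k` steps the accumulator holds `n - k, …, n - 1`. The next number comes from deleting
  -- from `n` one entry more than the accumulator has.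
  have H : ∀ k ≤ n, foldV (fun _ s => .cons (dropV (.cons .nil s) (encUnary n)) s) .nil
      (encUnary k) = encList encUnary ((List.range k).map fun i => n - k + i) := by
    intro k
    induction k with
    | zero => intro _; simp [encUnary, encList, foldV]
    | succ k ih =>
      intro hk
      have hu : encUnary (k + 1) = encList (fun _ => .nil) (List.replicate (k + 1) ()) := by
        rw [encUnary_eq _ _ fun _ _ => rfl]; simp
      have hu' : encUnary k = encList (fun _ => .nil) (List.replicate k ()) := by
        rw [encUnary_eq _ _ fun _ _ => rfl]; simp
      rw [hu, foldV_encList, List.replicate_succ', List.foldl_append,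
        ← foldV_encList (fun _ s => .cons (dropV (.cons .nil s) (encUnary n)) s)
          (fun _ : Unit => Val.nil) (List.replicate k ()), ← hu',
        ih (by omega)]
      simp only [List.foldl_cons, List.foldl_nil]
      have h1 : Val.cons .nil (encList encUnary ((List.range k).map fun i => n - k + i)) =
        encList encUnary (0 :: (List.range k).map fun i => n - k + i) := rfl
      have h2 : encUnary n = encList (fun _ => .nil) (List.replicate n ()) := by
        rw [encUnary_eq _ _ fun _ _ => rfl]; simp
      rw [h1, h2, dropV_encList, encUnary_eq _ _ fun _ _ => rfl, List.range_succ_eq_map]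
      simp only [List.length_drop, List.length_replicate, List.length_cons, List.length_map,
        List.length_range, List.map_cons, encList, List.map_map]
      congr 2
      apply List.map_congr_left
      intro i _
      simp only [Function.comp]
      omega
  simpa [rangeV] using H n le_rfl

theorem zipV_encList (enc : T → Val) (enc' : S → Val) (l : List T) (m : List S)
    (hlm : l.length ≤ m.length) :
    zipV (encList enc l) (encList enc' m) =
      encList (fun q : T × S => .cons (enc q.1) (enc' q.2)) (l.zip m) := by
  suffices H : ∀ acc : List (T × S),
      (foldV (fun a s => .cons s.fst.snd (.cons (.cons a s.fst.fst) s.snd))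
        (.cons (encList enc' m) (encList (fun q : T × S => .cons (enc q.1) (enc' q.2)) acc))
        (encList enc l)).snd =
      encList (fun q : T × S => .cons (enc q.1) (enc' q.2)) ((l.zip m).reverse ++ acc) by
    have h0 := H []
    rw [zipV]
    simp only [encList, List.append_nil] at h0
    rw [h0]
    simp
  induction l generalizing m with
  | nil => simp [encList, foldV]
  | cons a l ih =>
    intro acc
    cases m with
    | nil => simp at hlm
    | cons b m =>
      have := ih m (by simpa using hlm) ((a, b) :: acc)
      simp only [encList] at this
      simp [encList, foldV, this]

end Spec

/-! ### List operations take polynomial time -/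

theorem size_encList (l : List Val) :
    (encList (fun x => x) l).size = (l.map fun v => v.size + 1).sum + 1 := by
  induction l with
  | nil => rfl
  | cons a l ih => simp [encList, ih]; omega

theorem size_revV (l : Val) : (revV l).size = l.size := by
  obtain ⟨l, rfl⟩ := exists_encList l
  rw [revV_encList, size_encList, size_encList, List.map_reverse, List.sum_reverse]

theorem size_appV_le (l m : Val) : (appV l m).size ≤ l.size + m.size := by
  obtain ⟨l, rfl⟩ := exists_encList l
  obtain ⟨m, rfl⟩ := exists_encList m
  rw [appV_encList, size_encList, size_encList, size_encList, List.map_append, List.sum_append]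
  omega

theorem size_dropV_le (l m : Val) : (dropV l m).size ≤ m.size := by
  rw [dropV]
  induction l generalizing m with
  | nil => exact le_rfl
  | cons a b _ ih => exact (ih _).trans m.size_snd_le

namespace PolyTime
variable {f g k l i : Val → Val}

/-- Outputs of a polynomial-time function have polynomial size, so an increment bounded by such an
output meets the growth condition for folds. -/
theorem fold_of_le {H : Val → Val → Val → Val} {G : Val → Val → Val} (c : ℕ)
    (hH : PolyTime fun y => H y.fst y.snd.fst y.snd.snd) (hG : PolyTime fun y => G y.fst y.snd)
    (hg : ∀ a s x, (H a s x).size ≤ s.size + (G a x).size + c)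
    (hl : PolyTime l) (hi : PolyTime i) :
    PolyTime fun x => foldV (fun a s => H a s x) (i x) (l x) := by
  refine fold hH ?_ hl hi
  obtain ⟨d, hd⟩ := hG.size_bound
  have hb : ∀ q : Val × Val, 2 ≤ q.1.size + q.2.size + 1 := fun q => by
    have := q.1.size_pos; omega
  have key : PolyBounded (fun q : Val × Val => q.1.size + q.2.size + 1)
      fun q => (q.1.size + q.2.size + 1 + 1) ^ d + c :=
    (((PolyBounded.self _).add hb (PolyBounded.const hb 1)).pow d).add hb (PolyBounded.const hb c)
  obtain ⟨e, he⟩ := key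
  refine ⟨e, fun a s x => (hg a s x).trans ?_⟩
  have h1 := hd (.cons a x)
  have h2 := he (a, x)
  simp at h1 h2
  omega

theorem revV (hf : PolyTime f) : PolyTime fun x => revV (f x) := by
  refine fold_of_le (H := fun a s _ => .cons a s) (G := fun a _ => a) 1 ?_ id.fst
    (fun a s x => by simp; omega) hf const_nil
  exact id.fst.cons id.snd.fst

theorem appV (hf : PolyTime f) (hg : PolyTime g) : PolyTime fun x => appV (f x) (g x) := by
  refine fold_of_le (H := fun a s _ => .cons a s) (G := fun a _ => a) 1 ?_ id.fst
    (fun a s x => by simp; omega) hf.revV hg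
  exact id.fst.cons id.snd.fst

theorem mapV {h : Val → Val → Val} (hh : PolyTime fun y => h y.fst y.snd) (hf : PolyTime f) :
    PolyTime fun x => mapV (fun a => h a x) (f x) := by
  refine revV (fold_of_le (H := fun a s x => .cons (h a x) s) (G := h) 1 ?_ hh
    (fun a s x => by simp; omega) hf const_nil)
  exact (hh.comp (id.fst.cons id.snd.snd)).cons id.snd.fst

theorem flatMapV {h : Val → Val → Val} (hh : PolyTime fun y => h y.fst y.snd) (hf : PolyTime f) :
    PolyTime fun x => flatMapV (fun a => h a x) (f x) := by
  refine fold_of_le (H := fun a s x => AltMatSpace.appV s (h a x)) (G := h) 1 ?_ hh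
    (fun a s x => (size_appV_le _ _).trans (by omega)) hf const_nil
  exact appV id.snd.fst (hh.comp (id.fst.cons id.snd.snd))

theorem dropV (hf : PolyTime f) (hg : PolyTime g) : PolyTime fun x => dropV (f x) (g x) :=
  fold_of_le (H := fun _ s _ => s.snd) (G := fun a _ => a) 1 id.snd.fst.snd id.fst
    (fun a s x => by have := s.size_snd_le; omega) hf hg

theorem nthV (hf : PolyTime f) (hg : PolyTime g) : PolyTime fun x => nthV (f x) (g x) :=
  (dropV hg hf).fst

theorem anyV {h : Val → Val → Val} (hh : PolyTime fun y => h y.fst y.snd) (hf : PolyTime f) :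
    PolyTime fun x => anyV (fun a => h a x) (f x) := by
  refine fold_of_le (H := fun a s x => iteV (h a x) (.cons .nil .nil) s) (G := h) 3 ?_ hh
    (fun a s x => ?_) hf const_nil
  · exact ite (hh.comp (id.fst.cons id.snd.snd)) (const _) id.snd.fst
  · cases h a x <;> (simp; try omega)

theorem rangeV (hf : PolyTime f) : PolyTime fun x => rangeV (f x) := by
  refine comp (g := AltMatSpace.rangeV) ?_ hf
  refine fold_of_le (H := fun _ s x => .cons (AltMatSpace.dropV (.cons .nil s) x) s)
    (G := fun _ x => x) 1 ?_ id.snd (fun a s x => ?_) id const_nil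
  · exact (dropV (const_nil.cons id.snd.fst) id.snd.snd).cons id.snd.fst
  · have := size_dropV_le (.cons .nil s) x
    simp; omega

theorem zipV (hf : PolyTime f) (hg : PolyTime g) : PolyTime fun x => zipV (f x) (g x) := by
  refine revV (snd (fold_of_le (H := fun a s _ => .cons s.fst.snd
    (.cons (.cons a s.fst.fst) s.snd)) (G := fun a _ => a) 5 ?_ id.fst (fun a s x => ?_) hf
      (hg.cons const_nil)))
  · exact id.snd.fst.fst.snd.cons ((id.fst.cons id.snd.fst.fst.fst).cons id.snd.fst.snd)
  · rcases s with _ | ⟨_ | ⟨s, t⟩, u⟩ <;> simp <;> omega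

theorem eqV (hf : PolyTime f) (hg : PolyTime g) : PolyTime fun x => eqV (f x) (g x) :=
  ite (dropV hf hg) const_nil (ite (dropV hg hf) const_nil (const _))

end PolyTime

/-! ### Congruence of matrix spaces over an arbitrary index type -/

section Congruence
variable {K : Type*} [Field K] {ι : Type*} [Fintype ι]

/-- The space of all `M x` for `M` in a matrix space. -/
def orbitSpace (S : Submodule K (Matrix ι ι K)) (x : ι → K) : Submodule K (ι → K) :=
  S.map ((Matrix.mulVecBilin K K).flip x)

theorem mem_orbitSpace {S : Submodule K (Matrix ι ι K)} {x y : ι → K} :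
    y ∈ orbitSpace S x ↔ ∃ M ∈ S, M.mulVec x = y := Iff.rfl

variable [DecidableEq ι]

/-- `Q` is invertible and `Qᵗ S Q = T`. -/
def IsCongruence (Q : Matrix ι ι K) (S T : Submodule K (Matrix ι ι K)) : Prop :=
  IsUnit Q ∧ ∀ M, M ∈ S ↔ Q.transpose * M * Q ∈ T

theorem congr_cancel {Q R : Matrix ι ι K} (h : Q * R = 1) (M : Matrix ι ι K) :
    R.transpose * (Q.transpose * M * Q) * R = M := by
  have h' : R.transpose * Q.transpose = 1 := by
    rw [← Matrix.transpose_mul, h, Matrix.transpose_one]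
  calc R.transpose * (Q.transpose * M * Q) * R
      = (R.transpose * Q.transpose) * M * (Q * R) := by simp only [Matrix.mul_assoc]
    _ = M := by rw [h, h', Matrix.one_mul, Matrix.mul_one]

theorem IsCongruence.of_inverse {Q R : Matrix ι ι K} {S T : Submodule K (Matrix ι ι K)}
    (h : Q * R = 1) (hQ : ∀ M ∈ S, Q.transpose * M * Q ∈ T)
    (hR : ∀ M ∈ T, R.transpose * M * R ∈ S) : IsCongruence Q S T := by
  refine ⟨⟨⟨Q, R, h, mul_eq_one_comm.mp h⟩, rfl⟩, fun M => ⟨hQ M, fun hM => ?_⟩⟩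
  have := hR _ hM
  rwa [congr_cancel h] at this

theorem IsCongruence.surj {Q : Matrix ι ι K} {S T : Submodule K (Matrix ι ι K)}
    (h : IsCongruence Q S T) {N : Matrix ι ι K} (hN : N ∈ T) :
    ∃ M ∈ S, Q.transpose * M * Q = N := by
  obtain ⟨⟨u, rfl⟩, h⟩ := h
  have hu : (↑u⁻¹ : Matrix ι ι K) * (u : Matrix ι ι K) = 1 := u.inv_mul
  refine ⟨(↑u⁻¹ : Matrix ι ι K).transpose * N * (↑u⁻¹ : Matrix ι ι K), ?_, congr_cancel hu N⟩
  rw [h, congr_cancel hu]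
  exact hN

theorem IsCongruence.smul {Q : Matrix ι ι K} {S T : Submodule K (Matrix ι ι K)}
    (h : IsCongruence Q S T) {c : K} (hc : c ≠ 0) : IsCongruence (c • Q) S T := by
  obtain ⟨hQ, h⟩ := h
  refine ⟨?_, fun M => ?_⟩
  · exact (Units.isUnit (Units.mk0 c hc • hQ.unit) : _)
  · rw [h, Matrix.transpose_smul, Matrix.smul_mul, Matrix.smul_mul, Matrix.mul_smul, smul_smul,
      Submodule.smul_mem_iff _ (mul_ne_zero hc hc)]

/-- Since `T = Qᵗ S Q`, the space `T x` is the image of `S (Q x)` under the injective map `Qᵗ`. This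
dimension is the invariant that distinguishes marking vectors from the rest. -/
theorem IsCongruence.finrank_orbitSpace {Q : Matrix ι ι K} {S T : Submodule K (Matrix ι ι K)}
    (h : IsCongruence Q S T) (x : ι → K) :
    Module.finrank K (orbitSpace T x) = Module.finrank K (orbitSpace S (Q.mulVec x)) := by
  have hQ : IsUnit Q.transpose := by
    rw [Matrix.isUnit_iff_isUnit_det, Matrix.det_transpose, ← Matrix.isUnit_iff_isUnit_det]
    exact h.1
  have : orbitSpace T x = (orbitSpace S (Q.mulVec x)).map Q.transpose.mulVecLin := by
    ext y
    simp only [Submodule.mem_map, mem_orbitSpace, Matrix.mulVecLin_apply]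
    constructor
    · rintro ⟨N, hN, rfl⟩
      obtain ⟨M, hM, rfl⟩ := h.surj hN
      exact ⟨_, ⟨M, hM, rfl⟩, by simp [Matrix.mulVec_mulVec, Matrix.mul_assoc]⟩
    · rintro ⟨_, ⟨M, hM, rfl⟩, rfl⟩
      exact ⟨_, (h.2 M).mp hM, by simp [Matrix.mulVec_mulVec, Matrix.mul_assoc]⟩
  rw [this]
  exact (LinearEquiv.finrank_eq (Submodule.equivMapOfInjective _
    (Matrix.mulVec_injective_of_isUnit hQ) _)).symm

end Congruence

/-! ### The rigidifying gadget -/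

/-- Indices of the given matrices together with those of the rigid frame. -/
abbrev CoreIdx (n : ℕ) : Type := Fin n ⊕ Fin (n + 1)

/-- Indices marking the core. -/
abbrev FreeIdx (n : ℕ) : Type := Fin (2 * n + 2)

/-- Indices marking the lines of the frame, the `i`-th of them with multiplicity `i + 1`. -/
abbrev LineIdx (n : ℕ) : Type := Σ i : Fin (n + 2), Fin (i + 1)

/-- All indices of the gadget. -/
abbrev GadgetIdx (n : ℕ) : Type := CoreIdx n ⊕ (FreeIdx n ⊕ LineIdx n)

section Gadget
variable {K : Type*} [Field K] {n : ℕ}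

/-- The marked functionals: the frame and, last, the sum of the frame. -/
def lineVec (i : Fin (n + 2)) : CoreIdx n → K :=
  Sum.elim 0 fun l => if l.castSucc = i ∨ i = Fin.last _ then 1 else 0

/-- The core block. -/
def coreBlock (a : Matrix (Fin n) (Fin n) K) (t : K) (S : Matrix (Fin (n + 1)) (Fin n) K) :
    Matrix (CoreIdx n) (CoreIdx n) K :=
  Matrix.fromBlocks a (-(t • S.transpose)) (t • S) 0

/-- The block relating the core and the marking indices. -/
def sideBlock (D : Matrix (CoreIdx n) (FreeIdx n) K) (c : LineIdx n → K) :
    Matrix (CoreIdx n) (FreeIdx n ⊕ LineIdx n) K :=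
  Matrix.of fun y => Sum.elim (D y) fun s => c s * lineVec s.1 y

/-- The matrices of the gadget. -/
def gadgetMap (S : Matrix (Fin (n + 1)) (Fin n) K) :
    (Matrix (Fin n) (Fin n) K × K × Matrix (CoreIdx n) (FreeIdx n) K × (LineIdx n → K)) →ₗ[K]
      Matrix (GadgetIdx n) (GadgetIdx n) K where
  toFun q := Matrix.fromBlocks (coreBlock q.1 q.2.1 S) (sideBlock q.2.2.1 q.2.2.2)
    (-(sideBlock q.2.2.1 q.2.2.2).transpose) 0
  map_add' q r := by
    ext (⟨_ | _⟩ | ⟨_ | _⟩) (⟨_ | _⟩ | ⟨_ | _⟩) <;> simp [coreBlock, sideBlock] <;> ring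
  map_smul' c q := by
    ext (⟨_ | _⟩ | ⟨_ | _⟩) (⟨_ | _⟩ | ⟨_ | _⟩) <;> simp [coreBlock, sideBlock] <;> ring

theorem gadgetMap_apply (S : Matrix (Fin (n + 1)) (Fin n) K) (a : Matrix (Fin n) (Fin n) K) (t : K)
    (D : Matrix (CoreIdx n) (FreeIdx n) K) (c : LineIdx n → K) :
    gadgetMap S (a, t, D, c) = Matrix.fromBlocks (coreBlock a t S) (sideBlock D c)
      (-(sideBlock D c).transpose) 0 := rfl

/-- The gadget built from a matrix space and a frame of functionals. -/
def gadgetSpace (A : Submodule K (Matrix (Fin n) (Fin n) K))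
    (S : Matrix (Fin (n + 1)) (Fin n) K) :
    Submodule K (Matrix (GadgetIdx n) (GadgetIdx n) K) :=
  (A.prod ⊤).map (gadgetMap S)

theorem mem_gadgetSpace {A : Submodule K (Matrix (Fin n) (Fin n) K)}
    {S : Matrix (Fin (n + 1)) (Fin n) K} {M : Matrix (GadgetIdx n) (GadgetIdx n) K} :
    M ∈ gadgetSpace A S ↔ ∃ a ∈ A, ∃ t D c, gadgetMap S (a, t, D, c) = M := by
  constructor
  · rintro ⟨⟨a, t, D, c⟩, ⟨ha, -⟩, rfl⟩
    exact ⟨a, ha, t, D, c, rfl⟩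
  · rintro ⟨a, ha, t, D, c, rfl⟩
    exact ⟨(a, t, D, c), ⟨ha, trivial⟩, rfl⟩

theorem sideBlock_zero : sideBlock (0 : Matrix (CoreIdx n) (FreeIdx n) K) 0 = 0 := by
  ext y (_ | _) <;> simp [sideBlock]

theorem coreBlock_zero (S : Matrix (Fin (n + 1)) (Fin n) K) : coreBlock 0 0 S = 0 := by
  ext (_ | _) (_ | _) <;> simp [coreBlock]

/-- An isometry of the original spaces that matches the frames extends to the gadgets. -/
theorem gadget_forward {A B : Submodule K (Matrix (Fin n) (Fin n) K)}
    {S : Matrix (Fin (n + 1)) (Fin n) K} {P : Matrix (Fin n) (Fin n) K}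
    (hP : ∀ a ∈ A, P.transpose * a * P ∈ B) {M : Matrix (GadgetIdx n) (GadgetIdx n) K}
    (hM : M ∈ gadgetSpace A S) :
    (Matrix.fromBlocks (Matrix.fromBlocks P 0 0 1) 0 0 1 :
      Matrix (GadgetIdx n) (GadgetIdx n) K).transpose * M *
      Matrix.fromBlocks (Matrix.fromBlocks P 0 0 1) 0 0 1 ∈ gadgetSpace B (S * P) := by
  obtain ⟨a, ha, t, D, c, rfl⟩ := mem_gadgetSpace.mp hM
  -- The marked functionals are supported on the frame, where the congruence is the identity, so `c`
  -- stays the same; only `D` is transformed.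
  refine mem_gadgetSpace.mpr ⟨_, hP a ha, t,
    (Matrix.fromBlocks P 0 0 1 : Matrix (CoreIdx n) (CoreIdx n) K).transpose * D, c, ?_⟩
  have hcore : coreBlock (P.transpose * a * P) t (S * P) =
      (Matrix.fromBlocks P 0 0 1 : Matrix (CoreIdx n) (CoreIdx n) K).transpose * coreBlock a t S *
        Matrix.fromBlocks P 0 0 1 := by
    simp [coreBlock, Matrix.fromBlocks_transpose, Matrix.fromBlocks_multiply, Matrix.mul_assoc]
  have hside : sideBlock ((Matrix.fromBlocks P 0 0 1 :
      Matrix (CoreIdx n) (CoreIdx n) K).transpose * D) c =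
      (Matrix.fromBlocks P 0 0 1 : Matrix (CoreIdx n) (CoreIdx n) K).transpose *
        sideBlock D c := by
    ext y (j | s)
    · simp [sideBlock, Matrix.mul_apply]
    · rcases y with v | l
      · simp [sideBlock, Matrix.mul_apply, lineVec, Matrix.fromBlocks_transpose]
      · simp only [sideBlock, Matrix.mul_apply, Matrix.fromBlocks_transpose, Fintype.sum_sum_type]
        rw [Finset.sum_eq_single_of_mem l (Finset.mem_univ _) fun b _ hb => by
          simp [Matrix.one_apply_ne' hb]]
        simp [lineVec]
  rw [gadgetMap_apply, gadgetMap_apply, hcore, hside]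
  simp [Matrix.fromBlocks_transpose, Matrix.fromBlocks_multiply]

theorem gadget_congruence {A B : Submodule K (Matrix (Fin n) (Fin n) K)}
    {S : Matrix (Fin (n + 1)) (Fin n) K} {P : Matrix (Fin n) (Fin n) K}
    (hP : IsCongruence P A B) :
    ∃ Q, IsCongruence Q (gadgetSpace A S) (gadgetSpace B (S * P)) := by
  obtain ⟨⟨u, rfl⟩, h⟩ := hP
  have hu : (u : Matrix (Fin n) (Fin n) K) * (↑u⁻¹ : Matrix (Fin n) (Fin n) K) = 1 := u.mul_inv
  have hu' : (↑u⁻¹ : Matrix (Fin n) (Fin n) K) * (u : Matrix (Fin n) (Fin n) K) = 1 := u.inv_mul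
  refine ⟨_, IsCongruence.of_inverse
    (R := Matrix.fromBlocks (Matrix.fromBlocks (↑u⁻¹ : Matrix (Fin n) (Fin n) K) 0 0 1) 0 0 1) ?_
    (fun M hM => gadget_forward (fun a ha => (h a).mp ha) hM) fun M hM => ?_⟩
  · simp [Matrix.fromBlocks_multiply]
  · have := gadget_forward (A := B) (B := A) (P := (↑u⁻¹ : Matrix (Fin n) (Fin n) K))
      (fun b hb => ?_) hM
    · rwa [Matrix.mul_assoc, hu, Matrix.mul_one] at this
    · rw [h, congr_cancel hu']
      exact hb

/-! ### Rigidity of the gadget -/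

section Rigidity
variable {A B : Submodule K (Matrix (Fin n) (Fin n) K)} {S T : Matrix (Fin (n + 1)) (Fin n) K}

/-- The block between marking indices vanishes, so a vector supported there is sent into the core
coordinates, of which there are `n + (n + 1)`. -/
theorem finrank_orbitSpace_le (ξ : FreeIdx n ⊕ LineIdx n → K) :
    Module.finrank K (orbitSpace (gadgetSpace A S) (Sum.elim 0 ξ)) ≤ 2 * n + 1 := by
  let E : (CoreIdx n → K) →ₗ[K] (GadgetIdx n → K) :=
    { toFun := fun y => Sum.elim y 0
      map_add' := fun x y => by ext (_ | _) <;> simp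
      map_smul' := fun c y => by ext (_ | _) <;> simp }
  have hle : orbitSpace (gadgetSpace A S) (Sum.elim 0 ξ) ≤ LinearMap.range E := by
    rintro _ ⟨M, hM, rfl⟩
    obtain ⟨a, ha, t, D, c, rfl⟩ := mem_gadgetSpace.mp hM
    refine ⟨(sideBlock D c).mulVec ξ, ?_⟩
    change Sum.elim _ _ = Matrix.mulVec _ _
    rw [gadgetMap_apply, Matrix.fromBlocks_mulVec]
    simp
  refine (Submodule.finrank_mono hle).trans ((LinearMap.finrank_range_le E).trans ?_)
  simp
  omega

/-- On the free coordinates a gadget matrix contributes `-Dᵗ y` with `D` arbitrary, and for `y ≠ 0`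
this takes every value. Having one more free index than core indices separates this bound from the
preceding one. -/
theorem le_finrank_orbitSpace {y : CoreIdx n → K} (hy : y ≠ 0) (ξ : FreeIdx n ⊕ LineIdx n → K) :
    2 * n + 2 ≤ Module.finrank K (orbitSpace (gadgetSpace A S) (Sum.elim y ξ)) := by
  let E : (GadgetIdx n → K) →ₗ[K] (FreeIdx n → K) := LinearMap.funLeft K K fun j => .inr (.inl j)
  have htop : (orbitSpace (gadgetSpace A S) (Sum.elim y ξ)).map E = ⊤ := by
    rw [eq_top_iff]
    intro w _
    obtain ⟨y₀, hy₀⟩ := Function.ne_iff.mp hy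
    -- `D` lives in the single row `y₀`, at which `y` is nonzero, and is scaled so that `-Dᵗ y = w`.
    refine ⟨_, ⟨_, mem_gadgetSpace.mpr ⟨0, A.zero_mem, 0,
      Matrix.of fun y' j => if y' = y₀ then -(w j) / y y₀ else 0, 0, rfl⟩, rfl⟩, ?_⟩
    ext j
    change Matrix.mulVec _ _ _ = _
    rw [gadgetMap_apply, Matrix.fromBlocks_mulVec]
    have hy₀' : y y₀ ≠ 0 := hy₀
    simp [Matrix.mulVec, dotProduct, sideBlock, Matrix.transpose_apply, -Fintype.sum_sum_type,
      div_mul_cancel₀ _ hy₀', -mul_eq_mul_left_iff]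
  have := Submodule.finrank_map_le E (orbitSpace (gadgetSpace A S) (Sum.elim y ξ))
  rw [htop] at this
  simpa using this

/-- A marking vector whose image had a nonzero core part would have an orbit of dimension at most
`2n + 1` on one side and at least `2n + 2` on the other. -/
theorem toBlocks₁₂_eq_zero {Q : Matrix (GadgetIdx n) (GadgetIdx n) K}
    (h : IsCongruence Q (gadgetSpace A S) (gadgetSpace B T)) : Q.toBlocks₁₂ = 0 := by
  have key : ∀ ξ, Q.toBlocks₁₂.mulVec ξ = 0 := by
    intro ξ
    by_contra hne
    have h1 := h.finrank_orbitSpace (Sum.elim 0 ξ)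
    have h2 := finrank_orbitSpace_le (A := B) (S := T) ξ
    have h3 : Q.mulVec (Sum.elim 0 ξ) =
        Sum.elim (Q.toBlocks₁₂.mulVec ξ) (Q.toBlocks₂₂.mulVec ξ) := by
      conv_lhs => rw [← Q.fromBlocks_toBlocks, Matrix.fromBlocks_mulVec]
      simp
    have h4 := le_finrank_orbitSpace (A := A) (S := S) hne (Q.toBlocks₂₂.mulVec ξ)
    rw [h3] at h1
    omega
  ext i j
  simpa using congrFun (key (Pi.single j 1)) i

/-- The vectors that the side blocks map into the line of `ψ`. -/
def markSpace (ψ : CoreIdx n → K) : Submodule K (FreeIdx n ⊕ LineIdx n → K) where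
  carrier := {ξ | ∀ D c, (sideBlock D c).mulVec ξ ∈ Submodule.span K {ψ}}
  zero_mem' := fun D c => by simp
  add_mem' := fun hx hy D c => by
    rw [Matrix.mulVec_add]
    exact Submodule.add_mem _ (hx D c) (hy D c)
  smul_mem' := fun r x hx D c => by
    rw [Matrix.mulVec_smul]
    exact Submodule.smul_mem _ _ (hx D c)

theorem sideBlock_mulVec (D : Matrix (CoreIdx n) (FreeIdx n) K) (c : LineIdx n → K)
    (ξ : FreeIdx n ⊕ LineIdx n → K) : (sideBlock D c).mulVec ξ =
      D.mulVec (fun j => ξ (.inl j)) + ∑ s, (c s * ξ (.inr s)) • lineVec s.1 := by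
  ext y
  simp only [Matrix.mulVec, dotProduct, sideBlock, Fintype.sum_sum_type, Pi.add_apply,
    Matrix.of_apply, Sum.elim_inl, Sum.elim_inr, Finset.sum_apply, Pi.smul_apply, smul_eq_mul]
  congr 1
  exact Finset.sum_congr rfl fun s _ => by ring

/-- The parameters are independent. Varying `D`, a nonzero free coordinate would push all core
vectors into one line. Varying `c`, every nonzero line coordinate puts its own functional into the
line of `ψ`. -/
theorem mem_markSpace (hn : 1 ≤ n) {ψ : CoreIdx n → K} {ξ : FreeIdx n ⊕ LineIdx n → K} :
    ξ ∈ markSpace ψ ↔ (∀ j, ξ (.inl j) = 0) ∧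
      ∀ s, ξ (.inr s) ≠ 0 → lineVec s.1 ∈ Submodule.span K {ψ} := by
  constructor
  · intro h
    refine ⟨fun j => ?_, fun s hs => ?_⟩
    · by_contra hj
      have h1 : ∀ y : CoreIdx n, Pi.single y 1 ∈ Submodule.span K {ψ} := by
        intro y
        have := h (Matrix.single y j 1) 0
        rw [sideBlock_mulVec] at this
        simp only [Matrix.single_mulVec, Pi.zero_apply, zero_mul, zero_smul, Finset.sum_const_zero,
          add_zero, one_mul] at this
        have h2 := Submodule.smul_mem _ (ξ (.inl j))⁻¹ this
        convert h2 using 1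
        ext z
        by_cases hz : z = y
        · subst hz; simp [hj]
        · simp [hz]
      -- Two different unit vectors, one from each half of the core, cannot lie on a common line;
      -- the first of them exists because `n ≥ 1`.
      obtain ⟨r, hr⟩ := Submodule.mem_span_singleton.mp (h1 (.inl ⟨0, hn⟩))
      obtain ⟨r', hr'⟩ := Submodule.mem_span_singleton.mp (h1 (.inr 0))
      have e1 := congrFun hr (.inl ⟨0, hn⟩)
      have e2 := congrFun hr (.inr 0)
      have e3 := congrFun hr' (.inr 0)
      simp at e1 e2 e3
      rcases e2 with e2 | e2
      · simp [e2] at e1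
      · simp [e2] at e3
    · have := h 0 (Pi.single s 1)
      rw [sideBlock_mulVec, Finset.sum_eq_single s (fun b _ hb => by simp [hb]) (by simp)] at this
      simp only [Matrix.zero_mulVec, zero_add, Pi.single_eq_same, one_mul] at this
      exact (Submodule.smul_mem_iff _ hs).mp this
  · rintro ⟨h0, h1⟩ D c
    rw [sideBlock_mulVec]
    have : (fun j => ξ (.inl j)) = 0 := funext h0
    rw [this, Matrix.mulVec_zero, zero_add]
    refine Submodule.sum_mem _ fun s _ => ?_
    by_cases hs : ξ (.inr s) = 0
    · simp [hs]
    · exact Submodule.smul_mem _ _ (h1 s hs)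

theorem lineVec_ne_zero (i : Fin (n + 2)) : (lineVec i : CoreIdx n → K) ≠ 0 := by
  intro h
  induction i using Fin.lastCases with
  | last => simpa [lineVec] using congrFun h (.inr 0)
  | cast l => simpa [lineVec] using congrFun h (.inr l)

/-- Distinct unit vectors are not proportional, and neither is their sum to any of them, because
there are `n + 1 ≥ 2` summands. -/
theorem eq_of_lineVec_mem (hn : 1 ≤ n) {i j : Fin (n + 2)}
    (h : (lineVec i : CoreIdx n → K) ∈ Submodule.span K {lineVec j}) : i = j := by
  obtain ⟨r, hr⟩ := Submodule.mem_span_singleton.mp h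
  have hother : ∀ l : Fin (n + 1), ∃ l' : Fin (n + 1), l' ≠ l := by
    intro l
    have : Nontrivial (Fin (n + 1)) := Fin.nontrivial_iff_two_le.mpr (by omega)
    exact exists_ne l
  induction j using Fin.lastCases with
  | last =>
    induction i using Fin.lastCases with
    | last => rfl
    | cast l =>
      obtain ⟨l', hl'⟩ := hother l
      have e1 := congrFun hr (.inr l)
      have e2 := congrFun hr (.inr l')
      simp [lineVec, hl', Fin.castSucc_ne_last] at e1 e2
      simp [e1] at e2
  | cast m =>
    induction i using Fin.lastCases with
    | last =>
      obtain ⟨l', hl'⟩ := hother m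
      have e2 := congrFun hr (.inr l')
      simp [lineVec, hl', Fin.castSucc_ne_last] at e2
    | cast l =>
      by_contra hlm
      have hlm' : l ≠ m := fun h => hlm (by rw [h])
      have e2 := congrFun hr (.inr l)
      simp [lineVec, hlm', Fin.castSucc_ne_last] at e2

/-- No two marked functionals are proportional, so only the `i + 1` coordinates attached to line `i`
survive. The dimension thus recovers `i`, which excludes nontrivial permutations of the lines. -/
theorem finrank_markSpace (hn : 1 ≤ n) (i : Fin (n + 2)) :
    Module.finrank K (markSpace (lineVec i : CoreIdx n → K)) = i + 1 := by
  have hmem : ∀ ξ : FreeIdx n ⊕ LineIdx n → K, ξ ∈ markSpace (lineVec i : CoreIdx n → K) ↔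
      (∀ j, ξ (.inl j) = 0) ∧ ∀ s, s.1 ≠ i → ξ (.inr s) = 0 := by
    intro ξ
    rw [mem_markSpace hn]
    refine and_congr_right fun _ => forall_congr' fun s => ?_
    constructor
    · intro h hs
      by_contra hne
      exact hs (eq_of_lineVec_mem hn (h hne))
    · intro h hne
      have : s.1 = i := by
        by_contra hs
        exact hne (h hs)
      rw [this]
      exact Submodule.mem_span_singleton_self _
  let e : markSpace (lineVec i : CoreIdx n → K) ≃ₗ[K] ({s : LineIdx n // s.1 = i} → K) :=
    { toFun := fun ξ s => ξ.1 (.inr s.1)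
      map_add' := fun _ _ => rfl
      map_smul' := fun _ _ => rfl
      invFun := fun w => ⟨Sum.elim 0 fun s => if h : s.1 = i then w ⟨s, h⟩ else 0, by
        rw [hmem]
        exact ⟨fun j => rfl, fun s hs => by simp [hs]⟩⟩
      left_inv := fun ξ => by
        obtain ⟨ξ, hξ⟩ := ξ
        obtain ⟨h0, h1⟩ := (hmem ξ).mp hξ
        ext (j | s)
        · simp [h0]
        · by_cases hs : s.1 = i
          · simp [hs]
          · simp [hs, h1 s hs]
      right_inv := fun w => by
        ext ⟨s, hs⟩
        simp [hs] }
  rw [e.finrank_eq, Module.finrank_fintype_fun_eq_card,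
    Fintype.card_congr (Equiv.sigmaSubtype (β := fun i : Fin (n + 2) => Fin (i + 1)) i)]
  simp

/-- A linear map preserving the side blocks scales each of the marked functionals. -/
theorem mulVec_lineVec (hn : 1 ≤ n) {g : Matrix (CoreIdx n) (CoreIdx n) K} (hg : IsUnit g)
    {R : Matrix (FreeIdx n ⊕ LineIdx n) (FreeIdx n ⊕ LineIdx n) K} (hR : IsUnit R)
    (h1 : ∀ (D : Matrix (CoreIdx n) (FreeIdx n) K) (c : LineIdx n → K), ∃ D' c',
      g * sideBlock D c * R = sideBlock D' c')
    (h2 : ∀ (D' : Matrix (CoreIdx n) (FreeIdx n) K) (c' : LineIdx n → K),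
      ∃ (D : Matrix (CoreIdx n) (FreeIdx n) K) (c : LineIdx n → K),
       g * sideBlock D c * R = sideBlock D' c') (i : Fin (n + 2)) :
    ∃ r : K, g.mulVec (lineVec i) = r • lineVec i := by
  have ginj := Matrix.mulVec_injective_of_isUnit hg
  -- Since left multiplication by `g` and right multiplication by `R` map the side blocks onto the
  -- side blocks, `R` carries the mark space of `g ψ` onto that of `ψ`.
  have hcomap : ∀ ψ : CoreIdx n → K, ∀ ξ,
      ξ ∈ markSpace (g.mulVec ψ) ↔ R.mulVec ξ ∈ markSpace ψ := by
    intro ψ ξ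
    have hspan : ∀ v, g.mulVec v ∈ Submodule.span K {g.mulVec ψ} ↔ v ∈ Submodule.span K {ψ} := by
      intro v
      simp only [Submodule.mem_span_singleton, ← Matrix.mulVec_smul, ginj.eq_iff]
    constructor
    · intro h D c
      obtain ⟨D', c', e⟩ := h1 D c
      rw [← hspan, Matrix.mulVec_mulVec, Matrix.mulVec_mulVec, e]
      exact h D' c'
    · intro h D' c'
      obtain ⟨D, c, e⟩ := h2 D' c'
      have := h D c
      rwa [← hspan, Matrix.mulVec_mulVec, Matrix.mulVec_mulVec, e] at this
  have hfin : ∀ ψ : CoreIdx n → K,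
      Module.finrank K (markSpace (g.mulVec ψ)) = Module.finrank K (markSpace ψ) := by
    intro ψ
    have : markSpace (g.mulVec ψ) = (markSpace ψ).comap R.mulVecLin := by
      ext ξ
      exact hcomap ψ ξ
    have e : (markSpace (g.mulVec ψ)).map R.mulVecLin = markSpace ψ := by
      rw [this]
      exact Submodule.map_comap_eq_of_surjective
        (Matrix.mulVec_surjective_iff_isUnit.mpr hR) _
    rw [← e]
    exact LinearEquiv.finrank_eq (Submodule.equivMapOfInjective _
      (Matrix.mulVec_injective_of_isUnit hR) _)
  -- The image of a marked functional has a nonzero mark space. It therefore lies on some marked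
  -- line, and the dimension tells which one.
  have hi := (hfin (lineVec i)).trans (finrank_markSpace hn i)
  have hne : markSpace (g.mulVec (lineVec i)) ≠ ⊥ := by
    intro h
    rw [h] at hi
    simp at hi
  obtain ⟨ξ, hξ, hξ0⟩ := Submodule.exists_mem_ne_zero_of_ne_bot hne
  obtain ⟨e0, e1⟩ := (mem_markSpace hn).mp hξ
  obtain ⟨s, hs⟩ : ∃ s, ξ (.inr s) ≠ 0 := by
    by_contra hcon
    push Not at hcon
    exact hξ0 (by ext (j | s) <;> simp [e0, hcon])
  obtain ⟨r, hr⟩ := Submodule.mem_span_singleton.mp (e1 s hs)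
  have hr0 : r ≠ 0 := by
    rintro rfl
    exact lineVec_ne_zero (K := K) s.1 (by simpa using hr.symm)
  have hgi : g.mulVec (lineVec i) = r⁻¹ • lineVec s.1 := by
    rw [← hr, smul_smul, inv_mul_cancel₀ hr0, one_smul]
  have heq : markSpace (g.mulVec (lineVec i)) = markSpace (lineVec s.1) := by
    ext ξ
    rw [mem_markSpace hn, mem_markSpace hn, hgi,
      Submodule.span_singleton_smul_eq (IsUnit.mk0 _ (inv_ne_zero hr0))]
  have hsi : s.1 = i := by
    rw [heq, finrank_markSpace hn] at hi
    exact Fin.ext (by omega)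
  exact ⟨r⁻¹, by rw [hgi, hsi]⟩

/-- A congruence of gadgets restricts to an isometry of the original spaces that matches the
frames up to a scalar. -/
theorem gadget_rigid (hn : 1 ≤ n) (hS : S ≠ 0) {Q : Matrix (GadgetIdx n) (GadgetIdx n) K}
    (h : IsCongruence Q (gadgetSpace A S) (gadgetSpace B T)) :
    ∃ (P : Matrix (Fin n) (Fin n) K) (r : K), r ≠ 0 ∧ IsCongruence P A B ∧ S * P = r • T := by
  have h12 := toBlocks₁₂_eq_zero h
  set G := Q.toBlocks₁₁ with hG
  set L := Q.toBlocks₂₁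
  set R := Q.toBlocks₂₂
  have hQ : Q = Matrix.fromBlocks G 0 L R := by
    conv_lhs => rw [← Q.fromBlocks_toBlocks, h12]
  have hdet : IsUnit G ∧ IsUnit R := by
    have := h.1
    rw [hQ, Matrix.isUnit_iff_isUnit_det, Matrix.det_fromBlocks_zero₁₂, IsUnit.mul_iff] at this
    simpa only [Matrix.isUnit_iff_isUnit_det] using this
  have hGt : IsUnit G.transpose := by
    rw [Matrix.isUnit_iff_isUnit_det, Matrix.det_transpose, ← Matrix.isUnit_iff_isUnit_det]
    exact hdet.1
  -- The upper right and lower left blocks involve only the side block. The remainder `L` affects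
  -- the core alone and vanishes with the side block.
  have hcalc : ∀ (a : Matrix (Fin n) (Fin n) K) t D c, Q.transpose * gadgetMap S (a, t, D, c) * Q =
      Matrix.fromBlocks (G.transpose * coreBlock a t S * G - L.transpose *
        (sideBlock D c).transpose * G + G.transpose * sideBlock D c * L)
        (G.transpose * sideBlock D c * R) (-(R.transpose * (sideBlock D c).transpose * G)) 0 := by
    intro a t D c
    rw [hQ, gadgetMap_apply]
    simp [Matrix.fromBlocks_transpose, Matrix.fromBlocks_multiply, Matrix.add_mul, sub_eq_add_neg]
  have hf : ∀ a ∈ A, ∀ t D c, ∃ b ∈ B, ∃ t' D' c',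
      Q.transpose * gadgetMap S (a, t, D, c) * Q = gadgetMap T (b, t', D', c') := by
    intro a ha t D c
    obtain ⟨b, hb, t', D', c', e⟩ := mem_gadgetSpace.mp
      ((h.2 _).mp (mem_gadgetSpace.mpr ⟨a, ha, t, D, c, rfl⟩))
    exact ⟨b, hb, t', D', c', e.symm⟩
  have hs : ∀ b ∈ B, ∀ t' D' c', ∃ a ∈ A, ∃ t D c,
      Q.transpose * gadgetMap S (a, t, D, c) * Q = gadgetMap T (b, t', D', c') := by
    intro b hb t' D' c'
    obtain ⟨M, hM, e⟩ := h.surj (mem_gadgetSpace.mpr ⟨b, hb, t', D', c', rfl⟩)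
    obtain ⟨a, ha, t, D, c, rfl⟩ := mem_gadgetSpace.mp hM
    exact ⟨a, ha, t, D, c, e⟩
  simp only [hcalc] at hf hs
  simp only [gadgetMap_apply, Matrix.fromBlocks_inj] at hf hs
  have hline := mulVec_lineVec hn hGt hdet.2
    (fun D c => by
      obtain ⟨b, -, t', D', c', -, e, -⟩ := hf 0 A.zero_mem 0 D c
      exact ⟨D', c', e⟩)
    (fun D' c' => by
      obtain ⟨a, -, t, D, c, -, e, -⟩ := hs 0 B.zero_mem 0 D' c'
      exact ⟨D, c, e⟩)
  obtain ⟨r, hr⟩ := hline (Fin.last _)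
  -- The unit vectors of the frame and their sum are all eigenvectors of `Gᵗ`. Comparing coordinates
  -- in the image of the sum makes every eigenvalue equal to `r`.
  have hframe : ∀ l : Fin (n + 1), G.transpose.mulVec (Pi.single (.inr l) 1) =
      r • Pi.single (.inr l) 1 := by
    have hlv : ∀ l : Fin (n + 1), (lineVec l.castSucc : CoreIdx n → K) =
        Pi.single (.inr l) 1 := by
      intro l
      ext (v | l')
      · simp [lineVec]
      · simp [lineVec, Fin.castSucc_ne_last, Pi.single_apply]
    have hsum : (lineVec (Fin.last _) : CoreIdx n → K) = ∑ l, lineVec (Fin.castSucc l) := by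
      ext (v | l')
      · simp [lineVec]
      · simp [lineVec, Fin.castSucc_ne_last]
    choose c hc using fun l : Fin (n + 1) => hline l.castSucc
    have hcr : ∀ l, c l = r := by
      intro l
      have e := congrFun hr (.inr l)
      rw [hsum, Matrix.mulVec_sum] at e
      simp only [hc] at e
      simpa [lineVec, Fin.castSucc_ne_last] using e
    intro l
    rw [← hlv, hc, hcr]
  have hG21 : G.toBlocks₂₁ = 0 := by
    ext l v
    simpa [Matrix.toBlocks₂₁] using congrFun (hframe l) (.inl v)
  have hG22 : G.toBlocks₂₂ = r • (1 : Matrix (Fin (n + 1)) (Fin (n + 1)) K) := by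
    ext l l'
    have := congrFun (hframe l) (.inr l')
    simp [Pi.single_apply] at this
    simp [Matrix.toBlocks₂₂, Matrix.one_apply, this, eq_comm]
  set P := G.toBlocks₁₁
  set N := G.toBlocks₁₂
  have hGb : G = Matrix.fromBlocks P N 0 (r • 1) := by
    conv_lhs => rw [← G.fromBlocks_toBlocks, hG21, hG22]
  have hdetP : IsUnit P ∧ r ≠ 0 := by
    have := hdet.1
    rw [hGb, Matrix.isUnit_iff_isUnit_det, Matrix.det_fromBlocks_zero₂₁, IsUnit.mul_iff] at this
    refine ⟨(Matrix.isUnit_iff_isUnit_det _).mpr this.1, ?_⟩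
    rintro rfl
    simp at this
  -- Only the left column of the transformed core block is compared below, so the right column is
  -- left unspecified.
  have hcore : ∀ (a : Matrix (Fin n) (Fin n) K) t, ∃ E₁ E₂, G.transpose * coreBlock a t S * G =
      Matrix.fromBlocks (P.transpose * a * P) E₁ (N.transpose * a * P + (r * t) • (S * P)) E₂ := by
    intro a t
    rw [hGb]
    simp only [coreBlock, Matrix.fromBlocks_transpose, Matrix.fromBlocks_multiply]
    refine ⟨_, _, Matrix.fromBlocks_inj.mpr ⟨?_, rfl, ?_, rfl⟩⟩
    · simp
    · simp [Matrix.add_mul, smul_smul, mul_comm t r]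
  have hfwd : ∀ a ∈ A, P.transpose * a * P ∈ B := by
    intro a ha
    obtain ⟨b, hb, t', D', c', e, -⟩ := hf a ha 0 0 0
    obtain ⟨E₁, E₂, e'⟩ := hcore a 0
    rw [sideBlock_zero, e'] at e
    simp only [coreBlock, Matrix.transpose_zero, Matrix.mul_zero, Matrix.zero_mul, sub_zero,
      add_zero, Matrix.fromBlocks_inj] at e
    rw [e.1]
    exact hb
  obtain ⟨u, hu⟩ := hdetP.1
  have hu1 : P * (↑u⁻¹ : Matrix (Fin n) (Fin n) K) = 1 := by rw [← hu]; exact u.mul_inv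
  have hcong : IsCongruence P A B := by
    refine IsCongruence.of_inverse hu1 hfwd ?_
    intro b hb
    obtain ⟨a, ha, t, D, c, e, e2, -⟩ := hs b hb 0 0 0
    -- A source element corresponding to a target element without side block has none either, since
    -- `G` and `R` are invertible. The terms with `L` then disappear.
    have hside : sideBlock D c = 0 := by
      rw [sideBlock_zero] at e2
      obtain ⟨R', hR'⟩ := hdet.2.exists_right_inv
      obtain ⟨G', hG'⟩ := hGt.exists_left_inv
      calc sideBlock D c = (G' * G.transpose) * sideBlock D c * (R * R') := by
            rw [hG', hR', Matrix.one_mul, Matrix.mul_one]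
        _ = G' * (G.transpose * sideBlock D c * R) * R' := by simp only [Matrix.mul_assoc]
        _ = 0 := by rw [e2, Matrix.mul_zero, Matrix.zero_mul]
    obtain ⟨E₁, E₂, e'⟩ := hcore a t
    rw [hside, e'] at e
    simp only [coreBlock, Matrix.transpose_zero, Matrix.mul_zero, Matrix.zero_mul, sub_zero,
      add_zero, Matrix.fromBlocks_inj] at e
    rw [← e.1, congr_cancel hu1]
    exact ha
  -- The frame matrix alone: its lower left block yields `r • (S * P) = t' • T`.
  obtain ⟨b, hb, t', D', c', e, -⟩ := hf 0 A.zero_mem 1 0 0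
  obtain ⟨E₁, E₂, e'⟩ := hcore 0 1
  rw [sideBlock_zero, e'] at e
  simp only [coreBlock, Matrix.transpose_zero, Matrix.mul_zero, Matrix.zero_mul, sub_zero,
    add_zero, zero_add, mul_one, Matrix.fromBlocks_inj] at e
  have hSP : S * P = (r⁻¹ * t') • T := by
    rw [mul_smul, ← e.2.2.1, smul_smul, inv_mul_cancel₀ hdetP.2, one_smul]
  refine ⟨P, r⁻¹ * t', ?_, hcong, hSP⟩
  -- A zero factor would give `S * P = 0`, hence `S = 0` as `P` is invertible.
  intro h0
  apply hS
  rw [h0, zero_smul] at hSP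
  calc S = S * P * (↑u⁻¹ : Matrix (Fin n) (Fin n) K) := by
        rw [Matrix.mul_assoc, hu1, Matrix.mul_one]
    _ = 0 := by rw [hSP, Matrix.zero_mul]

end Rigidity
end Gadget

/-! ### The gadget as an instance of the isometry problem -/

section Isometry
variable {K : Type*} [Field K] {ι ι' : Type*} [Fintype ι] [DecidableEq ι] [Fintype ι']
  [DecidableEq ι']

/-- Congruence by an invertible matrix is injective, so equality of the image with `T` amounts to a
membership equivalence for each matrix, a form that transports well along index bijections. -/
theorem isIsometry_iff {n : ℕ} (P : Matrix.GeneralLinearGroup (Fin n) K)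
    (S T : Submodule K (Matrix (Fin n) (Fin n) K)) :
    IsIsometry P S T ↔ IsCongruence (P : Matrix (Fin n) (Fin n) K) S T := by
  have hP : (P : Matrix (Fin n) (Fin n) K) * (↑P⁻¹ : Matrix (Fin n) (Fin n) K) = 1 := P.mul_inv
  have hP' : (↑P⁻¹ : Matrix (Fin n) (Fin n) K) * (P : Matrix (Fin n) (Fin n) K) = 1 := P.inv_mul
  constructor
  · intro h
    refine ⟨P.isUnit, fun M => ⟨fun hM => ?_, fun hM => ?_⟩⟩
    · have : _ ∈ (T : Set (Matrix (Fin n) (Fin n) K)) := h ▸ Set.mem_image_of_mem _ hM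
      exact this
    · have hM' : _ ∈ (T : Set (Matrix (Fin n) (Fin n) K)) := hM
      rw [← h] at hM'
      obtain ⟨M', hM', e⟩ := hM'
      have e' : P.1.transpose * M' * P.1 = P.1.transpose * M * P.1 := e
      have := congrArg (fun X => (↑P⁻¹ : Matrix (Fin n) (Fin n) K).transpose * X *
        (↑P⁻¹ : Matrix (Fin n) (Fin n) K)) e'
      simp only [congr_cancel hP] at this
      rwa [← this]
  · intro h
    ext N
    constructor
    · rintro ⟨M, hM, rfl⟩
      exact (h.2 M).mp hM
    · intro hN
      obtain ⟨M, hM, e⟩ := h.surj hN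
      exact ⟨M, hM, e⟩

theorem isometric_iff {n : ℕ} (S T : Submodule K (Matrix (Fin n) (Fin n) K)) :
    Isometric S T ↔ ∃ P, IsCongruence P S T := by
  constructor
  · rintro ⟨P, hP⟩
    exact ⟨P, (isIsometry_iff P S T).mp hP⟩
  · rintro ⟨P, hP⟩
    obtain ⟨⟨u, rfl⟩, -⟩ := id hP
    exact ⟨u, (isIsometry_iff u S T).mpr hP⟩

theorem IsCongruence.reindex (e : ι' ≃ ι) {Q : Matrix ι ι K} {S T : Submodule K (Matrix ι ι K)}
    (h : IsCongruence Q S T) : IsCongruence (Q.submatrix e e)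
      (S.map (Matrix.reindexLinearEquiv K K e.symm e.symm).toLinearMap)
      (T.map (Matrix.reindexLinearEquiv K K e.symm e.symm).toLinearMap) := by
  refine ⟨?_, fun M => ?_⟩
  · rw [Matrix.isUnit_iff_isUnit_det, Matrix.det_submatrix_equiv_self,
      ← Matrix.isUnit_iff_isUnit_det]
    exact h.1
  · obtain ⟨M, rfl⟩ := (Matrix.reindexLinearEquiv K K e.symm e.symm).surjective M
    have hM : ∀ (U : Submodule K (Matrix ι ι K)) N, Matrix.reindexLinearEquiv K K e.symm e.symm N ∈
        U.map (Matrix.reindexLinearEquiv K K e.symm e.symm).toLinearMap ↔ N ∈ U := by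
      intro U N
      exact (Matrix.reindexLinearEquiv K K e.symm e.symm).injective.mem_set_image
    have hQ : (Q.submatrix e e).transpose * Matrix.reindexLinearEquiv K K e.symm e.symm M *
        Q.submatrix e e = Matrix.reindexLinearEquiv K K e.symm e.symm (Q.transpose * M * Q) := by
      simp [Matrix.coe_reindexLinearEquiv, Matrix.transpose_submatrix, Matrix.submatrix_mul_equiv]
    rw [hQ, hM, hM]
    exact h.2 M

theorem exists_isCongruence_reindex (e : ι' ≃ ι) (S T : Submodule K (Matrix ι ι K)) :
    (∃ Q, IsCongruence Q (S.map (Matrix.reindexLinearEquiv K K e.symm e.symm).toLinearMap)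
      (T.map (Matrix.reindexLinearEquiv K K e.symm e.symm).toLinearMap)) ↔
    ∃ Q, IsCongruence Q S T := by
  constructor
  · rintro ⟨Q, hQ⟩
    have := hQ.reindex e.symm
    rw [← Submodule.map_comp, ← Submodule.map_comp] at this
    have hid : (Matrix.reindexLinearEquiv K K e.symm.symm e.symm.symm).toLinearMap ∘ₗ
        (Matrix.reindexLinearEquiv K K e.symm e.symm).toLinearMap =
        (LinearMap.id : Matrix ι ι K →ₗ[K] Matrix ι ι K) := by
      ext M
      simp
    rw [hid, Submodule.map_id, Submodule.map_id] at this
    exact ⟨_, this⟩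
  · rintro ⟨Q, hQ⟩
    exact ⟨_, hQ.reindex e⟩

end Isometry

/-- The core indices in order. -/
def coreList (n : ℕ) : List (CoreIdx n) :=
  (List.finRange n).map .inl ++ (List.finRange (n + 1)).map .inr

/-- The line indices in order. -/
def lineList (n : ℕ) : List (LineIdx n) :=
  (List.finRange (n + 2)).flatMap fun i : Fin (n + 2) =>
    (List.finRange (i.val + 1)).map fun j => ⟨i, j⟩

/-- The marking indices in order. -/
def markList (n : ℕ) : List (FreeIdx n ⊕ LineIdx n) :=
  (List.finRange (2 * n + 2)).map .inl ++ (lineList n).map .inr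

/-- The gadget indices in order. -/
def gadgetList (n : ℕ) : List (GadgetIdx n) := (coreList n).map .inl ++ (markList n).map .inr

/-- Indices of the basis of the gadget. -/
abbrev FormIdx (n m : ℕ) : Type := Fin m ⊕ (Unit ⊕ (CoreIdx n × FreeIdx n ⊕ LineIdx n))

/-- The basis of the gadget in order. -/
def formList (n m : ℕ) : List (FormIdx n m) :=
  (List.finRange m).map .inl ++ (.inr (.inl ()) :: ((coreList n).flatMap fun y =>
    (List.finRange (2 * n + 2)).map fun j => .inr (.inr (.inl (y, j)))) ++
    (lineList n).map fun s => .inr (.inr (.inr s)))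

theorem nodup_sum {α β : Type*} {l : List α} {l' : List β} (h : l.Nodup) (h' : l'.Nodup) :
    (l.map Sum.inl ++ l'.map Sum.inr : List (α ⊕ β)).Nodup := by
  rw [List.nodup_append]
  refine ⟨h.map Sum.inl_injective, h'.map Sum.inr_injective, ?_⟩
  simp

theorem nodup_coreList (n : ℕ) : (coreList n).Nodup :=
  nodup_sum (List.nodup_finRange _) (List.nodup_finRange _)

theorem mem_coreList (n : ℕ) (y : CoreIdx n) : y ∈ coreList n := by
  rcases y with v | l <;> simp [coreList]

theorem nodup_lineList (n : ℕ) : (lineList n).Nodup := by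
  rw [lineList, List.nodup_flatMap]
  refine ⟨fun i _ => (List.nodup_finRange _).map fun a b h => by simpa using h, ?_⟩
  refine (List.nodup_finRange _).imp fun {i j} hij => ?_
  simp only [Function.onFun, List.disjoint_left, List.mem_map, not_exists, not_and]
  rintro _ ⟨k, -, rfl⟩ k' - h
  exact hij (congrArg Sigma.fst h).symm

theorem mem_lineList (n : ℕ) (s : LineIdx n) : s ∈ lineList n := by
  simp only [lineList, List.mem_flatMap, List.mem_map]
  exact ⟨s.1, List.mem_finRange _, s.2, List.mem_finRange _, rfl⟩

theorem nodup_gadgetList (n : ℕ) : (gadgetList n).Nodup :=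
  nodup_sum (nodup_coreList n) (nodup_sum (List.nodup_finRange _) (nodup_lineList n))

theorem mem_gadgetList (n : ℕ) (i : GadgetIdx n) : i ∈ gadgetList n := by
  rcases i with y | j | s
  · simp [gadgetList, mem_coreList]
  · simp [gadgetList, markList]
  · simp [gadgetList, markList, mem_lineList]

theorem nodup_formList (n m : ℕ) : (formList n m).Nodup := by
  have h1 : ((coreList n).flatMap fun y => (List.finRange (2 * n + 2)).map fun j =>
      ((y, j) : CoreIdx n × FreeIdx n)).Nodup :=
    (nodup_coreList n).product (List.nodup_finRange _)
  have h2 := nodup_sum h1 (nodup_lineList n)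
  have h3 := nodup_sum (List.nodup_singleton ()) h2
  have h4 := nodup_sum (List.nodup_finRange m) h3
  convert h4 using 1
  simp [formList, List.map_flatMap, Function.comp_def]

theorem mem_formList (n m : ℕ) (k : FormIdx n m) : k ∈ formList n m := by
  rcases k with k | u | ⟨y, j⟩ | s
  · simp [formList]
  · simp [formList]
  · simp [formList, mem_coreList]
  · simp [formList, mem_lineList]

theorem length_lineList_le (n : ℕ) : (lineList n).length ≤ (n + 2) * (n + 2) := by
  rw [lineList, List.length_flatMap]
  refine (List.sum_le_card_nsmul _ (n + 2) ?_).trans ?_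
  · intro x hx
    simp only [List.mem_map] at hx
    obtain ⟨i, -, rfl⟩ := hx
    simp
    omega
  · simp

theorem length_gadgetList_le {n : ℕ} (hn : 1 ≤ n) : (gadgetList n).length ≤ 30 * n ^ 2 := by
  have := length_lineList_le n
  simp only [gadgetList, coreList, markList, List.length_append, List.length_map,
    List.length_finRange]
  nlinarith

/-- The count is at most `6 * n ^ 2 + 10 * n + 7`, so the constant 30, chosen to serve for the
matrix size as well, is generous. -/
theorem length_formList_le {n m : ℕ} (hn : 1 ≤ n) (hm : m ≤ n ^ 2) :
    (formList n m).length ≤ 30 * n ^ 2 := by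
  have := length_lineList_le n
  simp only [formList, coreList, List.length_append, List.length_map, List.length_finRange,
    List.length_cons, List.length_flatMap, List.map_const', List.sum_replicate, smul_eq_mul]
  nlinarith

/-- Enumeration of the gadget indices. -/
def gadgetEquiv (n : ℕ) : Fin (gadgetList n).length ≃ GadgetIdx n :=
  List.Nodup.getEquivOfForallMemList _ (nodup_gadgetList n) (mem_gadgetList n)

/-- Enumeration of the basis of the gadget. -/
def formEquiv (n m : ℕ) : Fin (formList n m).length ≃ FormIdx n m :=
  List.Nodup.getEquivOfForallMemList _ (nodup_formList n m) (mem_formList n m)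

/-! ### A basis of the gadget and the criterion for isometry of two gadgets -/

section Gadget
variable {K : Type*} [Field K] {n m : ℕ}

/-- The parameters of the basis matrices of the gadget. -/
def formParam (A : Fin m → Matrix (Fin n) (Fin n) K) : FormIdx n m →
    Matrix (Fin n) (Fin n) K × K × Matrix (CoreIdx n) (FreeIdx n) K × (LineIdx n → K)
  | .inl k => (A k, 0, 0, 0)
  | .inr (.inl _) => (0, 1, 0, 0)
  | .inr (.inr (.inl q)) => (0, 0, Matrix.single q.1 q.2 1, 0)
  | .inr (.inr (.inr s)) => (0, 0, 0, Pi.single s 1)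

/-- The gadget as a tuple of matrices. -/
def gadgetTuple (A : Fin m → Matrix (Fin n) (Fin n) K) (S : Matrix (Fin (n + 1)) (Fin n) K)
    (k : Fin (formList n m).length) :
    Matrix (Fin (gadgetList n).length) (Fin (gadgetList n).length) K :=
  (gadgetMap S (formParam A (formEquiv n m k))).submatrix (gadgetEquiv n) (gadgetEquiv n)

theorem sum_formParam (A : Fin m → Matrix (Fin n) (Fin n) K) (g : FormIdx n m → K) :
    ∑ k, g k • formParam A k = (∑ k, g (.inl k) • A k, g (.inr (.inl ())),
      Matrix.of fun y j => g (.inr (.inr (.inl (y, j)))), fun s => g (.inr (.inr (.inr s)))) := by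
  simp only [Fintype.sum_sum_type, formParam, Finset.univ_unique, Finset.sum_singleton]
  refine Prod.ext ?_ (Prod.ext ?_ (Prod.ext ?_ ?_))
  · simp [Prod.fst_sum]
  · simp [Prod.fst_sum, Prod.snd_sum]
  · simp only [Prod.fst_sum, Prod.snd_sum, Prod.fst_add, Prod.snd_add, Prod.smul_snd,
      Prod.smul_fst, smul_zero, Finset.sum_const_zero, zero_add, add_zero]
    ext y j
    rw [Matrix.sum_apply, Finset.sum_eq_single (y, j)]
    · simp
    · rintro ⟨y', j'⟩ - hne
      have : ¬ (y' = y ∧ j' = j) := fun h => hne (by rw [h.1, h.2])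
      simp [this]
    · simp
  · simp only [Prod.snd_sum, Prod.snd_add, Prod.smul_snd, smul_zero, Finset.sum_const_zero,
      zero_add]
    ext s
    simp [Finset.sum_apply, Pi.single_apply]

theorem linearIndependent_formParam {A : Fin m → Matrix (Fin n) (Fin n) K}
    (hA : LinearIndependent K A) : LinearIndependent K (formParam A) := by
  rw [Fintype.linearIndependent_iff]
  intro g hg
  rw [sum_formParam] at hg
  simp only [Prod.mk_eq_zero] at hg
  obtain ⟨h1, h2, h3, h4⟩ := hg
  rintro (k | u | ⟨y, j⟩ | s)
  · exact Fintype.linearIndependent_iff.mp hA _ h1 k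
  · exact h2
  · exact congrFun (congrFun h3 y) j
  · exact congrFun h4 s

theorem span_formParam (A : Fin m → Matrix (Fin n) (Fin n) K) :
    Submodule.span K (Set.range (formParam A)) = (space A).prod ⊤ := by
  apply le_antisymm
  · rw [Submodule.span_le]
    rintro _ ⟨k, rfl⟩
    refine ⟨?_, trivial⟩
    rcases k with k | u | q | s
    · exact Submodule.subset_span ⟨k, rfl⟩
    all_goals exact Submodule.zero_mem _
  · rintro ⟨a, t, D, c⟩ ⟨ha, -⟩
    obtain ⟨g, rfl⟩ := (Submodule.mem_span_range_iff_exists_fun K).mp ha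
    refine (Submodule.mem_span_range_iff_exists_fun K).mpr
      ⟨Sum.elim g (Sum.elim (fun _ => t) (Sum.elim (fun q => D q.1 q.2) c)), ?_⟩
    rw [sum_formParam]
    rfl

/-- The parameters can be read off from the blocks. The condition `S ≠ 0` serves to recover `t`,
while `c` is recovered because no marked functional is zero. -/
theorem gadgetMap_injective {S : Matrix (Fin (n + 1)) (Fin n) K} (hS : S ≠ 0) :
    Function.Injective (gadgetMap S) := by
  rw [← LinearMap.ker_eq_bot, LinearMap.ker_eq_bot']
  rintro ⟨a, t, D, c⟩ h
  rw [gadgetMap_apply, show (0 : Matrix (GadgetIdx n) (GadgetIdx n) K) =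
    Matrix.fromBlocks 0 0 0 0 from Matrix.fromBlocks_zero.symm, Matrix.fromBlocks_inj] at h
  obtain ⟨h1, h2, -⟩ := h
  rw [coreBlock, show (0 : Matrix (CoreIdx n) (CoreIdx n) K) =
    Matrix.fromBlocks 0 0 0 0 from Matrix.fromBlocks_zero.symm, Matrix.fromBlocks_inj] at h1
  obtain ⟨h3, -, h4, -⟩ := h1
  have h5 : D = 0 := by
    ext y j
    simpa [sideBlock] using congrFun (congrFun h2 y) (.inl j)
  have h6 : c = 0 := by
    ext s
    have h7 : ∀ y, c s * lineVec s.1 y = 0 := fun y => by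
      simpa [sideBlock] using congrFun (congrFun h2 y) (.inr s)
    obtain ⟨y, hy⟩ := Function.ne_iff.mp (lineVec_ne_zero (K := K) s.1)
    exact (mul_eq_zero.mp (h7 y)).resolve_right hy
  have h8 : t = 0 := (smul_eq_zero.mp h4).resolve_right hS
  rw [h3, h5, h6, h8]
  rfl

theorem space_gadgetTuple (A : Fin m → Matrix (Fin n) (Fin n) K)
    (S : Matrix (Fin (n + 1)) (Fin n) K) :
    space (gadgetTuple A S) = (gadgetSpace (space A) S).map
      (Matrix.reindexLinearEquiv K K (gadgetEquiv n).symm (gadgetEquiv n).symm).toLinearMap := by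
  rw [gadgetSpace, ← span_formParam, ← Submodule.map_comp, Submodule.map_span, space]
  congr 1
  rw [← Set.range_comp, ← (formEquiv n m).surjective.range_comp]
  rfl

/-- Quadratic forms of gadget matrices come from the given matrices. -/
theorem gadgetMap_dotProduct (S : Matrix (Fin (n + 1)) (Fin n) K) (a : Matrix (Fin n) (Fin n) K)
    (t : K) (D : Matrix (CoreIdx n) (FreeIdx n) K) (c : LineIdx n → K) (x : GadgetIdx n → K) :
    dotProduct x ((gadgetMap S (a, t, D, c)).mulVec x) =
      dotProduct (fun i => x (.inl (.inl i))) (a.mulVec fun i => x (.inl (.inl i))) := by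
  have hswap : ∀ {μ ν : Type} [Fintype μ] [Fintype ν] (M : Matrix μ ν K) (u : μ → K) (v : ν → K),
      dotProduct v (M.transpose.mulVec u) = dotProduct u (M.mulVec v) := by
    intro μ ν _ _ M u v
    rw [Matrix.mulVec_transpose, Matrix.dotProduct_mulVec, dotProduct_comm]
  have hsplit : ∀ {μ ν : Type} [Fintype μ] [Fintype ν] (u v : μ ⊕ ν → K), dotProduct u v =
      dotProduct (u ∘ Sum.inl) (v ∘ Sum.inl) + dotProduct (u ∘ Sum.inr) (v ∘ Sum.inr) := by
    intro μ ν _ _ u v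
    simp [dotProduct]
  -- Every off-diagonal block is accompanied by its negative transpose, and the two cancel in the
  -- quadratic form in any characteristic.
  rw [gadgetMap_apply, Matrix.fromBlocks_mulVec, hsplit]
  simp only [Sum.elim_comp_inl, Sum.elim_comp_inr, Matrix.neg_mulVec, Matrix.zero_mulVec, add_zero,
    dotProduct_add, dotProduct_neg, hswap]
  rw [coreBlock, Matrix.fromBlocks_mulVec, hsplit (x ∘ Sum.inl)]
  simp only [Sum.elim_comp_inl, Sum.elim_comp_inr, Matrix.neg_mulVec, Matrix.zero_mulVec, add_zero,
    dotProduct_add, dotProduct_neg, ← Matrix.transpose_smul, hswap]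
  simp [Function.comp_def]

theorem isAltBasis_gadgetTuple {A : Fin m → Matrix (Fin n) (Fin n) K} (hA : IsAltBasis A)
    {S : Matrix (Fin (n + 1)) (Fin n) K} (hS : S ≠ 0) : IsAltBasis (gadgetTuple A S) := by
  refine ⟨fun k v => ?_, ?_⟩
  · have : dotProduct v ((gadgetTuple A S k).mulVec v) =
        dotProduct (v ∘ (gadgetEquiv n).symm)
          ((gadgetMap S (formParam A (formEquiv n m k))).mulVec (v ∘ (gadgetEquiv n).symm)) := by
      rw [gadgetTuple, Matrix.submatrix_mulVec_equiv, ← dotProduct_comp_equiv_symm]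
      rfl
    rw [this]
    obtain ⟨a, t, D, c, hq, ha⟩ : ∃ a t D c, formParam A (formEquiv n m k) = (a, t, D, c) ∧
        IsAlternating a := by
      rcases formEquiv n m k with k | u | q | s
      · exact ⟨_, _, _, _, rfl, hA.1 k⟩
      all_goals exact ⟨_, _, _, _, rfl, fun v => by simp⟩
    rw [hq, gadgetMap_dotProduct]
    exact ha _
  · have h1 := (linearIndependent_formParam hA.2).map' (gadgetMap S)
      (LinearMap.ker_eq_bot.mpr (gadgetMap_injective hS))
    have h2 := h1.map' (Matrix.reindexLinearEquiv K K (gadgetEquiv n).symm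
      (gadgetEquiv n).symm).toLinearMap (LinearEquiv.ker _)
    exact h2.comp _ (formEquiv n m).injective

theorem isometric_gadgetTuple {m' : ℕ} (A : Fin m → Matrix (Fin n) (Fin n) K)
    (B : Fin m' → Matrix (Fin n) (Fin n) K) (S T : Matrix (Fin (n + 1)) (Fin n) K) :
    Isometric (space (gadgetTuple A S)) (space (gadgetTuple B T)) ↔
      ∃ Q, IsCongruence Q (gadgetSpace (space A) S) (gadgetSpace (space B) T) := by
  rw [isometric_iff, space_gadgetTuple, space_gadgetTuple, exists_isCongruence_reindex]

/-- The gadgets are isometric exactly if some isometry of the original spaces matches the frames. -/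
theorem isometric_gadgetTuple_iff {m' : ℕ} (hn : 1 ≤ n) (A : Fin m → Matrix (Fin n) (Fin n) K)
    (B : Fin m' → Matrix (Fin n) (Fin n) K) {S T : Matrix (Fin (n + 1)) (Fin n) K} (hS : S ≠ 0) :
    Isometric (space (gadgetTuple A S)) (space (gadgetTuple B T)) ↔
      ∃ P, IsCongruence P (space A) (space B) ∧ S * P = T := by
  rw [isometric_gadgetTuple]
  constructor
  · rintro ⟨Q, hQ⟩
    obtain ⟨P, r, hr, hP, hST⟩ := gadget_rigid hn hS hQ
    -- Matrix spaces are closed under scaling, so the projective ambiguity of the frame is absorbed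
    -- into the isometry.
    refine ⟨r⁻¹ • P, hP.smul (inv_ne_zero hr), ?_⟩
    rw [Matrix.mul_smul, hST, smul_smul, inv_mul_cancel₀ hr, one_smul]
  · rintro ⟨P, hP, rfl⟩
    exact gadget_congruence hP

theorem card_le_sq {A : Fin m → Matrix (Fin n) (Fin n) K} (hA : IsAltBasis A) : m ≤ n ^ 2 := by
  have := hA.2.fintype_card_le_finrank
  rw [Module.finrank_matrix] at this
  simp at this
  rw [sq]
  exact this

end Gadget

/-! ### Encoding of the gadget -/

section Encoding
variable {p : ℕ} {F : Type*} [Field F] [Algebra (ZMod p) F] (pb : PowerBasis (ZMod p) F)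

theorem encList_ofFn_get {S T : Type*} (enc : T → Val) (l : List S) (g : S → T) :
    encList enc (List.ofFn fun k : Fin l.length => g (l.get k)) = encList (fun a => enc (g a)) l := by
  rw [← encList_map enc g]
  congr 1
  have := List.map_ofFn (f := l.get) (g := g)
  rw [List.ofFn_get] at this
  exact this.symm

theorem encMatrix_submatrix {n : ℕ} (M : Matrix (GadgetIdx n) (GadgetIdx n) F) :
    encMatrix pb (M.submatrix (gadgetEquiv n) (gadgetEquiv n)) =
      encList (fun i => encList (fun j => encElt pb (M i j)) (gadgetList n)) (gadgetList n) := by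
  have h1 : ∀ i, encList (encElt pb) (List.ofFn fun j => M i (gadgetEquiv n j)) =
      encList (fun j => encElt pb (M i j)) (gadgetList n) := fun i =>
    encList_ofFn_get (encElt pb) (gadgetList n) fun j => M i j
  have h2 := encList_ofFn_get (encList (encElt pb)) (gadgetList n) fun i =>
    List.ofFn fun j => M i (gadgetEquiv n j)
  simp only [h1] at h2
  exact h2

theorem encTuple_gadgetTuple {n m : ℕ} (A : Fin m → Matrix (Fin n) (Fin n) F)
    (S : Matrix (Fin (n + 1)) (Fin n) F) : encTuple pb (gadgetTuple A S) =
      encList (fun k => encList (fun i => encList (fun j =>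
        encElt pb (gadgetMap S (formParam A k) i j)) (gadgetList n)) (gadgetList n))
        (formList n m) := by
  simp only [← encMatrix_submatrix]
  exact encList_ofFn_get (encMatrix pb) (formList n m) fun k =>
    (gadgetMap S (formParam A k)).submatrix (gadgetEquiv n) (gadgetEquiv n)

end Encoding

/-! ### Writing down the gadget -/

/-- Conjunction of Boolean values. -/
def andV (a b : Val) : Val := iteV a b .nil

/-- Equality of index labels. -/
def eqLabelV (a b : Val) : Val :=
  andV (eqV a.fst b.fst) (andV (eqV a.snd.fst b.snd.fst) (eqV a.snd.snd b.snd.snd))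

/-- The label with a given tag and index. -/
def labelV (t a : Val) : Val := .cons t (.cons a .nil)

/-- The labels of the indices of the given matrices. -/
def baseLabelsV (u : Val) : Val := mapV (fun a => labelV (encUnary 0) a) (rangeV u)

/-- The labels of the frame indices. -/
def frameLabelsV (u : Val) : Val := mapV (fun a => labelV (encUnary 1) a) (rangeV (.cons .nil u))

/-- The labels of the core indices. -/
def coreLabelsV (u : Val) : Val := appV (baseLabelsV u) (frameLabelsV u)

/-- The labels of the indices marking the core. -/
def freeLabelsV (u : Val) : Val :=
  mapV (fun a => labelV (encUnary 2) a) (rangeV (.cons .nil (.cons .nil (appV u u))))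

/-- The marked functionals, each given by the labels of its support and its index. -/
def lineItemsV (u : Val) : Val :=
  appV (mapV (fun a => .cons (.cons (labelV (encUnary 1) a) .nil) a) (rangeV (.cons .nil u)))
    (.cons (.cons (frameLabelsV u) (.cons .nil u)) .nil)

/-- The basis elements marking lines, each given by a list of core labels and one label. -/
def lineFormsV (u : Val) : Val :=
  flatMapV (fun i => mapV (fun j => .cons i.fst (.cons (encUnary 3) (.cons i.snd j)))
    (rangeV (.cons .nil i.snd))) (lineItemsV u)

/-- The basis elements marking the core. -/
def freeFormsV (u : Val) : Val :=
  flatMapV (fun y => mapV (fun x => .cons (.cons y .nil) x) (freeLabelsV u)) (coreLabelsV u)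

/-- The labels of the marking indices. -/
def markLabelsV (u : Val) : Val :=
  appV (freeLabelsV u) (mapV (fun f => f.snd) (lineFormsV u))

/-- All labels. -/
def gadgetLabelsV (u : Val) : Val := appV (coreLabelsV u) (markLabelsV u)

/-- Membership of a label in a list. -/
def memLabelV (a l : Val) : Val := anyV (fun y => eqLabelV y a) l

/-- An entry of the alternating matrix given by a list of core labels and one label; the first
argument holds the field elements `0`, `1` and `-1`. -/
def wedgeEntryV (k f a b : Val) : Val :=
  iteV (andV (eqLabelV b f.snd) (memLabelV a f.fst)) k.snd.fst
    (iteV (andV (eqLabelV a f.snd) (memLabelV b f.fst)) k.snd.snd k.fst)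

/-- The alternating matrix given by a list of core labels and one label. -/
def wedgeV (k u f : Val) : Val :=
  mapV (fun a => mapV (fun b => wedgeEntryV k f a b) (gadgetLabelsV u)) (gadgetLabelsV u)

/-- A constant list. -/
def constV (z l : Val) : Val := mapV (fun _ => z) l

/-- Extension of a matrix by zero. -/
def padV (k u a : Val) : Val :=
  appV (mapV (fun r => appV r (constV k.fst (appV (frameLabelsV u) (markLabelsV u)))) a)
    (constV (constV k.fst (gadgetLabelsV u)) (appV (frameLabelsV u) (markLabelsV u)))

/-- Extension of a list of rows by zero rows. -/
def padRowsV (k u rows : Val) : Val :=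
  appV rows (dropV rows (constV (.cons (constV k.fst (rangeV u)) (constV k.fst (rangeV u)))
    (rangeV (.cons .nil u))))

/-- The matrix of the frame. -/
def frameV (k u rows : Val) : Val :=
  appV (mapV (fun a => appV (constV k.fst (rangeV u)) (appV (mapV (fun r => nthV r.snd a)
      (padRowsV k u rows)) (constV k.fst (markLabelsV u)))) (rangeV u))
    (appV (mapV (fun r => appV r.fst (constV k.fst (appV (frameLabelsV u) (markLabelsV u))))
      (padRowsV k u rows)) (constV (constV k.fst (gadgetLabelsV u)) (markLabelsV u)))

/-- The gadget of a tuple of matrices and a list of rows. -/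
def gadgetV (k u A rows : Val) : Val :=
  appV (mapV (fun a => padV k u a) A) (.cons (frameV k u rows)
    (mapV (fun f => wedgeV k u f) (appV (freeFormsV u) (lineFormsV u))))

/-! ### The gadget takes polynomial time -/

namespace PolyTime
variable {f g h k u a b : Val → Val}

theorem andV (hf : PolyTime f) (hg : PolyTime g) : PolyTime fun x => andV (f x) (g x) :=
  ite hf hg const_nil

theorem eqLabelV (hf : PolyTime f) (hg : PolyTime g) : PolyTime fun x => eqLabelV (f x) (g x) :=
  andV (eqV hf.fst hg.fst) (andV (eqV hf.snd.fst hg.snd.fst) (eqV hf.snd.snd hg.snd.snd))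

theorem labelV (hf : PolyTime f) (hg : PolyTime g) : PolyTime fun x => labelV (f x) (g x) :=
  hf.cons (hg.cons const_nil)

theorem baseLabelsV (hu : PolyTime u) : PolyTime fun x => baseLabelsV (u x) :=
  mapV (labelV (const _) id.fst) (rangeV hu)

theorem frameLabelsV (hu : PolyTime u) : PolyTime fun x => frameLabelsV (u x) :=
  mapV (labelV (const _) id.fst) (rangeV (const_nil.cons hu))

theorem coreLabelsV (hu : PolyTime u) : PolyTime fun x => coreLabelsV (u x) :=
  appV hu.baseLabelsV hu.frameLabelsV

theorem freeLabelsV (hu : PolyTime u) : PolyTime fun x => freeLabelsV (u x) :=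
  mapV (labelV (const _) id.fst) (rangeV (const_nil.cons (const_nil.cons (appV hu hu))))

theorem lineItemsV (hu : PolyTime u) : PolyTime fun x => lineItemsV (u x) :=
  appV (mapV (((labelV (const _) id.fst).cons const_nil).cons id.fst)
    (rangeV (const_nil.cons hu))) ((hu.frameLabelsV.cons (const_nil.cons hu)).cons const_nil)

theorem lineFormsV (hu : PolyTime u) : PolyTime fun x => lineFormsV (u x) :=
  flatMapV (mapV (h := fun j e => .cons e.fst.fst (.cons (encUnary 3) (.cons e.fst.snd j)))
    (id.snd.fst.fst.cons ((const _).cons (id.snd.fst.snd.cons id.fst)))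
    (rangeV (const_nil.cons id.fst.snd))) hu.lineItemsV

theorem freeFormsV (hu : PolyTime u) : PolyTime fun x => freeFormsV (u x) :=
  flatMapV (h := fun y e => AltMatSpace.mapV (fun x => .cons (.cons y .nil) x)
      (AltMatSpace.freeLabelsV (u e)))
    (mapV (h := fun x e => .cons (.cons e.fst .nil) x)
      ((id.snd.fst.cons const_nil).cons id.fst) (hu.comp id.snd).freeLabelsV) hu.coreLabelsV

theorem markLabelsV (hu : PolyTime u) : PolyTime fun x => markLabelsV (u x) :=
  appV hu.freeLabelsV (mapV id.fst.snd hu.lineFormsV)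

theorem gadgetLabelsV (hu : PolyTime u) : PolyTime fun x => gadgetLabelsV (u x) :=
  appV hu.coreLabelsV hu.markLabelsV

theorem memLabelV (ha : PolyTime a) (hf : PolyTime f) : PolyTime fun x => memLabelV (a x) (f x) :=
  anyV (h := fun y e => AltMatSpace.eqLabelV y (a e)) (eqLabelV id.fst (ha.comp id.snd)) hf

theorem wedgeEntryV (hk : PolyTime k) (hf : PolyTime f) (ha : PolyTime a) (hb : PolyTime b) :
    PolyTime fun x => wedgeEntryV (k x) (f x) (a x) (b x) :=
  ite (andV (eqLabelV hb hf.snd) (memLabelV ha hf.fst)) hk.snd.fst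
    (ite (andV (eqLabelV ha hf.snd) (memLabelV hb hf.fst)) hk.snd.snd hk.fst)

theorem wedgeV (hk : PolyTime k) (hu : PolyTime u) (hf : PolyTime f) :
    PolyTime fun x => wedgeV (k x) (u x) (f x) :=
  mapV (h := fun a e => AltMatSpace.mapV (fun b => AltMatSpace.wedgeEntryV (k e) (f e) a b)
      (AltMatSpace.gadgetLabelsV (u e)))
    (mapV (h := fun b e => AltMatSpace.wedgeEntryV (k e.snd) (f e.snd) e.fst b)
      (wedgeEntryV (hk.comp id.snd.snd) (hf.comp id.snd.snd) id.snd.fst id.fst)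
      (hu.comp id.snd).gadgetLabelsV) hu.gadgetLabelsV

theorem constV (hf : PolyTime f) (hg : PolyTime g) : PolyTime fun x => constV (f x) (g x) :=
  mapV (h := fun _ e => f e) (hf.comp id.snd) hg

theorem padV (hk : PolyTime k) (hu : PolyTime u) (ha : PolyTime a) :
    PolyTime fun x => padV (k x) (u x) (a x) :=
  appV (mapV (h := fun r e => AltMatSpace.appV r (AltMatSpace.constV (k e).fst
      (AltMatSpace.appV (AltMatSpace.frameLabelsV (u e)) (AltMatSpace.markLabelsV (u e)))))
    (appV id.fst (constV (hk.comp id.snd).fst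
      (appV (hu.comp id.snd).frameLabelsV (hu.comp id.snd).markLabelsV))) ha)
    (constV (constV hk.fst hu.gadgetLabelsV) (appV hu.frameLabelsV hu.markLabelsV))

theorem padRowsV (hk : PolyTime k) (hu : PolyTime u) (hf : PolyTime f) :
    PolyTime fun x => padRowsV (k x) (u x) (f x) :=
  appV hf (dropV hf (constV ((constV hk.fst hu.rangeV).cons (constV hk.fst hu.rangeV))
    (rangeV (const_nil.cons hu))))

theorem frameV (hk : PolyTime k) (hu : PolyTime u) (hf : PolyTime f) :
    PolyTime fun x => frameV (k x) (u x) (f x) :=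
  appV (mapV (h := fun a e => AltMatSpace.appV (AltMatSpace.constV (k e).fst
        (AltMatSpace.rangeV (u e))) (AltMatSpace.appV (AltMatSpace.mapV
          (fun r => AltMatSpace.nthV r.snd a) (AltMatSpace.padRowsV (k e) (u e) (f e)))
        (AltMatSpace.constV (k e).fst (AltMatSpace.markLabelsV (u e)))))
      (appV (constV (hk.comp id.snd).fst (hu.comp id.snd).rangeV)
        (appV (mapV (h := fun r e => AltMatSpace.nthV r.snd e.fst) (nthV id.fst.snd id.snd.fst)
          (padRowsV (hk.comp id.snd) (hu.comp id.snd) (hf.comp id.snd)))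
        (constV (hk.comp id.snd).fst (hu.comp id.snd).markLabelsV))) hu.rangeV)
    (appV (mapV (h := fun r e => AltMatSpace.appV r.fst (AltMatSpace.constV (k e).fst
        (AltMatSpace.appV (AltMatSpace.frameLabelsV (u e)) (AltMatSpace.markLabelsV (u e)))))
      (appV id.fst.fst (constV (hk.comp id.snd).fst
        (appV (hu.comp id.snd).frameLabelsV (hu.comp id.snd).markLabelsV)))
      (padRowsV hk hu hf)) (constV (constV hk.fst hu.gadgetLabelsV) hu.markLabelsV))

theorem gadgetV (hk : PolyTime k) (hu : PolyTime u) (ha : PolyTime a) (hf : PolyTime f) :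
    PolyTime fun x => gadgetV (k x) (u x) (a x) (f x) :=
  appV (mapV (h := fun a e => AltMatSpace.padV (k e) (u e) a)
      (padV (hk.comp id.snd) (hu.comp id.snd) id.fst) ha)
    ((frameV hk hu hf).cons (mapV (h := fun f e => AltMatSpace.wedgeV (k e) (u e) f)
      (wedgeV (hk.comp id.snd) (hu.comp id.snd) id.fst)
      (appV hu.freeFormsV hu.lineFormsV)))

end PolyTime

/-! ### Correctness of the gadget program -/

section Lists
variable {S T : Type*}

theorem encList_append (enc : T → Val) (l m : List T) :
    encList enc (l ++ m) = appV (encList enc l) (encList enc m) := (appV_encList enc l m).symm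

theorem mapV_encList' (h : Val → Val) (enc : T → Val) (enc' : T → Val) (l : List T)
    (hh : ∀ a ∈ l, h (enc a) = enc' a) : mapV h (encList enc l) = encList enc' l := by
  rw [mapV_encList]
  exact encList_congr hh

theorem appV_encUnary (k n : ℕ) : appV (encUnary k) (encUnary n) = encUnary (k + n) := by
  rw [encUnary, encUnary, appV_encList, ← List.replicate_add]
  rfl

theorem rangeV_encUnary' (n : ℕ) :
    rangeV (encUnary n) = encList (fun i : Fin n => encUnary i) (List.finRange n) := by
  rw [rangeV_encUnary, ← List.map_coe_finRange_eq_range, encList_map]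

theorem constV_encList (z : Val) (enc : T → Val) (l : List T) :
    constV z (encList enc l) = encList (fun _ => z) l := mapV_encList _ _ _

/-- Two lists with different encodings are handled as one list over the disjoint union of their
entry types. -/
theorem mapV_appV (h : Val → Val) (enc : S → Val) (enc' : T → Val) (l : List S) (l' : List T) :
    mapV h (appV (encList enc l) (encList enc' l')) =
      appV (encList (fun a => h (enc a)) l) (encList (fun a => h (enc' a)) l') := by
  have := appV_encList (Sum.elim enc enc') (l.map Sum.inl) (l'.map Sum.inr)
  simp only [encList_map, Sum.elim_inl, Sum.elim_inr] at this
  rw [this, mapV_encList, encList_append, encList_map, encList_map]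
  rfl

theorem constV_appV (z : Val) (enc : S → Val) (enc' : T → Val) (l : List S) (l' : List T) :
    constV z (appV (encList enc l) (encList enc' l')) =
      appV (encList (fun _ => z) l) (encList (fun _ => z) l') := mapV_appV _ _ _ _ _

theorem andV_encBool (a b : Bool) : andV (encBool a) (encBool b) = encBool (a && b) := by
  cases a <;> simp [andV, encBool]

theorem iteV_encBool {α : Type*} (c : Bool) (a b : α) : iteV (encBool c) a b = if c then a else b := by
  cases c <;> simp [encBool]

end Lists

/-! ### Labels of the gadget indices and of its marking matrices -/

section Labels
variable {n : ℕ}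

/-- The labels of the indices of the gadget. -/
def encLabel : GadgetIdx n → Val
  | .inl (.inl v) => labelV (encUnary 0) (encUnary v)
  | .inl (.inr l) => labelV (encUnary 1) (encUnary l)
  | .inr (.inl j) => labelV (encUnary 2) (encUnary j)
  | .inr (.inr s) => .cons (encUnary 3) (.cons (encUnary s.1) (encUnary s.2))

theorem eqLabelV_encLabel (i j : GadgetIdx n) :
    eqLabelV (encLabel i) (encLabel j) = encBool (decide (i = j)) := by
  -- The unused last component of a short label is the unary number 0, so all comparisons are
  -- comparisons of unary numbers.
  have h0 : Val.nil = encUnary 0 := rfl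
  rcases i with (v | l) | r | s <;> rcases j with (v' | l') | r' | s' <;>
    simp only [eqLabelV, encLabel, labelV, Val.fst_cons, Val.snd_cons, h0, eqV_encUnary,
      andV_encBool] <;> refine congrArg encBool ?_
  case inr.inr.inr.inr =>
    obtain ⟨s1, s2⟩ := s
    obtain ⟨t1, t2⟩ := s'
    rw [Bool.eq_iff_iff]
    simp only [Bool.and_eq_true, decide_eq_true_eq, Sum.inr.injEq, Sigma.mk.injEq, true_and]
    constructor
    · rintro ⟨h1, h2⟩
      obtain rfl := Fin.ext h1
      exact ⟨rfl, heq_of_eq (Fin.ext h2)⟩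
    · rintro ⟨rfl, h2⟩
      exact ⟨rfl, congrArg Fin.val (eq_of_heq h2)⟩
  all_goals
    rw [Bool.eq_iff_iff]
    simp only [Bool.and_eq_true, decide_eq_true_eq, Sum.inl.injEq, Sum.inr.injEq, reduceCtorEq,
      Fin.ext_iff]
    simp

/-- The support of a marked functional. -/
def lineSupport (i : Fin (n + 2)) : List (CoreIdx n) :=
  Fin.lastCases (motive := fun _ => List (CoreIdx n)) ((List.finRange (n + 1)).map .inr)
    (fun l => [.inr l]) i

theorem baseLabelsV_eq (n : ℕ) : baseLabelsV (encUnary n) =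
    encList (fun v : Fin n => encLabel (.inl (.inl v) : GadgetIdx n)) (List.finRange n) := by
  rw [baseLabelsV, rangeV_encUnary', mapV_encList]
  rfl

theorem frameLabelsV_eq (n : ℕ) : frameLabelsV (encUnary n) =
    encList (fun l => encLabel (.inl (.inr l) : GadgetIdx n)) (List.finRange (n + 1)) := by
  rw [frameLabelsV, ← encUnary_succ, rangeV_encUnary', mapV_encList]
  rfl

theorem coreLabelsV_eq (n : ℕ) : coreLabelsV (encUnary n) =
    encList (fun y => encLabel (.inl y : GadgetIdx n)) (coreList n) := by
  rw [coreLabelsV, baseLabelsV_eq, frameLabelsV_eq, coreList, encList_append, encList_map,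
    encList_map]

theorem freeLabelsV_eq (n : ℕ) : freeLabelsV (encUnary n) =
    encList (fun j => encLabel (.inr (.inl j) : GadgetIdx n)) (List.finRange (2 * n + 2)) := by
  rw [freeLabelsV, appV_encUnary, ← encUnary_succ, ← encUnary_succ,
    show n + n + 1 + 1 = 2 * n + 2 by ring, rangeV_encUnary', mapV_encList]
  rfl

theorem lineItemsV_eq (n : ℕ) : lineItemsV (encUnary n) =
    encList (fun i => .cons (encList (fun y => encLabel (.inl y : GadgetIdx n)) (lineSupport i))
      (encUnary i)) (List.finRange (n + 2)) := by
  rw [lineItemsV, frameLabelsV_eq, ← encUnary_succ, rangeV_encUnary', mapV_encList,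
    List.finRange_succ_last (n := n + 1), encList_append, encList_map]
  congr 1
  · refine encList_congr fun l _ => ?_
    simp [lineSupport, encList, encLabel]
  · simp [encList, lineSupport, encList_map]

theorem lineFormsV_eq (n : ℕ) : lineFormsV (encUnary n) =
    encList (fun s => .cons (encList (fun y => encLabel (.inl y : GadgetIdx n)) (lineSupport s.1))
      (encLabel (.inr (.inr s) : GadgetIdx n))) (lineList n) := by
  rw [lineFormsV, lineItemsV_eq, lineList]
  refine flatMapV_encList _ _ _ _ _ fun i _ => ?_
  simp only [Val.fst_cons, Val.snd_cons]
  rw [← encUnary_succ, rangeV_encUnary', mapV_encList, encList_map]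
  rfl

theorem freeFormsV_eq (n : ℕ) : freeFormsV (encUnary n) =
    encList (fun q : CoreIdx n × FreeIdx n =>
      .cons (encList (fun y => encLabel (.inl y : GadgetIdx n)) [q.1])
      (encLabel (.inr (.inl q.2) : GadgetIdx n)))
      ((coreList n).flatMap fun y => (List.finRange (2 * n + 2)).map fun j => (y, j)) := by
  rw [freeFormsV, coreLabelsV_eq, freeLabelsV_eq]
  refine flatMapV_encList _ _ _ _ _ fun y _ => ?_
  rw [mapV_encList, encList_map]
  rfl

theorem markLabelsV_eq (n : ℕ) : markLabelsV (encUnary n) =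
    encList (fun x => encLabel (.inr x : GadgetIdx n)) (markList n) := by
  rw [markLabelsV, freeLabelsV_eq, lineFormsV_eq, mapV_encList, markList, encList_append,
    encList_map, encList_map]
  rfl

theorem gadgetLabelsV_eq (n : ℕ) :
    gadgetLabelsV (encUnary n) = encList encLabel (gadgetList n) := by
  rw [gadgetLabelsV, coreLabelsV_eq, markLabelsV_eq, gadgetList, encList_append, encList_map,
    encList_map]

theorem memLabelV_eq (i : GadgetIdx n) (l : List (CoreIdx n)) :
    memLabelV (encLabel i) (encList (fun y => encLabel (.inl y : GadgetIdx n)) l) =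
      encBool (decide (∃ y ∈ l, .inl y = i)) := by
  rw [memLabelV, anyV_encList _ _ (fun y => decide (.inl y = i))]
  · congr 1
    rw [Bool.eq_iff_iff]
    simp
  · intro y _
    rw [eqLabelV_encLabel]
    by_cases h : (Sum.inl y : GadgetIdx n) = i <;> simp [h, encBool]

theorem encList_gadgetList (e : GadgetIdx n → Val) : encList e (gadgetList n) =
    appV (encList (fun v => e (.inl (.inl v))) (List.finRange n))
      (appV (encList (fun l => e (.inl (.inr l))) (List.finRange (n + 1)))
        (encList (fun x => e (.inr x)) (markList n))) := by
  rw [gadgetList, coreList, List.map_append, List.append_assoc, encList_append, encList_append,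
    List.map_map, List.map_map, encList_map, encList_map, encList_map]
  rfl

end Labels

/-! ### Encodings of the basis matrices of the gadget -/

section Matrices
variable {p : ℕ} {F : Type*} [Field F] [Algebra (ZMod p) F] (pb : PowerBasis (ZMod p) F) {n m : ℕ}

/-- The field elements `0`, `1` and `-1`. -/
noncomputable def encConsts : Val := .cons (encElt pb 0) (.cons (encElt pb 1) (encElt pb (-1)))

/-- The encoding of a matrix over the gadget indices. -/
noncomputable def encGadgetMatrix (M : Matrix (GadgetIdx n) (GadgetIdx n) F) : Val :=
  encList (fun i => encList (fun j => encElt pb (M i j)) (gadgetList n)) (gadgetList n)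

/-- A row together with its negative. -/
noncomputable def encRow (v : Fin n → F) : Val :=
  .cons (encList (fun j => encElt pb (v j)) (List.finRange n))
    (encList (fun j => encElt pb (-(v j))) (List.finRange n))

/-- The matrix with given rows, extended by zero rows. -/
def rowMatrix (rows : List (Fin n → F)) : Matrix (Fin (n + 1)) (Fin n) F :=
  Matrix.of fun l => rows.getD l 0

theorem rowMatrix_apply (rows : List (Fin n → F)) (l : Fin (n + 1)) :
    rowMatrix rows l = rows.getD l 0 := rfl

theorem encMatrix_eq (X : Matrix (Fin n) (Fin n) F) : encMatrix pb X =
    encList (fun i => encList (fun j => encElt pb (X i j)) (List.finRange n)) (List.finRange n) := by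
  rw [encMatrix]
  simp only [List.ofFn_eq_map, encList_map]

/-- Both kinds of marking matrices are wedges of a core vector with entries 0 and 1 and one marking
unit vector. A list of core labels and one label therefore describe either kind. -/
theorem wedgeV_eq (l : List (CoreIdx n)) (x : FreeIdx n ⊕ LineIdx n)
    (M : Matrix (GadgetIdx n) (GadgetIdx n) F)
    (hM : ∀ i j, M i j = if j = .inr x ∧ ∃ y ∈ l, .inl y = i then 1 else
      if i = .inr x ∧ ∃ y ∈ l, .inl y = j then -1 else 0) :
    wedgeV (encConsts pb) (encUnary n)
      (.cons (encList (fun y => encLabel (.inl y : GadgetIdx n)) l) (encLabel (.inr x))) =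
      encGadgetMatrix pb M := by
  rw [wedgeV, gadgetLabelsV_eq]
  refine mapV_encList' _ _ _ _ fun i _ => mapV_encList' _ _ _ _ fun j _ => ?_
  simp only [wedgeEntryV, Val.fst_cons, Val.snd_cons, eqLabelV_encLabel, memLabelV_eq,
    andV_encBool, iteV_encBool, encConsts, hM, Bool.and_eq_true, decide_eq_true_eq]
  split_ifs <;> rfl

theorem wedgeV_free (S : Matrix (Fin (n + 1)) (Fin n) F) (y : CoreIdx n) (j : FreeIdx n) :
    wedgeV (encConsts pb) (encUnary n)
      (.cons (encList (fun y => encLabel (.inl y : GadgetIdx n)) [y]) (encLabel (.inr (.inl j)))) =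
      encGadgetMatrix pb (gadgetMap S (0, 0, Matrix.single y j 1, 0)) := by
  refine wedgeV_eq pb _ _ _ ?_
  rw [gadgetMap_apply, coreBlock_zero]
  rintro (y' | j' | s') (y'' | j'' | s'') <;>
    simp [sideBlock, Matrix.single_apply, and_comm, eq_comm]
  split_ifs <;> simp

theorem lineVec_eq (i : Fin (n + 2)) (y : CoreIdx n) :
    (lineVec i y : F) = if ∃ z ∈ lineSupport i, z = y then 1 else 0 := by
  induction i using Fin.lastCases with
  | last => rcases y with v | l <;> simp [lineVec, lineSupport]
  | cast k =>
    rcases y with v | l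
    · simp [lineVec, lineSupport]
    · simp [lineVec, lineSupport, Fin.castSucc_ne_last]

theorem wedgeV_line (S : Matrix (Fin (n + 1)) (Fin n) F) (s : LineIdx n) :
    wedgeV (encConsts pb) (encUnary n)
      (.cons (encList (fun y => encLabel (.inl y : GadgetIdx n)) (lineSupport s.1))
        (encLabel (.inr (.inr s)))) =
      encGadgetMatrix pb (gadgetMap S (0, 0, 0, Pi.single s 1)) := by
  refine wedgeV_eq pb _ _ _ ?_
  rw [gadgetMap_apply, coreBlock_zero]
  rintro (y' | j' | s') (y'' | j'' | s'') <;>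
    simp [sideBlock, Pi.single_apply, lineVec_eq]
  · by_cases h : s'' = s
    · subst h
      simp
      exact if_congr (by simp) rfl rfl
    · simp [h]
  · by_cases h : s' = s
    · subst h
      simp
      split_ifs <;> simp_all
    · simp [h]

theorem padV_eq (S : Matrix (Fin (n + 1)) (Fin n) F) (a : Matrix (Fin n) (Fin n) F) :
    padV (encConsts pb) (encUnary n) (encMatrix pb a) =
      encGadgetMatrix pb (gadgetMap S (a, 0, 0, 0)) := by
  have hz : (encConsts pb).fst = encElt pb 0 := rfl
  rw [padV, encMatrix_eq, mapV_encList, frameLabelsV_eq, markLabelsV_eq, gadgetLabelsV_eq, hz,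
    constV_encList, encGadgetMatrix, encList_gadgetList fun i => encList _ _]
  rw [constV_appV, constV_appV, gadgetMap_apply, sideBlock_zero]
  congr 1
  · refine encList_congr fun v _ => ?_
    rw [encList_gadgetList]
    simp [coreBlock]
  · congr 1
    · refine encList_congr fun l _ => encList_congr fun j _ => ?_
      rcases j with (v | l) | x <;> simp [coreBlock]
    · refine encList_congr fun l _ => encList_congr fun j _ => ?_
      rcases j with (v | l) | x <;> simp

/-- Deleting from `n + 1` zero rows as many as there are given rows leaves exactly the rows that are
missing. -/
theorem padRowsV_eq {rows : List (Fin n → F)} (hr : rows.length ≤ n + 1) :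
    padRowsV (encConsts pb) (encUnary n) (encList (encRow pb) rows) =
      encList (fun l => encRow pb (rowMatrix rows l)) (List.finRange (n + 1)) := by
  have hz : (encConsts pb).fst = encElt pb 0 := rfl
  have h0 : Val.cons (constV (encElt pb 0) (rangeV (encUnary n)))
      (constV (encElt pb 0) (rangeV (encUnary n))) = encRow pb (0 : Fin n → F) := by
    rw [rangeV_encUnary', constV_encList, encRow]
    simp
  rw [padRowsV, hz, h0, ← encUnary_succ, rangeV_encUnary', constV_encList,
    ← encList_map (encRow pb) (fun _ => 0), dropV_encList, appV_encList,
    ← encList_map (encRow pb) (fun l => rowMatrix rows l)]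
  congr 1
  refine List.ext_getElem (by simp; omega) fun i h1 h2 => ?_
  by_cases hi : i < rows.length
  · simp [rowMatrix_apply, List.getElem_append_left hi, hi]
  · simp [rowMatrix_apply, List.getElem_append_right (not_lt.mp hi), hi]

theorem frameV_eq (rows : List (Fin n → F)) (hr : rows.length ≤ n + 1) :
    frameV (encConsts pb) (encUnary n) (encList (encRow pb) rows) =
      encGadgetMatrix pb (gadgetMap (rowMatrix rows) (0, 1, 0, 0)) := by
  have hz : (encConsts pb).fst = encElt pb 0 := rfl
  rw [frameV, padRowsV_eq pb hr, frameLabelsV_eq, markLabelsV_eq, gadgetLabelsV_eq, hz,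
    rangeV_encUnary', constV_appV, constV_encList, constV_encList, constV_encList, constV_encList,
    mapV_encList, mapV_encList, encGadgetMatrix, encList_gadgetList fun i => encList _ _, gadgetMap_apply,
    sideBlock_zero]
  congr 1
  · refine encList_congr fun v _ => ?_
    rw [encList_gadgetList, mapV_encList]
    refine congrArg₂ appV ?_ (congrArg₂ appV (encList_congr fun l _ => ?_) ?_)
    · simp [coreBlock]
    · simp only [encRow, Val.snd_cons]
      rw [nthV_encUnary _ _ (by simp)]
      simp [coreBlock]
    · simp
  · congr 1
    · refine encList_congr fun l _ => ?_
      rw [encList_gadgetList]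
      simp [coreBlock, encRow]
    · refine encList_congr fun l _ => encList_congr fun j _ => ?_
      rcases j with (v | l) | x <;> simp

theorem gadgetV_eq (A : Fin m → Matrix (Fin n) (Fin n) F) (rows : List (Fin n → F))
    (hr : rows.length ≤ n + 1) :
    gadgetV (encConsts pb) (encUnary n) (encTuple pb A) (encList (encRow pb) rows) =
      encTuple pb (gadgetTuple A (rowMatrix rows)) := by
  rw [encTuple_gadgetTuple]
  change _ = encList (fun k => encGadgetMatrix pb (gadgetMap (rowMatrix rows) (formParam A k))) _
  rw [gadgetV, formList, encList_append, encList_map]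
  congr 1
  · rw [encTuple, List.ofFn_eq_map, encList_map, mapV_encList]
    exact encList_congr fun k _ => padV_eq pb _ _
  · rw [List.cons_append, encList, frameV_eq pb rows hr]
    congr 1
    have hflat : ((coreList n).flatMap fun y => (List.finRange (2 * n + 2)).map fun j =>
        (.inr (.inr (.inl (y, j))) : FormIdx n m)) =
        ((coreList n).flatMap fun y => (List.finRange (2 * n + 2)).map fun j => (y, j)).map
          fun q => .inr (.inr (.inl q)) := by
      simp [List.map_flatMap, Function.comp_def]
    rw [freeFormsV_eq, lineFormsV_eq, mapV_appV, hflat, encList_append, encList_map, encList_map]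
    congr 1
    · exact encList_congr fun q _ => wedgeV_free pb _ q.1 q.2
    · exact encList_congr fun s _ => wedgeV_line pb _ s

end Matrices

/-! ### Binary arithmetic -/

/-- One step of binary increment; the state holds the carry and the digits written so far. -/
def incStepV (a s : Val) : Val :=
  iteV s.fst (iteV a (.cons (encBool true) (.cons .nil s.snd))
    (.cons .nil (.cons (encBool true) s.snd))) (.cons .nil (.cons a s.snd))

/-- Completion of a binary increment. -/
def incFinV (s : Val) : Val := revV (iteV s.fst (.cons (encBool true) s.snd) s.snd)

/-- Binary increment. -/
def incV (b : Val) : Val := incFinV (foldV incStepV (.cons (encBool true) .nil) b)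

/-- Conversion from binary to unary. -/
def unaryV (b : Val) : Val :=
  foldV (fun a s => iteV a (.cons .nil (appV s s)) (appV s s)) .nil (revV b)

/-- Conversion from unary to binary. -/
def binaryV (u : Val) : Val := foldV (fun _ s => incV s) .nil u

/-- The binary numbers below a unary number. -/
def binariesV (u : Val) : Val := mapV (fun j => binaryV j) (rangeV u)

/-- The residues, each paired with its negative. -/
def residuesV (u : Val) : Val :=
  zipV (binariesV u) (.cons (binariesV u).fst (revV (binariesV u).snd))

/-- Prefixes a pair of lists with a pair of entries. -/
def pairConsV (r t : Val) : Val := .cons (.cons r.fst t.fst) (.cons r.snd t.snd)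

/-- All prefixings of a list of pairs of lists. -/
def prodV (b L : Val) : Val := flatMapV (fun r => mapV (fun t => pairConsV r t) L) b

/-- All pairs of lists of a given length over a list of pairs. -/
def powV (b l : Val) : Val := foldV (fun _ L => prodV b L) (.cons (.cons .nil .nil) .nil) l

section Binary

/-- Increment on lists of binary digits. -/
def incBits : List Bool → List Bool
  | [] => [true]
  | false :: l => true :: l
  | true :: l => false :: incBits l

theorem bits_two_mul {j : ℕ} (hj : j ≠ 0) : (2 * j).bits = false :: j.bits := Nat.bit0_bits j hj

theorem bits_two_mul_add_one (j : ℕ) : (2 * j + 1).bits = true :: j.bits := Nat.bit1_bits j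

theorem bits_succ (k : ℕ) : (k + 1).bits = incBits k.bits := by
  induction k using Nat.strong_induction_on with
  | _ k ih =>
    obtain ⟨j, rfl | rfl⟩ := Nat.even_or_odd' k
    · rcases Nat.eq_zero_or_pos j with rfl | hj
      · simp [incBits]
      · rw [bits_two_mul_add_one, bits_two_mul hj.ne', incBits]
    · rw [show 2 * j + 1 + 1 = 2 * (j + 1) by ring, bits_two_mul (by omega), bits_two_mul_add_one,
        incBits, ih j (by omega)]

theorem incV_encList (l : List Bool) : incV (encList encBool l) = encList encBool (incBits l) := by
  have h0 : ∀ l acc : List Bool, incFinV (foldV incStepV (.cons .nil (encList encBool acc))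
      (encList encBool l)) = encList encBool (acc.reverse ++ l) := by
    intro l
    induction l with
    | nil => intro acc; simp [encList, foldV, incFinV]
    | cons a l ih =>
      intro acc
      have := ih (a :: acc)
      simp only [encList] at this
      simp [encList, foldV, incStepV, this]
  have h1 : ∀ l acc : List Bool, incFinV (foldV incStepV (.cons (encBool true)
      (encList encBool acc)) (encList encBool l)) = encList encBool (acc.reverse ++ incBits l) := by
    intro l
    induction l with
    | nil =>
      intro acc
      have := revV_encList encBool (true :: acc)
      simp only [encList] at this
      simp [encList, foldV, incFinV, iteV_encBool, this, incBits]
    | cons a l ih =>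
      intro acc
      cases a with
      | false =>
        have := h0 l (true :: acc)
        simp only [encList] at this
        simp [encList, foldV, incStepV, iteV_encBool, this, incBits]
      | true =>
        have := ih (false :: acc)
        simp only [encList] at this
        have hf : encBool false = .nil := rfl
        rw [hf] at this
        simp [encList, foldV, incStepV, iteV_encBool, this, incBits]
  exact h1 l []

theorem incV_encNat (k : ℕ) : incV (encNat k) = encNat (k + 1) := by
  rw [encNat, incV_encList, ← bits_succ, encNat]

theorem binaryV_encUnary (k : ℕ) : binaryV (encUnary k) = encNat k := by
  suffices H : ∀ j, foldV (fun _ s => incV s) (encNat j) (encUnary k) = encNat (j + k) by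
    have := H 0
    rwa [zero_add, show encNat 0 = .nil by simp [encNat, encList]] at this
  induction k with
  | zero => intro j; rfl
  | succ k ih =>
    intro j
    rw [encUnary_succ, foldV, incV_encNat, ih]
    congr 1
    ring

theorem unaryV_encNat (k : ℕ) : unaryV (encNat k) = encUnary k := by
  rw [unaryV, encNat, revV_encList, foldV_encList, List.foldl_reverse]
  induction k using Nat.strong_induction_on with
  | _ k ih =>
    obtain ⟨j, rfl | rfl⟩ := Nat.even_or_odd' k
    · rcases Nat.eq_zero_or_pos j with rfl | hj
      · simp [encUnary, encList]
      · rw [bits_two_mul hj.ne', List.foldr_cons, ih j (by omega), appV_encUnary, iteV_encBool,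
          two_mul]
        rfl
    · rw [bits_two_mul_add_one, List.foldr_cons, ih j (by omega), appV_encUnary, iteV_encBool,
        if_pos rfl, ← encUnary_succ, two_mul]

theorem binariesV_encUnary (n : ℕ) :
    binariesV (encUnary n) = encList encNat (List.range n) := by
  rw [binariesV, rangeV_encUnary, mapV_encList]
  exact encList_congr fun k _ => binaryV_encUnary k

/-- The residues modulo `p` in order. -/
def residues (p : ℕ) : List (ZMod p) := (List.range p).map fun i : ℕ => ((i : ℕ) : ZMod p)

theorem mem_residues {p : ℕ} [NeZero p] (a : ZMod p) : a ∈ residues p := by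
  simp only [residues, List.mem_map, List.mem_range]
  exact ⟨a.val, a.val_lt, ZMod.natCast_zmod_val a⟩

/-- The negatives of `0, 1, …, p - 1` are `0, p - 1, …, 1`: reversing the tail of the list replaces
modular arithmetic. -/
theorem residuesV_encUnary {p : ℕ} [NeZero p] : residuesV (encUnary p) =
    encList (fun a : ZMod p => .cons (encZMod a) (encZMod (-a))) (residues p) := by
  obtain ⟨k, hk⟩ : ∃ k, p = k + 1 := ⟨p - 1, by have := NeZero.ne p; omega⟩
  have h1 : (.cons (binariesV (encUnary p)).fst (revV (binariesV (encUnary p)).snd)) =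
      encList encNat (0 :: ((List.range k).map fun i => i + 1).reverse) := by
    rw [binariesV_encUnary, hk, List.range_succ_eq_map]
    simp only [encList, Val.fst_cons, Val.snd_cons, revV_encList]
  rw [residuesV, h1, binariesV_encUnary, zipV_encList _ _ _ _ (by simp [hk]), residues, encList_map]
  have h2 : (List.range p).zip (0 :: ((List.range k).map fun i => i + 1).reverse) =
      (List.range p).map fun i : ℕ => (i, (-((i : ℕ) : ZMod p)).val) := by
    refine List.ext_getElem (by simp [hk]) fun i hi hi' => ?_
    have hip : i < p := by simpa using hi'
    simp only [List.getElem_zip, List.getElem_range, List.getElem_map]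
    congr 1
    rcases i with _ | i
    · simp
    · have hcast : ((i + 1 : ℕ) : ZMod p) ≠ 0 := by
        rw [Ne, ZMod.natCast_eq_zero_iff]
        intro hd
        exact absurd (Nat.le_of_dvd (by omega) hd) (by omega)
      have : NeZero ((i + 1 : ℕ) : ZMod p) := ⟨hcast⟩
      rw [ZMod.val_neg_of_ne_zero, ZMod.val_cast_of_lt hip]
      simp
      omega
  rw [h2, encList_map]
  refine encList_congr fun i hi => ?_
  simp only [encZMod]
  rw [ZMod.val_cast_of_lt (by simpa using hi)]

end Binary

/-! ### Enumeration of all words of a given length -/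

section Power
variable {R : Type*}

/-- All lists of length `k` over a list. -/
def allLists (b : List R) : ℕ → List (List R)
  | 0 => [[]]
  | k + 1 => b.flatMap fun r => (allLists b k).map fun t => r :: t

theorem mem_allLists {b : List R} (hb : ∀ r, r ∈ b) (l : List R) : l ∈ allLists b l.length := by
  induction l with
  | nil => simp [allLists]
  | cons r l ih => simp [allLists, ih, hb]

theorem length_of_mem_allLists {b : List R} {k : ℕ} {l : List R} (h : l ∈ allLists b k) :
    l.length = k := by
  induction k generalizing l with
  | zero => simp [allLists] at h; simp [h]
  | succ k ih =>
    simp only [allLists, List.mem_flatMap, List.mem_map] at h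
    obtain ⟨r, -, t, ht, rfl⟩ := h
    simp [ih ht]

theorem length_allLists (b : List R) (k : ℕ) : (allLists b k).length = b.length ^ k := by
  induction k with
  | zero => rfl
  | succ k ih =>
    simp [allLists, List.length_flatMap, ih, pow_succ, mul_comm]

/-- Encoding of a list together with the list of negatives. -/
def encPair (e e' : R → Val) (l : List R) : Val := .cons (encList e l) (encList e' l)

theorem prodV_encList (e e' : R → Val) (b : List R) (L : List (List R)) :
    prodV (encList (fun r => .cons (e r) (e' r)) b) (encList (encPair e e') L) =
      encList (encPair e e') (b.flatMap fun r => L.map fun t => r :: t) := by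
  refine flatMapV_encList _ _ _ _ _ fun r _ => ?_
  rw [mapV_encList, encList_map]
  rfl

theorem powV_encList {T : Type*} (e e' : R → Val) (b : List R) (enc : T → Val) (l : List T) :
    powV (encList (fun r => .cons (e r) (e' r)) b) (encList enc l) =
      encList (encPair e e') (allLists b l.length) := by
  suffices H : ∀ k, foldV (fun _ L => prodV (encList (fun r => .cons (e r) (e' r)) b) L)
      (encList (encPair e e') (allLists b k)) (encList enc l) =
        encList (encPair e e') (allLists b (k + l.length)) by
    have := H 0
    rwa [zero_add] at this
  induction l with
  | nil => intro k; rfl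
  | cons a l ih =>
    intro k
    rw [encList, foldV, prodV_encList]
    have := ih (k + 1)
    rw [show k + (a :: l).length = k + 1 + l.length by simp; ring]
    exact this

theorem size_encList_le {e : R → Val} {K : ℕ} {l : List R} (h : ∀ a ∈ l, (e a).size ≤ K) :
    (encList e l).size ≤ l.length * (K + 1) + 1 := by
  induction l with
  | nil => simp [encList]
  | cons a l ih =>
    have h1 := h a (by simp)
    have h2 := ih fun b hb => h b (by simp [hb])
    simp only [encList, Val.size_cons, List.length_cons]
    nlinarith

/-- The total size of the states of a power computation. -/
theorem foldTrace_powV {T : Type*} (e e' : R → Val) {b : List R} (hb : b ≠ []) {K : ℕ}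
    (he : ∀ r, (e r).size ≤ K) (he' : ∀ r, (e' r).size ≤ K) (enc : T → Val) (l : List T) :
    foldTrace (fun _ L => prodV (encList (fun r => .cons (e r) (e' r)) b) L)
      (.cons (.cons .nil .nil) .nil) (encList enc l) ≤
      (l.length + 1) * (b.length ^ l.length * (2 * (l.length * (K + 1)) + 4) + 1) := by
  -- The state after `k` steps consists of `b.length ^ k` words, each stored with its negative.
  -- Since `b` is nonempty, the bound for the last step covers all of them.
  have hstate : ∀ k ≤ l.length, (encList (encPair e e') (allLists b k)).size ≤
      b.length ^ l.length * (2 * (l.length * (K + 1)) + 4) + 1 := by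
    intro k hk
    have h1 : ∀ t ∈ allLists b k, (encPair e e' t).size ≤ 2 * (l.length * (K + 1)) + 3 := by
      intro t ht
      have hlen := length_of_mem_allLists ht
      have s1 := size_encList_le (e := e) (l := t) fun r _ => he r
      have s2 := size_encList_le (e := e') (l := t) fun r _ => he' r
      have s3 : t.length * (K + 1) ≤ l.length * (K + 1) := Nat.mul_le_mul_right _ (by omega)
      simp only [encPair, Val.size_cons]
      omega
    have h2 := size_encList_le h1
    rw [length_allLists] at h2
    have hb1 : 1 ≤ b.length := List.length_pos_iff.mpr hb
    have h3 : b.length ^ k ≤ b.length ^ l.length := Nat.pow_le_pow_right hb1 hk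
    have h4 := Nat.mul_le_mul_right (2 * (l.length * (K + 1)) + 4) h3
    rw [show 2 * (l.length * (K + 1)) + 3 + 1 = 2 * (l.length * (K + 1)) + 4 from rfl] at h2
    omega
  suffices H : ∀ (l' : List T) (k : ℕ), k + l'.length ≤ l.length →
      foldTrace (fun _ L => prodV (encList (fun r => .cons (e r) (e' r)) b) L)
        (encList (encPair e e') (allLists b k)) (encList enc l') ≤ (l'.length + 1) *
        (b.length ^ l.length * (2 * (l.length * (K + 1)) + 4) + 1) from H l 0 (by simp)
  intro l'
  induction l' with
  | nil =>
    intro k hk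
    simpa [encList, foldTrace] using hstate k (by simpa using hk)
  | cons a l' ih =>
    intro k hk
    simp only [List.length_cons] at hk
    have h1 := ih (k + 1) (by omega)
    have h2 := hstate k (by omega)
    rw [encList, foldTrace, prodV_encList]
    have h3 : foldTrace (fun _ L => prodV (encList (fun r => .cons (e r) (e' r)) b) L)
        (encList (encPair e e') (b.flatMap fun r => (allLists b k).map fun t => r :: t))
        (encList enc l') ≤ _ := h1
    rw [List.length_cons, add_mul (l'.length + 1), one_mul]
    omega

end Power

/-! ### Costs -/

theorem size_appV (l m : Val) : (appV l m).size + 1 = l.size + m.size := by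
  obtain ⟨l, rfl⟩ := exists_encList l
  obtain ⟨m, rfl⟩ := exists_encList m
  rw [appV_encList, size_encList, size_encList, size_encList, List.map_append, List.sum_append]
  omega

/-- If states never shrink, the final one is the largest. This handles the conversion to unary,
where the state doubles and the bound for additive growth does not apply. -/
theorem foldTrace_le_of_mono {h : Val → Val → Val} (hm : ∀ a s, s.size ≤ (h a s).size)
    (s l : Val) : foldTrace h s l ≤ (l.len + 1) * (foldV h s l).size ∧
      s.size ≤ (foldV h s l).size := by
  induction l generalizing s with
  | nil => simp [foldTrace, foldV, Val.len]
  | cons a b _ ih =>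
    obtain ⟨h1, h2⟩ := ih (h a s)
    have h3 := hm a s
    simp only [foldTrace, foldV, Val.len]
    refine ⟨?_, h3.trans h2⟩
    rw [add_mul (b.len + 1), one_mul]
    omega

/-- Growth by a constant keeps repeated increment polynomial. The bound must hold for arbitrary
trees, since polynomial time is asserted on all inputs. -/
theorem size_incV_le (b : Val) : (incV b).size ≤ b.size + 4 := by
  have h1 : ∀ b c acc : Val, ∃ c' acc', foldV incStepV (.cons c acc) b = .cons c' acc' ∧
      c'.size + acc'.size + 1 ≤ c.size + acc.size + b.size := by
    intro b
    induction b with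
    | nil => intro c acc; exact ⟨c, acc, rfl, by simp⟩
    | cons a b _ ih =>
      intro c acc
      rw [foldV]
      rcases c with _ | ⟨c, d⟩
      · obtain ⟨c', acc', e, h⟩ := ih .nil (.cons a acc)
        refine ⟨c', acc', by simpa [incStepV] using e, ?_⟩
        simp at h ⊢
        omega
      · have hc := c.size_pos
        have hd := d.size_pos
        rcases a with _ | ⟨a, a'⟩
        · obtain ⟨c', acc', e, h⟩ := ih .nil (.cons (encBool true) acc)
          refine ⟨c', acc', by simpa [incStepV] using e, ?_⟩
          simp [encBool] at h ⊢
          omega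
        · obtain ⟨c', acc', e, h⟩ := ih (encBool true) (.cons .nil acc)
          refine ⟨c', acc', by simpa [incStepV] using e, ?_⟩
          simp [encBool] at h ⊢
          omega
  obtain ⟨c, acc, e, h⟩ := h1 b (encBool true) .nil
  rw [incV, e, incFinV, size_revV]
  rcases c with _ | ⟨c, d⟩
  · simp [encBool] at h ⊢
    omega
  · have hc := c.size_pos
    have hd := d.size_pos
    simp [encBool] at h ⊢
    omega

namespace PolyTime
variable {f g u b l : Val → Val}

theorem incV (hf : PolyTime f) : PolyTime fun x => incV (f x) := by
  have hfold : PolyTime fun x => foldV (fun a s => incStepV a s) (.cons (encBool true) .nil) (f x) := by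
    refine fold_of_le (H := fun a s _ => incStepV a s) (G := fun a _ => a) 10 ?_ id.fst
      (fun a s x => ?_) hf (const _)
    · exact ite id.snd.fst.fst (ite id.fst ((const _).cons (const_nil.cons id.snd.fst.snd))
        (const_nil.cons ((const _).cons id.snd.fst.snd)))
        (const_nil.cons (id.fst.cons id.snd.fst.snd))
    · have h1 := s.size_snd_le
      rw [incStepV]
      cases s.fst <;> cases a <;> simp [encBool] <;> omega
  have hfin : PolyTime fun x => incFinV x :=
    revV (ite id.fst ((const _).cons id.snd) id.snd)
  exact hfin.comp hfold

theorem binaryV (hf : PolyTime f) : PolyTime fun x => binaryV (f x) :=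
  fold_of_le (H := fun _ s _ => AltMatSpace.incV s) (G := fun a _ => a) 4 (incV id.snd.fst) id.fst
    (fun a s x => by have := size_incV_le s; omega) hf const_nil

theorem binariesV (hf : PolyTime f) : PolyTime fun x => binariesV (f x) :=
  mapV (binaryV id.fst) (rangeV hf)

theorem residuesV (hf : PolyTime f) : PolyTime fun x => residuesV (f x) :=
  zipV (binariesV hf) ((binariesV hf).fst.cons (revV (binariesV hf).snd))

theorem prodV (hf : PolyTime f) (hg : PolyTime g) : PolyTime fun x => prodV (f x) (g x) :=
  flatMapV (h := fun r e => AltMatSpace.mapV (fun t => pairConsV r t) (g e))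
    (mapV (h := fun t e => pairConsV e.fst t)
      ((id.snd.fst.fst.cons id.fst.fst).cons (id.snd.fst.snd.cons id.fst.snd))
      (hg.comp id.snd)) hf

end PolyTime

/-- The cost parameter of the conversion to unary. -/
def unaryCost (b : Val) : ℕ :=
  foldTrace (fun a s => iteV a (.cons .nil (appV s s)) (appV s s)) .nil (revV b)

/-- The cost parameter of the enumeration of lists. -/
def powCost (b l : Val) : ℕ :=
  foldTrace (fun _ L => prodV b L) (.cons (.cons .nil .nil) .nil) l

/-- A unary numeral can be exponentially longer than the binary one, so the trace of the fold is
retained as a cost parameter. It is estimated later, for actual inputs only. -/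
theorem realizes_unaryV {f : Val → Val} (hf : PolyTime f) :
    Realizes (fun x => unaryCost (f x)) fun _ x => (unaryV (f x), []) := by
  have hH : PolyTime fun y => iteV y.fst (.cons .nil (appV y.snd.fst y.snd.fst))
      (appV y.snd.fst y.snd.fst) :=
    PolyTime.ite PolyTime.id.fst (PolyTime.const_nil.cons (PolyTime.appV PolyTime.id.snd.fst
      PolyTime.id.snd.fst)) (PolyTime.appV PolyTime.id.snd.fst PolyTime.id.snd.fst)
  have h1 := Realizes.fold (T := fun x => foldTrace (fun a s => iteV a (.cons .nil (appV s s))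
    (appV s s)) x.snd.fst x.fst) hH fun _ x => by simp
  have h2 : PolyTime fun x => .cons (revV (f x)) (.cons .nil .nil) :=
    (PolyTime.revV hf).cons (PolyTime.const _)
  refine Realizes.congr (Realizes.comp (T := fun x => unaryCost (f x)) h1
    (Realizes.of_zero h2) fun O x => le_rfl) fun O x => ?_
  simp [foldQ_pure, unaryV]

theorem realizes_powV {f g : Val → Val} (hf : PolyTime f) (hg : PolyTime g) :
    Realizes (fun x => powCost (f x) (g x)) fun _ x => (powV (f x) (g x), []) := by
  have hH : PolyTime fun y => prodV y.snd.snd y.snd.fst :=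
    PolyTime.prodV PolyTime.id.snd.snd PolyTime.id.snd.fst
  have h1 := Realizes.fold (T := fun x => foldTrace (fun _ s => prodV x.snd.snd s) x.snd.fst x.fst)
    hH fun _ x => by simp
  have h2 : PolyTime fun x => .cons (g x) (.cons (.cons (.cons .nil .nil) .nil) (f x)) :=
    hg.cons ((PolyTime.const _).cons hf)
  refine Realizes.congr (Realizes.comp (T := fun x => powCost (f x) (g x)) h1
    (Realizes.of_zero h2) fun O x => le_rfl) fun O x => ?_
  simp [foldQ_pure, powV]

theorem size_encUnary (k : ℕ) : (encUnary k).size = 2 * k + 1 := by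
  induction k with
  | zero => rfl
  | succ k ih => rw [encUnary_succ, Val.size_cons, ih, Val.size_nil]; ring

theorem length_bits_le (k : ℕ) : k.bits.length ≤ k := by
  rw [Nat.size_eq_bits_len]
  exact Nat.size_le.mpr Nat.lt_two_pow_self

theorem size_encNat_le (k : ℕ) : (encNat k).size ≤ 4 * k + 1 := by
  have h1 := size_encList_le (e := encBool) (K := 3) (l := k.bits) fun b _ => by
    cases b <;> simp [encBool]
  have h2 := length_bits_le k
  rw [encNat]
  omega

theorem unaryCost_encNat (k : ℕ) : unaryCost (encNat k) ≤ (4 * k + 2) * (2 * k + 1) := by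
  have h1 := (foldTrace_le_of_mono (h := fun a s => iteV a (.cons .nil (appV s s)) (appV s s))
    (fun a s => by
      have := size_appV s s
      have := s.size_pos
      cases a <;> simp <;> omega) .nil (revV (encNat k))).1
  have h2 : foldV (fun a s => iteV a (.cons .nil (appV s s)) (appV s s)) .nil (revV (encNat k)) =
      encUnary k := unaryV_encNat k
  rw [h2, size_encUnary] at h1
  have h3 := (revV (encNat k)).len_le_size
  rw [size_revV] at h3
  have h4 := size_encNat_le k
  exact h1.trans (Nat.mul_le_mul_right _ (by omega))

/-! ### The search program

The environment of the search is the tuple consisting of the constants `0, 1, -1`, the dimension,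
the two tuples of matrices and the list of all rows. -/

/-- The query testing whether the first rows can be sent to the second ones. -/
def queryV (e ra rb : Val) : Val :=
  .cons (constV .nil (gadgetLabelsV e.snd.fst))
    (.cons (gadgetV e.fst e.snd.fst e.snd.snd.fst ra)
      (gadgetV e.fst e.snd.fst e.snd.snd.snd.fst rb))

/-- Whether a row is nonzero. -/
def nonzeroV (v : Val) : Val := anyV (fun a => anyV (fun c => c) a) v.fst

/-- Tests the candidate `v` for the next row unless one has been found. -/
def tryV (O : Val → Bool) (e ra rb v s : Val) : Val × List Val :=
  iteV s (s, []) (iteV (nonzeroV v)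
    (iteV (encBool (O (queryV e ra (appV rb (.cons v .nil)))))
      (v, [queryV e ra (appV rb (.cons v .nil))])
      (.nil, [queryV e ra (appV rb (.cons v .nil))])) (.nil, []))

/-- The image of a new row, given the rows `s.fst` with images `s.snd` and the new row `a`. -/
def extendV (O : Val → Bool) (e a s : Val) : Val × List Val :=
  (.cons (appV s.fst (.cons a .nil)) (appV s.snd (.cons
    (foldV (fun v f => (tryV O e (appV s.fst (.cons a .nil)) s.snd v f).1) .nil
      e.snd.snd.snd.snd) .nil)),
    foldQ (fun v f => tryV O e (appV s.fst (.cons a .nil)) s.snd v f) .nil e.snd.snd.snd.snd)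

/-- The standard rows. -/
def stdRowsV (e : Val) : Val :=
  mapV (fun i => .cons
    (mapV (fun j => iteV (eqV i j) e.fst.snd.fst e.fst.fst) (rangeV e.snd.fst))
    (mapV (fun j => iteV (eqV i j) e.fst.snd.snd e.fst.fst) (rangeV e.snd.fst)))
    (rangeV e.snd.fst)

/-- The search for an isometry, one row at a time. -/
def searchV (O : Val → Bool) (e : Val) : Val × List Val :=
  (.cons .nil (mapV Val.fst
    (foldV (fun a s => (extendV O e a s).1) (.cons .nil .nil) (stdRowsV e)).snd),
    foldQ (fun a s => extendV O e a s) (.cons .nil .nil) (stdRowsV e))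

theorem size_foldV_le {h : Val → Val → Val} (hh : ∀ a s, (h a s).size ≤ s.size + a.size)
    (s l : Val) : (foldV h s l).size ≤ s.size + l.size := by
  induction l generalizing s with
  | nil => simp [foldV]
  | cons a b _ ih =>
    have h1 := ih (h a s)
    have h2 := hh a s
    simp only [foldV, Val.size_cons]
    omega

theorem size_tryV_le (O : Val → Bool) (e ra rb v s : Val) :
    (tryV O e ra rb v s).1.size ≤ s.size + v.size := by
  have := v.size_pos
  have := s.size_pos
  rw [tryV]
  cases s
  · cases nonzeroV v
    · simp
    · cases O (queryV e ra (appV rb (.cons v .nil))) <;> simp [encBool]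
  · simp

/-! ### Polynomial cost of the search -/

section Realize
variable {T : Val → ℕ}

theorem PolyTime.queryV {e f g : Val → Val} (he : PolyTime e) (hf : PolyTime f) (hg : PolyTime g) :
    PolyTime fun x => queryV (e x) (f x) (g x) :=
  (PolyTime.constV const_nil (gadgetLabelsV he.snd.fst)).cons
    ((gadgetV he.fst he.snd.fst he.snd.snd.fst hf).cons
      (gadgetV he.fst he.snd.fst he.snd.snd.snd.fst hg))

theorem PolyTime.nonzeroV {f : Val → Val} (hf : PolyTime f) : PolyTime fun x => nonzeroV (f x) :=
  anyV (h := fun a _ => AltMatSpace.anyV (fun c => c) a) (anyV (h := fun c _ => c) id.fst id.fst)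
    hf.fst

theorem PolyTime.stdRowsV {e : Val → Val} (he : PolyTime e) : PolyTime fun x => stdRowsV (e x) := by
  refine comp (g := AltMatSpace.stdRowsV) ?_ he
  have h1 : ∀ {f : Val → Val}, PolyTime f → PolyTime fun y : Val => AltMatSpace.mapV
      (fun j => iteV (AltMatSpace.eqV y.fst j) (f y) y.snd.fst.fst)
      (AltMatSpace.rangeV y.snd.snd.fst) := fun {f} hf =>
    mapV (h := fun j y => iteV (AltMatSpace.eqV y.fst j) (f y) y.snd.fst.fst)
      (ite (eqV id.snd.fst id.fst) (hf.comp id.snd) id.snd.snd.fst.fst) (rangeV id.snd.snd.fst)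
  exact mapV (h := fun i x => .cons
    (AltMatSpace.mapV (fun j => iteV (AltMatSpace.eqV i j) x.fst.snd.fst x.fst.fst)
      (AltMatSpace.rangeV x.snd.fst))
    (AltMatSpace.mapV (fun j => iteV (AltMatSpace.eqV i j) x.fst.snd.snd x.fst.fst)
      (AltMatSpace.rangeV x.snd.fst)))
    ((h1 id.snd.fst.snd.fst).cons (h1 id.snd.fst.snd.snd)) (rangeV id.snd.fst)

theorem realizes_tryV : Realizes (fun _ => 0) fun O z =>
    tryV O z.snd.snd.snd z.snd.snd.fst.fst z.snd.snd.fst.snd z.fst z.snd.fst := by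
  have hq : PolyTime fun z => queryV z.snd.snd.snd z.snd.snd.fst.fst
      (appV z.snd.snd.fst.snd (.cons z.fst .nil)) :=
    PolyTime.queryV PolyTime.id.snd.snd.snd PolyTime.id.snd.snd.fst.fst
      (PolyTime.appV PolyTime.id.snd.snd.fst.snd (PolyTime.id.fst.cons PolyTime.const_nil))
  have h1 := Realizes.ite (Realizes.comp (T := fun _ => 0) (Realizes.ask (T := fun _ => 0)) hq fun _ _ => le_rfl)
    PolyTime.id.fst PolyTime.const_nil
  refine Realizes.congr (Realizes.ite PolyTime.id.snd.fst PolyTime.id.snd.fst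
    (Realizes.ite (PolyTime.nonzeroV PolyTime.id.fst) h1 PolyTime.const_nil)) fun O z => ?_
  rw [tryV]
  cases hs : z.snd.fst <;> cases hv : nonzeroV z.fst <;>
    cases hO : O (queryV z.snd.snd.snd z.snd.snd.fst.fst
      (appV z.snd.snd.fst.snd (.cons z.fst .nil))) <;> simp [hs, hv, encBool]

theorem realizes_extendV : Realizes (fun _ => 0) fun O z =>
    extendV O z.snd.snd z.fst z.snd.fst := by
  have hra : PolyTime fun z => appV z.snd.fst.fst (.cons z.fst .nil) :=
    PolyTime.appV PolyTime.id.snd.fst.fst (PolyTime.id.fst.cons PolyTime.const_nil)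
  have h1 := Realizes.fold_of_growth (l := fun z => z.snd.snd.snd.snd.snd.snd)
    (i := fun _ => .nil)
    (e := fun z => .cons (.cons (appV z.snd.fst.fst (.cons z.fst .nil)) z.snd.fst.snd) z.snd.snd)
    realizes_tryV ⟨1, fun O a s e => by
      have := size_tryV_le O e.snd e.fst.fst e.fst.snd a s
      simp only [Val.fst_cons, Val.snd_cons, pow_one]
      omega⟩ PolyTime.id.snd.snd.snd.snd.snd.snd PolyTime.const_nil
      ((hra.cons PolyTime.id.snd.fst.snd).cons PolyTime.id.snd.snd)
  have happ : PolyTime fun y => appV y.fst (.cons y.snd .nil) :=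
    PolyTime.appV PolyTime.id.fst (PolyTime.id.snd.cons PolyTime.const_nil)
  refine Realizes.congr (Realizes.pair hra (Realizes.comp (T := fun _ => 0) happ
    (Realizes.pair PolyTime.id.snd.fst.snd h1) fun _ _ => le_rfl)) fun O z => ?_
  simp [extendV]

theorem realizes_searchV : Realizes (fun _ => 0) searchV := by
  have h1 := Realizes.fold_of_growth (l := stdRowsV) (i := fun _ => .cons .nil .nil)
    (e := fun z => z) realizes_extendV ⟨4, fun O a s e => by
      have h1 := size_foldV_le (fun v f =>
        size_tryV_le O e (appV s.fst (.cons a .nil)) s.snd v f) .nil e.snd.snd.snd.snd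
      have h2 := size_appV s.fst (.cons a .nil)
      have h3 := size_appV s.snd (.cons (foldV (fun v f =>
        (tryV O e (appV s.fst (.cons a .nil)) s.snd v f).1) .nil e.snd.snd.snd.snd) .nil)
      have h4 : e.snd.snd.snd.snd.size ≤ e.size :=
        (Val.size_snd_le _).trans ((Val.size_snd_le _).trans ((Val.size_snd_le _).trans
          (Val.size_snd_le _)))
      have h5 : s.fst.size + s.snd.size ≤ s.size + 1 := by cases s <;> simp; omega
      have h6 := a.size_pos
      have h7 := e.size_pos
      -- The growth is linear in the sizes of the entry and the environment. The base is at least 3,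
      -- so raising the exponent to 4 covers the constant factor.
      have h8 : 3 ^ 3 * (a.size + e.size + 1) ≤ (a.size + e.size + 1) ^ 4 := by
        rw [pow_succ _ 3]
        exact Nat.mul_le_mul_right _ (Nat.pow_le_pow_left (by omega) 3)
      simp only [Val.fst_cons, Val.snd_cons, extendV, Val.size_cons, Val.size_nil] at *
      omega⟩ (PolyTime.stdRowsV PolyTime.id) (PolyTime.const _) PolyTime.id
  have hmap : PolyTime fun s => .cons .nil (mapV Val.fst s.snd) :=
    PolyTime.const_nil.cons (PolyTime.mapV (h := fun a _ => a.fst) PolyTime.id.fst.fst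
      PolyTime.id.snd)
  refine Realizes.congr (Realizes.comp (T := fun _ => 0) hmap h1 fun _ _ => le_rfl) fun O z => ?_
  simp [searchV]

end Realize

/-! ### Preparation of the environment -/

/-- The residues modulo the characteristic. -/
def primeFieldV (x : Val) : Val := residuesV (unaryV x.fst.fst)

/-- The field elements. -/
def elementsV (x : Val) : Val := powV (primeFieldV x) x.fst.snd

/-- The rows. -/
def rowsV (x : Val) : Val := powV (elementsV x) x.snd.fst

/-- The constants `0`, `1` and `-1`, from the residues and a list of the length of the degree. -/
def constsV (r c : Val) : Val :=
  .cons (constV .nil c) (.cons (.cons (encNat 1) (constV .nil c).snd)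
    (.cons r.snd.fst.snd (constV .nil c).snd))

/-- The environment of the search. -/
def envV (x : Val) : Val :=
  .cons (constsV (primeFieldV x) x.fst.snd)
    (.cons x.snd.fst (.cons x.snd.snd.fst (.cons x.snd.snd.snd (rowsV x))))

/-- The cost parameter of the preparation. -/
def envCost (x : Val) : ℕ :=
  unaryCost x.fst.fst + powCost (primeFieldV x) x.fst.snd + powCost (elementsV x) x.snd.fst

/-- Each enumeration keeps the earlier results beside its own. The three expensive stages therefore
run once each, and their cost parameters add up to `envCost`. -/
theorem realizes_envV : Realizes envCost fun _ x => (envV x, []) := by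
  have h1 : Realizes envCost fun _ x => (.cons (primeFieldV x) x, []) := by
    have h := Realizes.pair (T := envCost)
      ((realizes_unaryV PolyTime.id.fst.fst).mono' fun x => by rw [envCost]; omega)
      (Realizes.of_zero PolyTime.id)
    have h' : PolyTime fun y => .cons (residuesV y.fst) y.snd :=
      (PolyTime.residuesV PolyTime.id.fst).cons PolyTime.id.snd
    refine Realizes.congr (Realizes.comp h' h fun _ _ => Nat.zero_le _) fun O x => ?_
    simp [primeFieldV]
  have h2 : Realizes envCost fun _ x => (.cons (elementsV x) (.cons (primeFieldV x) x), []) := by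
    have h := Realizes.pair (realizes_powV PolyTime.id.fst PolyTime.id.snd.fst.snd)
      (Realizes.of_zero PolyTime.id)
    refine Realizes.congr (Realizes.comp h h1 fun O x => ?_) fun O x => ?_
    · simp only [Val.fst_cons, Val.snd_cons, envCost]
      omega
    · simp [elementsV]
  have h3 : Realizes envCost fun _ x =>
      (.cons (rowsV x) (.cons (elementsV x) (.cons (primeFieldV x) x)), []) := by
    have h := Realizes.pair (realizes_powV PolyTime.id.fst PolyTime.id.snd.snd.snd.fst)
      (Realizes.of_zero PolyTime.id)
    refine Realizes.congr (Realizes.comp h h2 fun O x => ?_) fun O x => ?_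
    · simp only [Val.fst_cons, Val.snd_cons, envCost]
      omega
    · simp [rowsV]
  have h4 : PolyTime fun y => .cons (constsV y.snd.snd.fst y.snd.snd.snd.fst.snd)
      (.cons y.snd.snd.snd.snd.fst (.cons y.snd.snd.snd.snd.snd.fst
        (.cons y.snd.snd.snd.snd.snd.snd y.fst))) := by
    have hx : PolyTime fun y => y.snd.snd.snd := PolyTime.id.snd.snd.snd
    have hz : PolyTime fun y => constV .nil y.snd.snd.snd.fst.snd :=
      PolyTime.constV PolyTime.const_nil hx.fst.snd
    exact (hz.cons (((PolyTime.const _).cons hz.snd).cons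
      ((PolyTime.id.snd.snd.fst.snd.fst.snd).cons hz.snd))).cons
      (hx.snd.fst.cons (hx.snd.snd.fst.cons (hx.snd.snd.snd.cons PolyTime.id.fst)))
  refine Realizes.congr (Realizes.comp h4 h3 fun _ _ => Nat.zero_le _) fun O x => ?_
  simp [envV]

/-- The search-to-decision reduction. -/
def reductionV (O : Val → Bool) (x : Val) : Val × List Val :=
  iteV (encBool (O x.snd)) ((searchV O (envV x)).1, x.snd :: (searchV O (envV x)).2)
    (.nil, [x.snd])

theorem realizes_reductionV : Realizes envCost reductionV := by
  have h1 : Realizes envCost fun O x => (encBool (O x.snd), [x.snd]) :=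
    Realizes.comp (T := envCost) (Realizes.ask (T := fun _ => 0))
      (Realizes.of_zero PolyTime.id.snd) fun _ _ => Nat.zero_le _
  have h2 := Realizes.comp realizes_searchV realizes_envV fun _ _ => Nat.zero_le _
  refine Realizes.congr (Realizes.ite h1 h2 (Realizes.of_zero PolyTime.const_nil)) fun O x => ?_
  rw [reductionV]
  cases O x.snd <;> simp [encBool]

/-! ### Enumeration of the field and of the rows -/

theorem map_getD_finRange {R : Type*} (d : R) {n : ℕ} {l : List R} (h : l.length = n) :
    (List.finRange n).map (fun i : Fin n => l.getD i d) = l := by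
  subst h
  refine List.ext_getElem (by simp) fun i h1 h2 => ?_
  simp

theorem length_residues (p : ℕ) : (residues p).length = p := by simp [residues]

section Enumeration
variable {p : ℕ} {F : Type*} [Field F] [Algebra (ZMod p) F] (pb : PowerBasis (ZMod p) F) {n : ℕ}

/-- The field elements in the order of enumeration. -/
noncomputable def elements : List F :=
  (allLists (residues p) pb.dim).map fun l => pb.basis.equivFun.symm fun i => l.getD i 0

/-- The rows in the order of enumeration. -/
noncomputable def rowVectors (n : ℕ) : List (Fin n → F) :=
  (allLists (elements pb) n).map fun l i => l.getD i 0

theorem encElt_equivFun_symm (c : Fin pb.dim → ZMod p) :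
    encElt pb (pb.basis.equivFun.symm c) = encList (fun i => encZMod (c i))
      (List.finRange pb.dim) := by
  rw [encElt, List.ofFn_eq_map, encList_map]
  refine encList_congr fun i _ => ?_
  rw [← Module.Basis.equivFun_apply, LinearEquiv.apply_symm_apply]

variable [Fact p.Prime]

theorem mem_elements (a : F) : a ∈ elements pb := by
  refine List.mem_map.mpr ⟨List.ofFn (pb.basis.equivFun a), ?_, ?_⟩
  · have := mem_allLists (b := residues p) mem_residues (List.ofFn (pb.basis.equivFun a))
    rwa [List.length_ofFn] at this
  · rw [LinearEquiv.symm_apply_eq]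
    funext i
    simp

theorem mem_rowVectors (v : Fin n → F) : v ∈ rowVectors pb n := by
  refine List.mem_map.mpr ⟨List.ofFn v, ?_, ?_⟩
  · have := mem_allLists (b := elements pb) (mem_elements pb) (List.ofFn v)
    rwa [List.length_ofFn] at this
  · funext i
    simp

theorem natCard_eq_pow_dim : Nat.card F = p ^ pb.dim := by
  rw [Nat.card_congr pb.basis.equivFun.toEquiv]
  simp

theorem length_elements : (elements pb).length = Nat.card F := by
  rw [elements, List.length_map, length_allLists, length_residues, natCard_eq_pow_dim pb]

theorem length_rowVectors : (rowVectors pb n).length = Nat.card F ^ n := by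
  rw [rowVectors, List.length_map, length_allLists, length_elements]

theorem primeFieldV_encInput {m m' : ℕ} (A : Fin m → Matrix (Fin n) (Fin n) F)
    (B : Fin m' → Matrix (Fin n) (Fin n) F) : primeFieldV (encInput pb A B) =
      encList (fun a : ZMod p => .cons (encZMod a) (encZMod (-a))) (residues p) := by
  rw [primeFieldV, encInput, encField, Val.fst_cons, Val.fst_cons, unaryV_encNat,
    residuesV_encUnary]

theorem elementsV_encInput {m m' : ℕ} (A : Fin m → Matrix (Fin n) (Fin n) F)
    (B : Fin m' → Matrix (Fin n) (Fin n) F) : elementsV (encInput pb A B) =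
      encList (fun a => .cons (encElt pb a) (encElt pb (-a))) (elements pb) := by
  rw [elementsV, primeFieldV_encInput, encInput, encField, Val.fst_cons, Val.snd_cons,
    powV_encList, List.length_ofFn, elements, encList_map]
  refine encList_congr fun l hl => ?_
  have h1 := map_getD_finRange (0 : ZMod p) (length_of_mem_allLists hl)
  rw [← map_neg, encElt_equivFun_symm, encElt_equivFun_symm, encPair]
  nth_rw 1 2 [← h1]
  rw [encList_map, encList_map]
  rfl

theorem rowsV_encInput {m m' : ℕ} (A : Fin m → Matrix (Fin n) (Fin n) F)
    (B : Fin m' → Matrix (Fin n) (Fin n) F) : rowsV (encInput pb A B) =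
      encList (encRow pb) (rowVectors pb n) := by
  rw [rowsV, elementsV_encInput, encInput, encInstance, Val.snd_cons, Val.fst_cons, encUnary,
    powV_encList, List.length_replicate, rowVectors, encList_map]
  refine encList_congr fun l hl => ?_
  have h1 := map_getD_finRange (0 : F) (length_of_mem_allLists hl)
  rw [encRow, encPair]
  nth_rw 1 2 [← h1]
  rw [encList_map, encList_map]

theorem encZMod_zero : encZMod (0 : ZMod p) = .nil := by simp [encZMod, encNat, encList]

theorem encZMod_eq_nil {a : ZMod p} : encZMod a = .nil ↔ a = 0 := by
  constructor
  · intro h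
    have h1 : a.val.bits = [] := by
      rw [encZMod, encNat] at h
      cases hb : a.val.bits with
      | nil => rfl
      | cons b l => rw [hb] at h; cases h
    have h2 : a.val.size = 0 := by rw [← Nat.size_eq_bits_len, h1]; rfl
    exact (ZMod.val_eq_zero a).mp (Nat.size_eq_zero.mp h2)
  · rintro rfl
    exact encZMod_zero

/-- The first vector of the power basis is 1, so a scalar `c` of the prime field has coordinates `c,
0, …, 0`. The coordinate of `-1` is stored with the second residue, which exists because `p ≥ 2`. -/
theorem constsV_encInput {m m' : ℕ} (A : Fin m → Matrix (Fin n) (Fin n) F)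
    (B : Fin m' → Matrix (Fin n) (Fin n) F) :
    constsV (primeFieldV (encInput pb A B)) (encInput pb A B).fst.snd = encConsts pb := by
  have hp : 2 ≤ p := (Fact.out : p.Prime).two_le
  have : Fact (1 < p) := ⟨hp⟩
  obtain ⟨d, hd⟩ : ∃ d, pb.dim = d + 1 := ⟨pb.dim - 1, by have := pb.dim_pos; omega⟩
  have hc : constV .nil (encInput pb A B).fst.snd = encUnary pb.dim := by
    rw [encInput, encField, Val.fst_cons, Val.snd_cons, constV_encList,
      encUnary_eq _ _ fun _ _ => rfl, List.length_ofFn]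
  have hone : (1 : F) = pb.basis ⟨0, pb.dim_pos⟩ := by simp
  have hcoord : ∀ c : ZMod p, encElt pb (c • (1 : F)) = .cons (encZMod c) (encUnary d) := by
    intro c
    rw [encElt, hone, map_smul, Module.Basis.repr_self, List.ofFn_congr hd, List.ofFn_succ, encList]
    congr 1
    · simp [Finsupp.single_apply, Fin.ext_iff]
    · rw [encUnary_eq _ _, List.length_ofFn]
      intro a ha
      obtain ⟨i, rfl⟩ := List.mem_ofFn.mp ha
      rw [encZMod_eq_nil]
      simp [Fin.ext_iff]
  have h0 := hcoord 0
  have h1 := hcoord 1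
  have h2 := hcoord (-1)
  rw [zero_smul] at h0
  rw [one_smul] at h1
  rw [neg_smul, one_smul] at h2
  have hres : (primeFieldV (encInput pb A B)).snd.fst.snd = encZMod (-1 : ZMod p) := by
    obtain ⟨k, rfl⟩ : ∃ k, p = k + 2 := ⟨p - 2, by omega⟩
    rw [primeFieldV_encInput, residues, List.range_succ_eq_map, List.range_succ_eq_map]
    simp [encList]
  have h3 : encZMod (1 : ZMod p) = encNat 1 := by rw [encZMod, ZMod.val_one]
  rw [constsV, hc, hres, encConsts, h0, h1, h2, h3, hd, encZMod_zero]
  rfl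

theorem envV_encInput {m m' : ℕ} (A : Fin m → Matrix (Fin n) (Fin n) F)
    (B : Fin m' → Matrix (Fin n) (Fin n) F) : envV (encInput pb A B) =
      .cons (encConsts pb) (.cons (encUnary n) (.cons (encTuple pb A) (.cons (encTuple pb B)
        (encList (encRow pb) (rowVectors pb n))))) := by
  rw [envV, constsV_encInput, rowsV_encInput]
  rfl

end Enumeration

/-! ### Correctness of the search -/

/-- A fold that searches for the first good entry of a list. -/
theorem foldV_find {V : Type*} {H : Val → Val → Val × List Val} {enc : V → Val} {good : V → Prop}
    {Q : Val → Prop} (henc : ∀ v, enc v ≠ .nil) (hkeep : ∀ a s, s ≠ .nil → H a s = (s, []))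
    (hstep : ∀ v, ((good v ∧ (H (enc v) .nil).1 = enc v) ∨ (¬ good v ∧ (H (enc v) .nil).1 = .nil)) ∧
      (H (enc v) .nil).2.length ≤ 1 ∧ ∀ w ∈ (H (enc v) .nil).2, Q w)
    {l : List V} (hl : ∃ v ∈ l, good v) :
    ∃ v, good v ∧ foldV (fun a s => (H a s).1) .nil (encList enc l) = enc v ∧
      (foldQ H .nil (encList enc l)).length ≤ l.length ∧
      ∀ w ∈ foldQ H .nil (encList enc l), Q w := by
  have hfound : ∀ (l : List V) (s : Val), s ≠ .nil →
      foldV (fun a s => (H a s).1) s (encList enc l) = s ∧ foldQ H s (encList enc l) = [] := by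
    intro l s hs
    induction l with
    | nil => exact ⟨rfl, rfl⟩
    | cons a l ih => simpa [encList, foldV, foldQ, hkeep _ s hs] using ih
  induction l with
  | nil => simp at hl
  | cons a l ih =>
    obtain ⟨hor, hlen, hQ⟩ := hstep a
    simp only [encList, foldV, foldQ, List.length_append, List.mem_append, List.length_cons]
    rcases hor with ⟨hg, e⟩ | ⟨hg, e⟩
    · obtain ⟨e1, e2⟩ := hfound l (enc a) (henc a)
      refine ⟨a, hg, ?_⟩
      rw [e, e1, e2]
      exact ⟨rfl, by simp; omega, fun w hw => hQ w (by simpa using hw)⟩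
    · obtain ⟨v, h1, h2, h3, h4⟩ := ih (by simpa [hg] using hl)
      refine ⟨v, h1, ?_⟩
      rw [e]
      exact ⟨h2, by omega, fun w hw => hw.elim (hQ w) (h4 w)⟩

/-! ### Lists of rows as padded matrices -/

section Rows
variable {F : Type*} [Field F] {n : ℕ}

theorem rowMatrix_mul (l : List (Fin n → F)) (P : Matrix (Fin n) (Fin n) F) :
    rowMatrix l * P = rowMatrix (l.map fun v => Matrix.vecMul v P) := by
  ext i j
  rw [Matrix.mul_apply_eq_vecMul, rowMatrix_apply, rowMatrix_apply]
  by_cases h : (i : ℕ) < l.length <;> simp [h]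

/-- Padding by zero rows forgets only the length of the list, which is prescribed here. -/
theorem rowMatrix_injOn {l l' : List (Fin n → F)} (hl : l.length = l'.length)
    (hn : l.length ≤ n + 1) (h : rowMatrix l = rowMatrix l') : l = l' := by
  refine List.ext_getElem hl fun i h1 h2 => ?_
  have := congrFun h ⟨i, by omega⟩
  rw [rowMatrix_apply, rowMatrix_apply] at this
  simpa [h1, h2] using this

theorem rowMatrix_ne_zero {l : List (Fin n → F)} (hn : l.length ≤ n + 1) {v : Fin n → F}
    (hv : v ∈ l) (hv0 : v ≠ 0) : rowMatrix l ≠ 0 := by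
  obtain ⟨i, hi, rfl⟩ := List.getElem_of_mem hv
  intro h
  have := congrFun h ⟨i, by omega⟩
  rw [rowMatrix_apply] at this
  rw [List.getD_eq_getElem _ _ hi] at this
  exact hv0 this

end Rows

section Search
variable {p : ℕ} {F : Type*} [Field F] [Algebra (ZMod p) F] (pb : PowerBasis (ZMod p) F)
  {n m m' : ℕ}

theorem encBool_eq_nil {b : Bool} : encBool b = .nil ↔ b = false := by cases b <;> simp [encBool]

theorem encRow_ne_nil (v : Fin n → F) : encRow pb v ≠ .nil := by simp [encRow]

theorem appV_encList_singleton {T : Type*} (enc : T → Val) (l : List T) (a : T) :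
    appV (encList enc l) (.cons (enc a) .nil) = encList enc (l ++ [a]) := by
  rw [encList_append]
  rfl

/-- The environment of the search as an encoding. -/
noncomputable def encEnv (A : Fin m → Matrix (Fin n) (Fin n) F)
    (B : Fin m' → Matrix (Fin n) (Fin n) F) : Val :=
  .cons (encConsts pb) (.cons (encUnary n) (.cons (encTuple pb A) (.cons (encTuple pb B)
    (encList (encRow pb) (rowVectors pb n)))))

theorem queryV_encEnv (A : Fin m → Matrix (Fin n) (Fin n) F)
    (B : Fin m' → Matrix (Fin n) (Fin n) F) {r r' : List (Fin n → F)} (hr : r.length ≤ n + 1)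
    (hr' : r'.length ≤ n + 1) :
    queryV (encEnv pb A B) (encList (encRow pb) r) (encList (encRow pb) r') =
      encInstance pb (gadgetTuple A (rowMatrix r)) (gadgetTuple B (rowMatrix r')) := by
  simp only [queryV, encEnv, Val.fst_cons, Val.snd_cons]
  rw [gadgetV_eq pb A r hr, gadgetV_eq pb B r' hr', gadgetLabelsV_eq, constV_encList,
    encUnary_eq _ _ fun _ _ => rfl]
  rfl

theorem stdRowsV_encEnv (A : Fin m → Matrix (Fin n) (Fin n) F)
    (B : Fin m' → Matrix (Fin n) (Fin n) F) : stdRowsV (encEnv pb A B) =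
      encList (encRow pb) ((List.finRange n).map fun i => Pi.single i 1) := by
  simp only [stdRowsV, encEnv, encConsts, Val.fst_cons, Val.snd_cons]
  rw [rangeV_encUnary', mapV_encList, encList_map]
  refine encList_congr fun i _ => ?_
  rw [encRow, mapV_encList, mapV_encList]
  congr 1 <;> refine encList_congr fun j _ => ?_ <;>
    rw [eqV_encUnary, iteV_encBool, Pi.single_apply]
  · by_cases h : i = j
    · simp [h]
    · simp [Fin.val_inj, h, Ne.symm h]
  · by_cases h : i = j
    · simp [h]
    · simp [Fin.val_inj, h, Ne.symm h]

variable [Fact p.Prime]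

theorem anyV_encElt (a : F) : anyV (fun c => c) (encElt pb a) = .nil ↔ a = 0 := by
  rw [encElt, anyV_encList _ _ (fun c => decide (c ≠ 0)) _ fun c _ => by simp [encZMod_eq_nil],
    encBool_eq_nil, List.any_eq_false]
  simp only [List.mem_ofFn]
  constructor
  · intro h
    rw [← pb.basis.repr.map_eq_zero_iff]
    ext i
    simpa using h _ ⟨i, rfl⟩
  · rintro rfl _ ⟨i, rfl⟩
    simp

open Classical in
theorem nonzeroV_encRow (v : Fin n → F) : nonzeroV (encRow pb v) = .nil ↔ v = 0 := by
  rw [nonzeroV, encRow, Val.fst_cons,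
    anyV_encList _ _ (fun j => decide (v j ≠ 0)) _ fun j _ => by simp [anyV_encElt],
    encBool_eq_nil, List.any_eq_false]
  simp [funext_iff]

variable {pb} {O : Val → Bool} {A : Fin m → Matrix (Fin n) (Fin n) F}
  {B : Fin m' → Matrix (Fin n) (Fin n) F}

/-- The image of `r` under the given isometry passes the test, so the search succeeds. The row found
may be a different one, but then the oracle's answer supplies another isometry with the same earlier
images. Zero rows are skipped, which keeps both frames nonzero and hence every query a legitimate
instance. -/
theorem extendV_encEnv (hO : IsDecisionOracle pb O) (hn : 1 ≤ n) (hA : IsAltBasis A)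
    (hB : IsAltBasis B)
    {pre ts : List (Fin n → F)} {r : Fin n → F} (hr : r ≠ 0)
    (hpre : pre.length ≤ n)
    (h : ∃ P, IsCongruence P (space A) (space B) ∧ pre.map (fun v => Matrix.vecMul v P) = ts) :
    ∃ v, (∃ P, IsCongruence P (space A) (space B) ∧
        (pre ++ [r]).map (fun v => Matrix.vecMul v P) = ts ++ [v]) ∧
      (extendV O (encEnv pb A B) (encRow pb r)
        (.cons (encList (encRow pb) pre) (encList (encRow pb) ts))).1 =
        .cons (encList (encRow pb) (pre ++ [r])) (encList (encRow pb) (ts ++ [v])) ∧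
      (extendV O (encEnv pb A B) (encRow pb r)
        (.cons (encList (encRow pb) pre) (encList (encRow pb) ts))).2.length ≤ Nat.card F ^ n ∧
      ∀ w ∈ (extendV O (encEnv pb A B) (encRow pb r)
        (.cons (encList (encRow pb) pre) (encList (encRow pb) ts))).2,
        IsInstanceOfSize pb (30 * n ^ 2) w := by
  obtain ⟨P, hP, hts⟩ := h
  have hlen : ts.length = pre.length := by rw [← hts, List.length_map]
  have hS : rowMatrix (pre ++ [r]) ≠ 0 := rowMatrix_ne_zero (by simp; omega) (v := r) (by simp) hr
  set good : (Fin n → F) → Prop := fun v => v ≠ 0 ∧ Isometric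
    (space (gadgetTuple A (rowMatrix (pre ++ [r])))) (space (gadgetTuple B (rowMatrix (ts ++ [v]))))
    with hgood
  have hquery : ∀ v : Fin n → F, queryV (encEnv pb A B) (encList (encRow pb) (pre ++ [r]))
      (appV (encList (encRow pb) ts) (.cons (encRow pb v) .nil)) =
      encInstance pb (gadgetTuple A (rowMatrix (pre ++ [r])))
        (gadgetTuple B (rowMatrix (ts ++ [v]))) := fun v => by
    rw [appV_encList_singleton, queryV_encEnv pb A B (by simp; omega) (by simp; omega)]
  have hT : ∀ v : Fin n → F, v ≠ 0 → rowMatrix (ts ++ [v]) ≠ 0 := fun v hv =>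
    rowMatrix_ne_zero (by simp; omega) (v := v) (by simp) hv
  -- The candidate that guarantees success: it is nonzero because `P` is invertible.
  have hgoodP : good (Matrix.vecMul r P) := by
    refine ⟨fun h0 => hr ?_, (isometric_gadgetTuple_iff hn A B hS).mpr ⟨P, hP, ?_⟩⟩
    · obtain ⟨u, rfl⟩ := hP.1
      have : Matrix.vecMul (Matrix.vecMul r u.1) u⁻¹.1 = 0 := by rw [h0, Matrix.zero_vecMul]
      rwa [Matrix.vecMul_vecMul, u.mul_inv, Matrix.vecMul_one] at this
    · rw [rowMatrix_mul, List.map_append, hts]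
      rfl
  obtain ⟨v, ⟨hv0, hv⟩, h1, h2, h3⟩ := foldV_find (enc := encRow pb) (good := good)
    (H := fun v f => tryV O (encEnv pb A B) (encList (encRow pb) (pre ++ [r]))
      (encList (encRow pb) ts) v f) (Q := IsInstanceOfSize pb (30 * n ^ 2)) (encRow_ne_nil pb)
    (fun a s hs => by
      cases s
      · exact absurd rfl hs
      · rfl)
    (fun v => by
      rw [tryV, iteV_nil, hquery]
      by_cases hv : v = 0
      · rw [(nonzeroV_encRow pb v).mpr hv]
        simp [hgood, hv]
      · have hne := mt (nonzeroV_encRow pb v).mp hv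
        have hsize : IsInstanceOfSize pb (30 * n ^ 2)
            (encInstance pb (gadgetTuple A (rowMatrix (pre ++ [r])))
              (gadgetTuple B (rowMatrix (ts ++ [v])))) :=
          ⟨_, _, _, _, _, isAltBasis_gadgetTuple hA hS, isAltBasis_gadgetTuple hB (hT v hv), rfl,
            length_gadgetList_le hn, length_formList_le hn (card_le_sq hA),
            length_formList_le hn (card_le_sq hB)⟩
        have hdec := hO _ _ _ _ _ (isAltBasis_gadgetTuple hA hS)
          (isAltBasis_gadgetTuple hB (hT v hv))
        cases hc : nonzeroV (encRow pb v) with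
        | nil => exact absurd hc hne
        | cons a b =>
          cases hq : O (encInstance pb (gadgetTuple A (rowMatrix (pre ++ [r])))
            (gadgetTuple B (rowMatrix (ts ++ [v])))) with
          | false =>
            have : ¬ good v := fun h => by simp [hdec.mpr h.2] at hq
            simp [encBool, this, hsize]
          | true =>
            have : good v := ⟨hv, hdec.mp hq⟩
            simp [encBool, this, hsize])
    ⟨_, mem_rowVectors pb _, hgoodP⟩
  have hvs : (encEnv pb A B).snd.snd.snd.snd = encList (encRow pb) (rowVectors pb n) := rfl
  refine ⟨v, ?_, ?_⟩
  -- The isometry `Q` need not be `P`; equality of the padded row matrices gives back equality of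
  -- the images row by row.
  · obtain ⟨Q, hQ, hST⟩ := (isometric_gadgetTuple_iff hn A B hS).mp hv
    rw [rowMatrix_mul] at hST
    exact ⟨Q, hQ, rowMatrix_injOn (by simp [hlen]) (by simp; omega) hST⟩
  · simp only [extendV, Val.fst_cons, Val.snd_cons, hvs, appV_encList_singleton]
    rw [h1, appV_encList_singleton]
    rw [length_rowVectors] at h2
    exact ⟨rfl, h2, h3⟩

/-- The invariant is that some isometry realizes all images chosen so far. The isometry may change
from round to round, whereas the chosen images persist. -/
theorem foldV_extendV (hO : IsDecisionOracle pb O) (hn : 1 ≤ n) (hA : IsAltBasis A)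
    (hB : IsAltBasis B)
    {es : List (Fin n → F)} (hes : ∀ r ∈ es, r ≠ 0) {pre ts : List (Fin n → F)}
    (hpre : pre.length + es.length ≤ n + 1)
    (h : ∃ P, IsCongruence P (space A) (space B) ∧ pre.map (fun v => Matrix.vecMul v P) = ts) :
    ∃ P, IsCongruence P (space A) (space B) ∧
      foldV (fun a s => (extendV O (encEnv pb A B) a s).1)
        (.cons (encList (encRow pb) pre) (encList (encRow pb) ts)) (encList (encRow pb) es) =
        .cons (encList (encRow pb) (pre ++ es))
          (encList (encRow pb) ((pre ++ es).map fun v => Matrix.vecMul v P)) ∧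
      (foldQ (fun a s => extendV O (encEnv pb A B) a s)
        (.cons (encList (encRow pb) pre) (encList (encRow pb) ts))
        (encList (encRow pb) es)).length ≤ es.length * Nat.card F ^ n ∧
      ∀ w ∈ foldQ (fun a s => extendV O (encEnv pb A B) a s)
        (.cons (encList (encRow pb) pre) (encList (encRow pb) ts)) (encList (encRow pb) es),
        IsInstanceOfSize pb (30 * n ^ 2) w := by
  induction es generalizing pre ts with
  | nil =>
    obtain ⟨P, hP, rfl⟩ := h
    exact ⟨P, hP, by simp [encList, foldV], by simp [encList, foldQ], by simp [encList, foldQ]⟩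
  | cons r es ih =>
    simp only [List.length_cons] at hpre
    obtain ⟨v, h1, h2, h3, h4⟩ := extendV_encEnv hO hn hA hB (hes r (by simp)) (by omega) h
    obtain ⟨P, hP, e1, e2, e3⟩ := ih (fun r' hr' => hes r' (by simp [hr'])) (by simp; omega) h1
    refine ⟨P, hP, ?_⟩
    simp only [encList, foldV, foldQ, h2, List.length_append, List.mem_append, List.length_cons]
    rw [e1]
    refine ⟨by simp, ?_, fun w hw => hw.elim (h4 w) (e3 w)⟩
    rw [add_mul, one_mul]
    omega

/-- Once all standard rows are treated, their images are the rows of an isometry, so the list of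
images is already the encoded answer. -/
theorem searchV_encEnv (hO : IsDecisionOracle pb O) (hn : 1 ≤ n) (hA : IsAltBasis A)
    (hB : IsAltBasis B)
    (h : Isometric (space A) (space B)) :
    ∃ P, IsCongruence P (space A) (space B) ∧
      (searchV O (encEnv pb A B)).1 = .cons .nil (encMatrix pb P) ∧
      (searchV O (encEnv pb A B)).2.length ≤ n * Nat.card F ^ n ∧
      ∀ w ∈ (searchV O (encEnv pb A B)).2, IsInstanceOfSize pb (30 * n ^ 2) w := by
  obtain ⟨P₀, hP₀⟩ := (isometric_iff _ _).mp h
  obtain ⟨P, hP, h1, h2, h3⟩ := foldV_extendV (pb := pb) hO hn hA hB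
    (es := (List.finRange n).map fun i => Pi.single i 1) (by simp) (pre := []) (ts := [])
    (by simp) ⟨P₀, hP₀, rfl⟩
  refine ⟨P, hP, ?_⟩
  simp only [searchV, stdRowsV_encEnv]
  simp only [encList] at h1 h2 h3
  rw [h1]
  refine ⟨?_, by simpa using h2, h3⟩
  rw [Val.snd_cons, mapV_encList, encMatrix_eq, List.nil_append, encList_map, encList_map]
  simp [encRow]

/-- The first query passes the given instance itself to the oracle. A positive answer starts the
search, whose invariant needs an isometry to exist. -/
theorem reductionV_encInput (hO : IsDecisionOracle pb O) (hn : 1 ≤ n) (hA : IsAltBasis A)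
    (hB : IsAltBasis B) :
    ∃ y qs, reductionV O (encInput pb A B) = (y, qs) ∧
    IsSolution pb (space A) (space B) y ∧ qs.length ≤ 1 + n * Nat.card F ^ n ∧
    ∀ w ∈ qs, IsInstanceOfSize pb (30 * n ^ 2) w := by
  have hsnd : (encInput pb A B).snd = encInstance pb A B := rfl
  have hsize : IsInstanceOfSize pb (30 * n ^ 2) (encInstance pb A B) := by
    have h1 := card_le_sq hA
    have h2 := card_le_sq hB
    exact ⟨n, m, m', A, B, hA, hB, rfl, by nlinarith, by omega, by omega⟩
  have hdec := hO n m m' A B hA hB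
  have henv : envV (encInput pb A B) = encEnv pb A B := envV_encInput pb A B
  rw [reductionV, hsnd, henv]
  cases hc : O (encInstance pb A B) with
  | false =>
    refine ⟨_, _, rfl, Or.inr ⟨fun h => ?_, rfl⟩, by simp, by simpa using hsize⟩
    rw [hdec.mpr h] at hc
    cases hc
  | true =>
    obtain ⟨P, hP, h1, h2, h3⟩ := searchV_encEnv (pb := pb) hO hn hA hB (hdec.mp hc)
    refine ⟨_, _, rfl, Or.inl ?_, ?_, ?_⟩
    · obtain ⟨u, hu⟩ := hP.1
      refine ⟨u, (isIsometry_iff _ _ _).mpr (hu ▸ hP), ?_⟩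
      rw [h1, ← hu]
      rfl
    · simp
      omega
    · simpa [hsize] using h3

end Search

/-! ### The cost of the reduction -/

section Cost
variable {p : ℕ} [Fact p.Prime] {F : Type*} [Field F] [Algebra (ZMod p) F]
  (pb : PowerBasis (ZMod p) F) {n m m' : ℕ}

theorem size_encZMod_le (a : ZMod p) : (encZMod a).size ≤ 4 * p + 1 := by
  have h1 := size_encNat_le a.val
  have h2 := a.val_lt
  rw [encZMod]
  omega

theorem size_encElt_le {Z : ℕ} (hp : p ≤ Z) (hd : pb.dim ≤ Z) (a : F) :
    (encElt pb a).size ≤ Z * (4 * Z + 2) + 1 := by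
  have h := size_encList_le (e := encZMod) (l := List.ofFn fun i => pb.basis.repr a i)
    fun c _ => size_encZMod_le c
  rw [List.length_ofFn] at h
  exact h.trans (Nat.add_le_add_right (Nat.mul_le_mul hd (by omega)) 1)

theorem size_encTuple_le {Z : ℕ} (hp : p ≤ Z) (hd : pb.dim ≤ Z) (hn : n ≤ Z) (hm : m ≤ Z ^ 2)
    (A : Fin m → Matrix (Fin n) (Fin n) F) : (encTuple pb A).size ≤
      Z ^ 2 * (Z * (Z * (Z * (4 * Z + 2) + 2) + 2) + 2) + 1 := by
  refine (size_encList_le (K := Z * (Z * (Z * (4 * Z + 2) + 2) + 2) + 1) fun X _ => ?_).trans ?_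
  · refine (size_encList_le (K := Z * (Z * (4 * Z + 2) + 2) + 1) fun r hr => ?_).trans ?_
    · obtain ⟨i, rfl⟩ := List.mem_ofFn.mp hr
      refine (size_encList_le (K := Z * (4 * Z + 2) + 1) fun a _ =>
        size_encElt_le pb hp hd a).trans ?_
      rw [List.length_ofFn]
      exact Nat.add_le_add_right (Nat.mul_le_mul_right _ hn) 1
    · rw [List.length_ofFn]
      exact Nat.add_le_add_right (Nat.mul_le_mul_right _ hn) 1
  · rw [List.length_ofFn]
    exact Nat.add_le_add_right (Nat.mul_le_mul_right _ hm) 1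

/-- A polynomial bound for the cost parameters in terms of the number of rows. -/
def costBound (Z : ℕ) : ℕ :=
  (4 * Z + 1 + (Z * (4 * Z + 2) + 1) + 1 + (2 * Z + 1 +
    (2 * (Z ^ 2 * (Z * (Z * (Z * (4 * Z + 2) + 2) + 2) + 2) + 1) + 1) + 1) + 1) +
  ((4 * Z + 2) * (2 * Z + 1) + (Z + 1) * (Z * (2 * (Z * (4 * Z + 2)) + 4) + 1) +
    (Z + 1) * (Z * (2 * (Z * (Z * (4 * Z + 2) + 2)) + 4) + 1)) + 1

/-- Restricting to the subtype of numbers at least 2 provides the lower bound on the base that the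
calculus of polynomial bounds requires. -/
theorem exists_costBound_le : ∃ c, ∀ Z, 2 ≤ Z → costBound Z ≤ Z ^ c := by
  have hb : ∀ Z : {Z : ℕ // 2 ≤ Z}, 2 ≤ Z.1 := fun Z => Z.2
  have key : PolyBounded (fun Z : {Z : ℕ // 2 ≤ Z} => Z.1) fun Z => costBound Z.1 := by
    have hZ := PolyBounded.self fun Z : {Z : ℕ // 2 ≤ Z} => Z.1
    have hc := PolyBounded.const hb
    have hE := hZ.mul (((hc 4).mul hZ).add hb (hc 2))
    have hE2 := hE.add hb (hc 2)
    have htuple := ((hZ.pow 2).mul ((hZ.mul ((hZ.mul hE2).add hb (hc 2))).add hb (hc 2))).add hb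
      (hc 1)
    have hfield := ((((hc 4).mul hZ).add hb (hc 1)).add hb (hE.add hb (hc 1))).add hb (hc 1)
    have hinst := ((((hc 2).mul hZ).add hb (hc 1)).add hb
      (((hc 2).mul htuple).add hb (hc 1))).add hb (hc 1)
    have hpow : ∀ {f : {Z : ℕ // 2 ≤ Z} → ℕ}, PolyBounded (fun Z => Z.1) f →
        PolyBounded (fun Z => Z.1) fun Z => (Z.1 + 1) * (Z.1 * (2 * f Z + 4) + 1) := fun hf =>
      (hZ.add hb (hc 1)).mul ((hZ.mul (((hc 2).mul hf).add hb (hc 4))).add hb (hc 1))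
    exact ((((hfield.add hb hinst).add hb (hc 1)).add hb
      ((((((hc 4).mul hZ).add hb (hc 2)).mul (((hc 2).mul hZ).add hb (hc 1))).add hb
        (hpow hE)).add hb (hpow (hZ.mul hE2))))).add hb (hc 1)
  obtain ⟨c, hc⟩ := key
  exact ⟨c, fun Z hZ => hc ⟨Z, hZ⟩⟩

/-- The characteristic, the degree, the field size and `n` are all at most `qⁿ`. Linear independence
bounds the lengths of the tuples by `n ^ 2`. -/
theorem size_add_envCost_le (hn : 1 ≤ n) {A : Fin m → Matrix (Fin n) (Fin n) F}
    {B : Fin m' → Matrix (Fin n) (Fin n) F} (hA : IsAltBasis A) (hB : IsAltBasis B) :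
    (encInput pb A B).size + envCost (encInput pb A B) + 1 ≤ costBound (Nat.card F ^ n) := by
  have hp2 : 2 ≤ p := (Fact.out : p.Prime).two_le
  have hq := natCard_eq_pow_dim pb
  have hd1 := pb.dim_pos
  have hpq : p ≤ Nat.card F := by
    rw [hq]
    exact Nat.le_self_pow hd1.ne' p
  have hdq : pb.dim ≤ Nat.card F := by
    rw [hq]
    exact (Nat.lt_pow_self hp2).le
  have hqZ : Nat.card F ≤ Nat.card F ^ n := Nat.le_self_pow (by omega) _
  have hnZ : n ≤ Nat.card F ^ n := (Nat.lt_pow_self (by omega)).le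
  have hprime : powCost (primeFieldV (encInput pb A B)) (encInput pb A B).fst.snd ≤
      (pb.dim + 1) * (Nat.card F * (2 * (pb.dim * (4 * p + 2)) + 4) + 1) := by
    have h := foldTrace_powV encZMod (fun a : ZMod p => encZMod (-a)) (b := residues p)
      (fun h => by have := length_residues p; rw [h] at this; simp at this; omega)
      (fun r => size_encZMod_le r) (fun r => size_encZMod_le _) encZMod
      (List.ofFn fun i : Fin pb.dim => (minpoly (ZMod p) pb.gen).coeff i)
    rw [List.length_ofFn, length_residues, ← hq] at h
    rw [powCost, primeFieldV_encInput]
    exact h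
  have helts : powCost (elementsV (encInput pb A B)) (encInput pb A B).snd.fst ≤
      (n + 1) * (Nat.card F ^ n * (2 * (n * (Nat.card F ^ n * (4 * Nat.card F ^ n + 2) + 2)) + 4)
        + 1) := by
    have h := foldTrace_powV (encElt pb) (fun a => encElt pb (-a)) (b := elements pb)
      (fun h => by simpa [h] using mem_elements pb 0)
      (fun r => size_encElt_le pb (hpq.trans hqZ) (hdq.trans hqZ) r)
      (fun r => size_encElt_le pb (hpq.trans hqZ) (hdq.trans hqZ) _) encBool
      (List.replicate n false)
    rw [List.length_replicate, length_elements] at h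
    rw [powCost, elementsV_encInput]
    exact h
  have hunary : unaryCost (encInput pb A B).fst.fst ≤ (4 * p + 2) * (2 * p + 1) :=
    unaryCost_encNat p
  generalize hZ : Nat.card F ^ n = Z at *
  have hp : p ≤ Z := hpq.trans hqZ
  have hd : pb.dim ≤ Z := hdq.trans hqZ
  have hsq : n ^ 2 ≤ Z ^ 2 := Nat.pow_le_pow_left hnZ 2
  have hsA := size_encTuple_le pb hp hd hnZ ((card_le_sq hA).trans hsq) A
  have hsB := size_encTuple_le pb hp hd hnZ ((card_le_sq hB).trans hsq) B
  have hcoeff : (encList encZMod (List.ofFn fun i : Fin pb.dim =>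
      (minpoly (ZMod p) pb.gen).coeff i)).size ≤ Z * (4 * Z + 2) + 1 := by
    have h := size_encList_le (e := encZMod) (l := List.ofFn fun i : Fin pb.dim =>
      (minpoly (ZMod p) pb.gen).coeff i) fun c _ => size_encZMod_le c
    rw [List.length_ofFn] at h
    exact h.trans (Nat.add_le_add_right (Nat.mul_le_mul hd (by omega)) 1)
  have hpn := size_encNat_le p
  have hun := size_encUnary n
  have h1 : (4 * p + 2) * (2 * p + 1) ≤ (4 * Z + 2) * (2 * Z + 1) :=
    Nat.mul_le_mul (by omega) (by omega)
  have h2 : (pb.dim + 1) * (Nat.card F * (2 * (pb.dim * (4 * p + 2)) + 4) + 1) ≤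
      (Z + 1) * (Z * (2 * (Z * (4 * Z + 2)) + 4) + 1) := by gcongr
  have h3 : (n + 1) * (Z * (2 * (n * (Z * (4 * Z + 2) + 2)) + 4) + 1) ≤
      (Z + 1) * (Z * (2 * (Z * (Z * (4 * Z + 2) + 2)) + 4) + 1) := by gcongr
  have hsize : (encInput pb A B).size = (encNat p).size + (encList encZMod (List.ofFn
      fun i : Fin pb.dim => (minpoly (ZMod p) pb.gen).coeff i)).size + 1 + ((encUnary n).size +
      ((encTuple pb A).size + (encTuple pb B).size + 1) + 1) + 1 := rfl
  rw [hsize, envCost, costBound]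
  omega

end Cost
end AltMatSpace

/-! ### The reduction theorem -/

open AltMatSpace

theorem mainTheorem5 :
    ∃ (M : Prog) (C : ℕ),
      ∀ (p : ℕ) [Fact p.Prime] (F : Type*) [Field F] [Algebra (ZMod p) F]
        (pb : PowerBasis (ZMod p) F) (O : Val → Bool), IsDecisionOracle pb O →
      ∀ (n m m' : ℕ), 1 ≤ n →
      ∀ (A : Fin m → Matrix (Fin n) (Fin n) F) (B : Fin m' → Matrix (Fin n) (Fin n) F),
        IsAltBasis A → IsAltBasis B →
        ∃ (y : Val) (t : ℕ) (qs : List Val),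
          Run O M (encInput pb A B) y t qs ∧
          IsSolution pb (space A) (space B) y ∧
          t ≤ Nat.card F ^ (C * n) * n.factorial ∧
          t ≤ Nat.card F ^ (C * (n * (Nat.log 2 n + 1))) ∧
          qs.length ≤ Nat.card F ^ (C * n) ∧
          ∀ w ∈ qs, IsInstanceOfSize pb (C * n ^ 2) w := by
  obtain ⟨M, c, hM⟩ := realizes_reductionV
  obtain ⟨d, hd⟩ := exists_costBound_le
  -- The product `d * c` is the exponent of the running time in terms of `qⁿ`; 30 bounds the query
  -- sizes and also covers the exponent 3 of the query count.
  refine ⟨M, d * c + 30, fun p _ F _ _ pb O hO n m m' hn A B hA hB => ?_⟩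
  obtain ⟨y, qs, hr, hsol, hlen, hqs⟩ := reductionV_encInput hO hn hA hB
  obtain ⟨t, hrun, ht⟩ := hM O (encInput pb A B)
  rw [hr] at hrun
  have hp2 : 2 ≤ p := (Fact.out : p.Prime).two_le
  have hq2 : 2 ≤ Nat.card F := by
    rw [natCard_eq_pow_dim pb]
    exact hp2.trans (Nat.le_self_pow pb.dim_pos.ne' p)
  have hZ2 : 2 ≤ Nat.card F ^ n := hq2.trans (Nat.le_self_pow (by omega) _)
  have hnZ : n ≤ Nat.card F ^ n := (Nat.lt_pow_self hq2).le
  have hmono : ∀ {k l : ℕ}, k ≤ l → Nat.card F ^ k ≤ Nat.card F ^ l := fun h =>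
    Nat.pow_le_pow_right (by omega) h
  have htime : t ≤ Nat.card F ^ ((d * c + 30) * n) := by
    calc t ≤ costBound (Nat.card F ^ n) ^ c :=
          ht.trans (Nat.pow_le_pow_left (size_add_envCost_le pb hn hA hB) c)
      _ ≤ ((Nat.card F ^ n) ^ d) ^ c := Nat.pow_le_pow_left (hd _ hZ2) c
      _ = Nat.card F ^ (d * c * n) := by rw [← pow_mul, ← pow_mul]; congr 1; ring
      _ ≤ _ := hmono (Nat.mul_le_mul_right n (by omega))
  refine ⟨y, t, qs, hrun, hsol, ?_, ?_, ?_, ?_⟩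
  -- The time is already at most `q^(Cn)`, so both stated bounds follow: the factors `n!` and `⌊log₂
  -- n⌋ + 1` are at least 1.
  · exact htime.trans (Nat.le_mul_of_pos_right _ n.factorial_pos)
  · exact htime.trans (hmono (Nat.mul_le_mul_left _ (Nat.le_mul_of_pos_right _ (by omega))))
  · calc qs.length ≤ 1 + n * Nat.card F ^ n := hlen
      -- With `Z = qⁿ ≥ 2` and `n ≤ Z`, one has `1 + n Z ≤ 1 + Z² ≤ Z³`.
      _ ≤ (Nat.card F ^ n) ^ 3 := by
          generalize Nat.card F ^ n = Z at *
          nlinarith [Nat.mul_le_mul_right Z hnZ, Nat.mul_le_mul_right (Z * Z) hZ2]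
      _ = Nat.card F ^ (3 * n) := by rw [← pow_mul]; congr 1; ring
      _ ≤ _ := hmono (Nat.mul_le_mul_right n (by omega))
  · intro w hw
    obtain ⟨N, k, k', A', B', h1, h2, h3, h4, h5, h6⟩ := hqs w hw
    have : 30 * n ^ 2 ≤ (d * c + 30) * n ^ 2 := Nat.mul_le_mul_right _ (by omega)
    exact ⟨N, k, k', A', B', h1, h2, h3, h4.trans this, h5.trans this, h6.trans this⟩
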